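/- **Setting.** Let $(V,g)$ be a smooth pseudo-Riemannian manifold (any signature) of dimension $N>3$ with Levi-Civita connection $\nabla$. Consider a smooth foliation of $V$ of codimension $p\ge 1$: a partition of $V$ into injectively immersed (for instance embedded) submanifolds of dimension $N-p$, the leaves, whose tangent spaces form a smooth distribution $D$. Assume the foliation is non-degenerate, i.e. the metric induced by $g$ on each leaf is non-degenerate. Let $\Pi$ be the $g$-orthogonal projector of $TV$ onto $D$ and $P=1-\Pi$ the projector onto $D^{\perp}$. Indices are raised and lowered with $g$, square brackets denote antisymmetrization with factor $\tfrac12$, and the curvature $R_{abc}{}^d$ of a torsion-free connection is normalized by $\nabla_a\nabla_bX^c-\nabla_b\nabla_aX^c=R_{bad}{}^cX^d$. Put $$M_{abc}=\nabla_bP_{ac}+\nabla_cP_{ab}-\nabla_aP_{bc},\qquad E_a=M_{acb}P^{cb},\qquad W_a=-M_{acb}\Pi^{cb},$$ $$L^a{}_{bc}=\frac{1}{2p}(E_bP^a{}_c+E_cP^a{}_b)+\frac{1}{2(N-p)}(W_b\Pi^a{}_c+W_c\Pi^a{}_b)+\frac12(P^a{}_d-\Pi^a{}_d)M^d{}_{bc}.$$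 The bi-conformal connection $\bar\nabla$ is the torsion-free connection whose coefficients are those of $\nabla$ plus $L^a{}_{bc}$; let $\bar R_{abc}{}^d$ be its curvature. Define $$\bar R^\Pi=\Pi^d{}_r\bar R_{bdc}{}^r\Pi^{cb},$$ $$L^\Pi_{bc}=2\Big(\Pi^d{}_r\bar R_{bdc}{}^r-\frac1{N-p}\big(\Pi^d{}_c\Pi^r{}_q\bar R_{bdr}{}^q+\Pi^d{}_b\Pi^r{}_q\bar R_{cdr}{}^q-\Pi^r{}_q\bar R_{cbr}{}^q\big)\Big)+\frac{\bar R^\Pi}{1-N+p}\Pi_{bc},$$ $$T_{bac}{}^d=2\bar R_{bac}{}^d-\frac{2}{2-N+p}\big(\Pi^d{}_cL^\Pi_{[ab]}+\Pi^d{}_{[b}L^\Pi_{a]c}+\Pi_{c[a}L^\Pi_{b]q}\Pi^{qd}\big)\quad(\text{for }N-p>3),$$ $$(T^{\|}(\Pi))_{cab}{}^d=\Pi^d{}_r\Pi^s{}_c\Pi^t{}_a\Pi^q{}_bT_{stq}{}^r,\qquad (B^{\|}(\Pi))_{abc}=\Pi_a{}^r\Pi_b{}^s\Pi_c{}^q\bar\nabla_{[r}L^\Pi_{s]q}.$$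 A pseudo-Riemannian manifold $(M,h)$ is called conformally flat if each point has a neighbourhood with a smooth function $f$ on it such that $e^{2f}h$ is flat there, i.e. has vanishing Riemann tensor. **Theorem 1.** (i) If $N-p>3$, then all leaves, with their induced metrics, are conformally flat if and only if $T^{\|}(\Pi)=0$ on $V$. (ii) If $N-p=3$, then all leaves, with their induced metrics, are conformally flat if and only if $B^{\|}(\Pi)=0$ on $V$. -/

import Mathlib

open scoped Manifold ContDiff
open Bundle

noncomputable section

namespace BiConformal

/-! ### Tensor calculus in coordinates

A tensor field on an open subset of `ℝᵐ` is given by its components, as functions of the point.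
In the names of the arguments, the metric `G` has components `g_{ab} = G x a b`, a `(1,1)`-tensor
`A` has components `A^a_b = A x a b`, and a connection `Γ` has components `Γ^c_{ab} = Γ x c a b`,
which means `∇_{∂_a} ∂_b = Γ^c_{ab} ∂_c`. -/

/-- The partial derivative `∂_a f` at the point `x`. -/
def pd {m : ℕ} (a : Fin m) (f : EuclideanSpace ℝ (Fin m) → ℝ) (x : EuclideanSpace ℝ (Fin m)) : ℝ :=
  fderiv ℝ f x (EuclideanSpace.single a 1)

section Coordinates

variable {m : ℕ} (G : EuclideanSpace ℝ (Fin m) → Matrix (Fin m) (Fin m) ℝ)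

/-- The Christoffel symbols `γ^c_{ab} = ½ g^{cd} (∂_a g_{db} + ∂_b g_{da} - ∂_d g_{ab})` of the
Levi-Civita connection. -/
def christoffel (x : EuclideanSpace ℝ (Fin m)) (c a b : Fin m) : ℝ :=
  (1 / 2) * ∑ d, (G x)⁻¹ c d *
    (pd a (fun y => G y d b) x + pd b (fun y => G y d a) x - pd d (fun y => G y a b) x)

/-- The curvature `R_{abc}^d` of a torsion-free connection, with the convention
`∇_a ∇_b X^c - ∇_b ∇_a X^c = R_{bad}^c X^d`; it is written `curvature Γ x a b c d`. -/
def curvature (Γ : EuclideanSpace ℝ (Fin m) → Fin m → Fin m → Fin m → ℝ)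
    (x : EuclideanSpace ℝ (Fin m)) (a b c d : Fin m) : ℝ :=
  pd b (fun y => Γ y d a c) x - pd a (fun y => Γ y d b c) x
    + ∑ e, (Γ x d b e * Γ x e a c - Γ x d a e * Γ x e b c)

/-- The covariant derivative `∇_c S_{ab} = ∂_c S_{ab} - Γ^d_{ca} S_{db} - Γ^d_{cb} S_{ad}` of a
`(0,2)`-tensor, written `covDeriv Γ S x c a b`. -/
def covDeriv (Γ : EuclideanSpace ℝ (Fin m) → Fin m → Fin m → Fin m → ℝ)
    (S : EuclideanSpace ℝ (Fin m) → Fin m → Fin m → ℝ)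
    (x : EuclideanSpace ℝ (Fin m)) (c a b : Fin m) : ℝ :=
  pd c (fun y => S y a b) x - ∑ d, (Γ x d c a * S x d b + Γ x d c b * S x a d)

/-- `A_{ab} = g_{ac} A^c_b`. -/
def lower (A : EuclideanSpace ℝ (Fin m) → Matrix (Fin m) (Fin m) ℝ)
    (x : EuclideanSpace ℝ (Fin m)) (a b : Fin m) : ℝ :=
  ∑ c, G x a c * A x c b

/-- `A^{ab} = A^a_c g^{cb}`. -/
def raise (A : EuclideanSpace ℝ (Fin m) → Matrix (Fin m) (Fin m) ℝ)
    (x : EuclideanSpace ℝ (Fin m)) (a b : Fin m) : ℝ :=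
  ∑ c, A x a c * (G x)⁻¹ c b

variable (P Pi : EuclideanSpace ℝ (Fin m) → Matrix (Fin m) (Fin m) ℝ)

/-- `M_{abc} = ∇_b P_{ac} + ∇_c P_{ab} - ∇_a P_{bc}`. -/
def tensorM (x : EuclideanSpace ℝ (Fin m)) (a b c : Fin m) : ℝ :=
  covDeriv (christoffel G) (lower G P) x b a c + covDeriv (christoffel G) (lower G P) x c a b
    - covDeriv (christoffel G) (lower G P) x a b c

/-- `E_a = M_{acb} P^{cb}`. -/
def tensorE (x : EuclideanSpace ℝ (Fin m)) (a : Fin m) : ℝ :=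
  ∑ c, ∑ b, tensorM G P x a c b * raise G P x c b

/-- `W_a = - M_{acb} Π^{cb}`. -/
def tensorW (x : EuclideanSpace ℝ (Fin m)) (a : Fin m) : ℝ :=
  -∑ c, ∑ b, tensorM G P x a c b * raise G Pi x c b

/-- The difference tensor `L^a_{bc}` between the bi-conformal and the Levi-Civita connection:
`(E_b P^a_c + E_c P^a_b) / (2 tr P) + (W_b Π^a_c + W_c Π^a_b) / (2 (m - tr P))
+ ½ (P^a_d - Π^a_d) M^d_{bc}`. -/
def tensorL (x : EuclideanSpace ℝ (Fin m)) (a b c : Fin m) : ℝ :=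
  1 / (2 * (P x).trace) * (tensorE G P x b * P x a c + tensorE G P x c * P x a b)
    + 1 / (2 * ((m : ℝ) - (P x).trace)) *
      (tensorW G P Pi x b * Pi x a c + tensorW G P Pi x c * Pi x a b)
    + (1 / 2) * ∑ d, (P x a d - Pi x a d) * ∑ e, (G x)⁻¹ d e * tensorM G P x e b c

/-- The bi-conformal connection `γ̄^a_{bc} = γ^a_{bc} + L^a_{bc}`. -/
def biconfConnection (x : EuclideanSpace ℝ (Fin m)) (a b c : Fin m) : ℝ :=
  christoffel G x a b c + tensorL G P Pi x a b c

/-- The curvature `R̄_{abc}^d` of the bi-conformal connection. -/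
def biconfCurvature (x : EuclideanSpace ℝ (Fin m)) (a b c d : Fin m) : ℝ :=
  curvature (biconfConnection G P Pi) x a b c d

/-- `R̄^Π = Π^d_r R̄_{bdc}^r Π^{cb}`. -/
def scalarPi (x : EuclideanSpace ℝ (Fin m)) : ℝ :=
  ∑ b, ∑ c, ∑ d, ∑ r, Pi x d r * biconfCurvature G P Pi x b d c r * raise G Pi x c b

/-- The tensor `L^Π_{bc}`, where `p = tr P`:
`2 (Π^d_r R̄_{bdc}^r - (m - p)⁻¹ (Π^d_c Π^r_q R̄_{bdr}^q + Π^d_b Π^r_q R̄_{cdr}^q - Π^r_q R̄_{cbr}^q))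
+ R̄^Π Π_{bc} / (1 - m + p)`. -/
def tensorLPi (p : ℕ) (x : EuclideanSpace ℝ (Fin m)) (b c : Fin m) : ℝ :=
  2 * ((∑ d, ∑ r, Pi x d r * biconfCurvature G P Pi x b d c r)
      - 1 / ((m : ℝ) - p) *
        ((∑ d, ∑ r, ∑ q, Pi x d c * Pi x r q * biconfCurvature G P Pi x b d r q)
          + (∑ d, ∑ r, ∑ q, Pi x d b * Pi x r q * biconfCurvature G P Pi x c d r q)
          - ∑ r, ∑ q, Pi x r q * biconfCurvature G P Pi x c b r q))
    + scalarPi G P Pi x / (1 - (m : ℝ) + p) * lower G Pi x b c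

/-- The tensor `T_{bac}^d`, where `p = tr P`:
`2 R̄_{bac}^d - 2 / (2 - m + p) (Π^d_c L^Π_{[ab]} + Π^d_{[b} L^Π_{a]c} + Π_{c[a} L^Π_{b]q} Π^{qd})`,
with `X_{[ab]} = ½ (X_{ab} - X_{ba})`; it is written `tensorT G P Pi p x b a c d`. -/
def tensorT (p : ℕ) (x : EuclideanSpace ℝ (Fin m)) (b a c d : Fin m) : ℝ :=
  2 * biconfCurvature G P Pi x b a c d
    - 2 / (2 - (m : ℝ) + p) *
      (Pi x d c * ((1 / 2) * (tensorLPi G P Pi p x a b - tensorLPi G P Pi p x b a))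
        + (1 / 2) * (Pi x d b * tensorLPi G P Pi p x a c - Pi x d a * tensorLPi G P Pi p x b c)
        + ∑ q, (1 / 2) * (lower G Pi x c a * tensorLPi G P Pi p x b q
            - lower G Pi x c b * tensorLPi G P Pi p x a q) * raise G Pi x q d)

/-- The leaf-projected tensor
`(T^∥(Π))_{cab}^d = Π^d_r Π^s_c Π^t_a Π^q_b T_{stq}^r`. -/
def tensorTPar (p : ℕ) (x : EuclideanSpace ℝ (Fin m)) (c a b d : Fin m) : ℝ :=
  ∑ r, ∑ s, ∑ t, ∑ q,
    Pi x d r * Pi x s c * Pi x t a * Pi x q b * tensorT G P Pi p x s t q r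

/-- The leaf-projected tensor
`(B^∥(Π))_{abc} = Π^r_a Π^s_b Π^q_c ∇̄_{[r} L^Π_{s]q}`. -/
def tensorBPar (p : ℕ) (x : EuclideanSpace ℝ (Fin m)) (a b c : Fin m) : ℝ :=
  ∑ r, ∑ s, ∑ q, Pi x r a * Pi x s b * Pi x q c *
    ((1 / 2) * (covDeriv (biconfConnection G P Pi) (tensorLPi G P Pi p) x r s q
      - covDeriv (biconfConnection G P Pi) (tensorLPi G P Pi p) x s r q))

end Coordinates

/-! ### Manifolds, metrics and foliations -/

section Charts

variable {m : ℕ} {M : Type*} [TopologicalSpace M] [ChartedSpace (EuclideanSpace ℝ (Fin m)) M]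

/-- The coordinate vector `∂_a` of the chart `φ` at the point with coordinates `y`. -/
def coordVec (φ : OpenPartialHomeomorph M (EuclideanSpace ℝ (Fin m)))
    (y : EuclideanSpace ℝ (Fin m)) (a : Fin m) : TangentSpace (𝓡 m) (φ.symm y) :=
  mfderiv (𝓡 m) (𝓡 m) φ.symm y (EuclideanSpace.single a (1 : ℝ) : EuclideanSpace ℝ (Fin m))

/-- The components `h_{ab} = h (∂_a, ∂_b)` in the chart `φ` of a field of bilinear forms. -/
def formComp (φ : OpenPartialHomeomorph M (EuclideanSpace ℝ (Fin m)))
    (h : ∀ x : M, TangentSpace (𝓡 m) x → TangentSpace (𝓡 m) x → ℝ)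
    (y : EuclideanSpace ℝ (Fin m)) : Matrix (Fin m) (Fin m) ℝ :=
  fun a b => h (φ.symm y) (coordVec φ y a) (coordVec φ y b)

/-- The components `A^a_b = dφ^a (A ∂_b)` in the chart `φ` of a field of endomorphisms of the
tangent spaces. -/
def endComp (φ : OpenPartialHomeomorph M (EuclideanSpace ℝ (Fin m)))
    (A : ∀ x : M, TangentSpace (𝓡 m) x →ₗ[ℝ] TangentSpace (𝓡 m) x)
    (y : EuclideanSpace ℝ (Fin m)) : Matrix (Fin m) (Fin m) ℝ :=
  fun a b =>
    (show EuclideanSpace ℝ (Fin m) from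
      mfderiv (𝓡 m) (𝓡 m) φ (φ.symm y) (A (φ.symm y) (coordVec φ y b))) a

/-- A manifold with a field `h` of nondegenerate symmetric bilinear forms is conformally flat if
each point has a coordinate neighbourhood with a smooth function `f` on it such that the metric
`e^{2f} h` is flat there, that is, its Riemann tensor vanishes. -/
def IsConformallyFlat [IsManifold (𝓡 m) ∞ M]
    (h : ∀ x : M, TangentSpace (𝓡 m) x → TangentSpace (𝓡 m) x → ℝ) : Prop :=
  ∀ x : M, ∃ φ ∈ IsManifold.maximalAtlas (𝓡 m) ∞ M, x ∈ φ.source ∧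
    ∃ f : EuclideanSpace ℝ (Fin m) → ℝ, ContDiffOn ℝ ∞ f φ.target ∧
      ∀ y ∈ φ.target, ∀ a b c d : Fin m,
        curvature (christoffel (fun z => Real.exp (2 * f z) • formComp φ h z)) y a b c d = 0

end Charts

/-- A smooth pseudo-Riemannian metric, of any signature, on an `N`-dimensional manifold. -/
structure PseudoRiemannianMetric (N : ℕ) (V : Type*) [TopologicalSpace V]
    [ChartedSpace (EuclideanSpace ℝ (Fin N)) V] [IsManifold (𝓡 N) ∞ V] where
  form : ∀ x : V, TangentSpace (𝓡 N) x →L[ℝ] TangentSpace (𝓡 N) x →L[ℝ] ℝ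
  symm : ∀ (x : V) (u v : TangentSpace (𝓡 N) x), form x u v = form x v u
  nondegenerate : ∀ (x : V) (u : TangentSpace (𝓡 N) x), (∀ v, form x u v = 0) → u = 0
  contMDiff : ContMDiff (𝓡 N)
    ((𝓡 N).prod 𝓘(ℝ, EuclideanSpace ℝ (Fin N) →L[ℝ] EuclideanSpace ℝ (Fin N) →L[ℝ] ℝ)) ∞
    (fun x => TotalSpace.mk' (EuclideanSpace ℝ (Fin N) →L[ℝ] EuclideanSpace ℝ (Fin N) →L[ℝ] ℝ)
      x (form x))

/-- A smooth foliation of codimension `p` of the `N`-dimensional manifold `V`: a partition of `V`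
into injectively immersed (for instance embedded) submanifolds of dimension `N - p`, the leaves,
whose tangent spaces form a smooth distribution `dist` on `V`. -/
structure Foliation.{w, u} (N p : ℕ) (V : Type u) [TopologicalSpace V]
    [ChartedSpace (EuclideanSpace ℝ (Fin N)) V] [IsManifold (𝓡 N) ∞ V] where
  /-- the index set of the leaves -/
  ι : Type w
  /-- the leaves, as manifolds -/
  Leaf : ι → Type w
  [topLeaf : ∀ i, TopologicalSpace (Leaf i)]
  [chartedLeaf : ∀ i, ChartedSpace (EuclideanSpace ℝ (Fin (N - p))) (Leaf i)]
  [manifoldLeaf : ∀ i, IsManifold (𝓡 (N - p)) ∞ (Leaf i)]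
  /-- the inclusions of the leaves -/
  incl : ∀ i, Leaf i → V
  isImmersion : ∀ i, Manifold.IsImmersion (𝓡 (N - p)) (𝓡 N) ∞ (incl i)
  injective : ∀ i, Function.Injective (incl i)
  disjoint : ∀ i j, i ≠ j → Disjoint (Set.range (incl i)) (Set.range (incl j))
  cover : ⋃ i, Set.range (incl i) = Set.univ
  /-- the distribution generated by the foliation -/
  dist : ∀ x : V, Submodule ℝ (TangentSpace (𝓡 N) x)
  dist_incl : ∀ i (y : Leaf i),
    dist (incl i y) = (mfderiv (𝓡 (N - p)) (𝓡 N) (incl i) y).range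
  smooth_dist : ∀ x : V, ∃ U : Set V, IsOpen U ∧ x ∈ U ∧
    ∃ X : Fin (N - p) → ∀ z : V, TangentSpace (𝓡 N) z,
      (∀ k, ContMDiffOn (𝓡 N) (𝓡 N).tangent ∞
        (fun z => (⟨z, X k z⟩ : TangentBundle (𝓡 N) V)) U) ∧
      ∀ z ∈ U, Submodule.span ℝ (Set.range fun k => X k z) = dist z

attribute [instance] Foliation.topLeaf Foliation.chartedLeaf Foliation.manifoldLeaf

section Foliations

variable {N p : ℕ} {V : Type*} [TopologicalSpace V]
  [ChartedSpace (EuclideanSpace ℝ (Fin N)) V] [IsManifold (𝓡 N) ∞ V]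

/-- The metric (first fundamental form) induced on the leaf `i`. -/
def Foliation.inducedMetric (F : Foliation N p V) (g : PseudoRiemannianMetric N V) (i : F.ι)
    (y : F.Leaf i) (u v : TangentSpace (𝓡 (N - p)) y) : ℝ :=
  g.form (F.incl i y) (mfderiv (𝓡 (N - p)) (𝓡 N) (F.incl i) y u)
    (mfderiv (𝓡 (N - p)) (𝓡 N) (F.incl i) y v)

/-- The foliation is non-degenerate if the metric induced on each leaf is non-degenerate. -/
def Foliation.IsNondegenerate (F : Foliation N p V) (g : PseudoRiemannianMetric N V) : Prop :=
  ∀ i (y : F.Leaf i) (u : TangentSpace (𝓡 (N - p)) y),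
    (∀ w, F.inducedMetric g i y u w = 0) → u = 0

/-- `(P, Π)` is the pair of complementary orthogonal projectors of the foliation: `Π` projects onto
the tangent spaces of the leaves, `P` onto their orthogonal complements. -/
structure Foliation.IsProjectorPair (F : Foliation N p V) (g : PseudoRiemannianMetric N V)
    (P Pi : ∀ x : V, TangentSpace (𝓡 N) x →ₗ[ℝ] TangentSpace (𝓡 N) x) : Prop where
  add_eq_id : ∀ x, P x + Pi x = LinearMap.id
  P_idem : ∀ x, P x ∘ₗ P x = P x
  Pi_idem : ∀ x, Pi x ∘ₗ Pi x = Pi x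
  P_comp_Pi : ∀ x, P x ∘ₗ Pi x = 0
  Pi_comp_P : ∀ x, Pi x ∘ₗ P x = 0
  range_Pi : ∀ x, LinearMap.range (Pi x) = F.dist x
  mem_range_P : ∀ x u, u ∈ LinearMap.range (P x) ↔ ∀ w ∈ F.dist x, g.form x u w = 0

/-- Every leaf, with its induced metric, is conformally flat. -/
def Foliation.LeavesConformallyFlat (F : Foliation N p V) (g : PseudoRiemannianMetric N V) : Prop :=
  ∀ i, IsConformallyFlat (F.inducedMetric g i)

/-- The tensor field `T^∥(Π)` vanishes: all its components vanish at every point of every chart. -/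
def TParVanishes (p : ℕ) (g : PseudoRiemannianMetric N V)
    (P Pi : ∀ x : V, TangentSpace (𝓡 N) x →ₗ[ℝ] TangentSpace (𝓡 N) x) : Prop :=
  ∀ φ ∈ IsManifold.maximalAtlas (𝓡 N) ∞ V, ∀ y ∈ φ.target, ∀ c a b d : Fin N,
    tensorTPar (formComp φ (fun x u v => g.form x u v)) (endComp φ P) (endComp φ Pi) p y c a b d = 0

/-- The tensor field `B^∥(Π)` vanishes: all its components vanish at every point of every chart. -/
def BParVanishes (p : ℕ) (g : PseudoRiemannianMetric N V)
    (P Pi : ∀ x : V, TangentSpace (𝓡 N) x →ₗ[ℝ] TangentSpace (𝓡 N) x) : Prop :=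
  ∀ φ ∈ IsManifold.maximalAtlas (𝓡 N) ∞ V, ∀ y ∈ φ.target, ∀ a b c : Fin N,
    tensorBPar (formComp φ (fun x u v => g.form x u v)) (endComp φ P) (endComp φ Pi) p y a b c = 0

end Foliations

end BiConformal

end

/-!
The bi-conformal connection restricts to each leaf as the Levi-Civita connection of the induced
metric, so that the tensors of the theorem restrict to classical conformal invariants of the leaves,
and the Weyl–Schouten theorem applies.

*Restriction to the leaves.* Let `y` be a local parametrization of a leaf and `K` the second
derivative of `y` corrected by the Christoffel symbols of `g`. As `P` annihilates tangent vectors,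
`∇P` is determined on them by differentiating `P (∂y) = 0` along the leaf, and this gives
`M(w; u, v) = -2 g(P K(u, v), w)` for `u`, `v` tangent to the leaf (`IsLeafParam.mForm_tangent`). In
particular `M` vanishes on three tangent vectors, hence `W` vanishes on the leaf, and the terms of
`L` with `E` contain a factor `P` that is applied to a tangent vector. What remains of `L(u, v)` is
`-P K(u, v)`, so the bi-conformal connection differentiates tangent vectors of the leaf by taking
the tangential part of `∇`, which by the Gauss formula is the Levi-Civita connection of the leaf
(`IsLeafParam.tensorL_tangent`, `IsLeafParam.biconfConnection_tangent`). Its curvature therefore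
restricts to that of the leaf, contractions with `Π` become traces over the tangent space of the
leaf, and with `n = N - p` the tensor `L^Π` becomes `2 (n - 2)` times the Schouten tensor
(`IsLeafParam.lpiForm_tangent`), `T` twice the Weyl tensor (`IsLeafParam.tForm_tangent`) and `B^∥` a
nonzero multiple of the Cotton tensor (`IsLeafParam.tensorTPar_eq_zero_iff`,
`IsLeafParam.tensorBPar_eq_zero_iff`).

*The Weyl–Schouten theorem.* In dimension at least three, a metric `h` is locally conformally flat
iff its Weyl and Cotton tensors vanish. If `e^{2f} h` is flat, the formula for the conformal change of the curvature
(`IsLeviCivita.curv_confConn`) shows that the curvature of `h` is a Kulkarni–Nomizu product with the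
Schouten tensor, and that the Schouten tensor is a known expression in `f` and its derivatives;
differentiating this expression gives the Cotton equation (`WeylFree.of_flat`,
`CottonFree.of_flat`).
Conversely, the vanishing of both tensors says that the tractor connection, a linear connection on
triples `(σ, m, ρ)`, is flat (`tractor_integrable`). It has parallel sections by Frobenius' theorem,
which for linear systems is proved by integrating along rays (`exists_solution_totalDifferential`),
and a parallel null section with `σ > 0` makes `σ⁻² h` flat (`exists_flat_conformal`). In dimension
at least four the Bianchi identity derives the vanishing of the Cotton tensor from that of the Weyl
tensor (`CottonFree.of_weylFree`), and in dimension three the Weyl tensor vanishes identically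
(`WeylFree.of_finrank_three`), so one tensor suffices in either case.

*Passage to charts.* The tensors contain derivatives of `P` and `Π`, whose smoothness follows from
that of the distribution: in terms of a smooth local frame with matrix `J` and the matrix `G` of the
metric, `Π = J (Jᵀ G J)⁻¹ Jᵀ G` (`matrix_proj_eq`, `Foliation.IsProjectorPair.isProjectorPairOn`).
Since every point lies on a leaf, a pointwise equivalence in charts of leaves and of the manifold is
enough (`Foliation.leavesConformallyFlat_iff`).
-/

open Filter Topology Module

noncomputable section

namespace BiConformal

set_option synthInstance.maxHeartbeats 200000
set_option maxHeartbeats 400000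

/-! ### Connections on open sets and their behaviour under maps -/

section Connections

section Instances

variable {E F : Type*} [NormedAddCommGroup E] [NormedSpace ℝ E]
  [NormedAddCommGroup F] [NormedSpace ℝ F]

/-! Shortcut instances: without them the search for the structure of triply iterated spaces of
continuous linear maps, in which second derivatives of connections live, exceeds its limits. -/

instance : SeminormedAddCommGroup (E →L[ℝ] F) := ContinuousLinearMap.toSeminormedAddCommGroup
instance : NormedAddCommGroup (E →L[ℝ] F) := ContinuousLinearMap.toNormedAddCommGroup
instance : SeminormedAddCommGroup (E →L[ℝ] E →L[ℝ] F) :=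
  ContinuousLinearMap.toSeminormedAddCommGroup
instance : NormedAddCommGroup (E →L[ℝ] E →L[ℝ] F) := ContinuousLinearMap.toNormedAddCommGroup
instance : NormedSpace ℝ (E →L[ℝ] E →L[ℝ] F) := ContinuousLinearMap.toNormedSpace
instance : NormedAddCommGroup (E →L[ℝ] E →L[ℝ] E →L[ℝ] F) :=
  ContinuousLinearMap.toNormedAddCommGroup
instance : NormedSpace ℝ (E →L[ℝ] E →L[ℝ] E →L[ℝ] F) := ContinuousLinearMap.toNormedSpace

end Instances

theorem minSmoothness_two_le : minSmoothness ℝ 2 ≤ (∞ : WithTop ℕ∞) := by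
  rw [minSmoothness_of_isRCLikeNormedField]
  exact WithTop.coe_le_coe.2 (le_top (a := (2 : ℕ∞)))

variable {E F : Type*} [NormedAddCommGroup E] [NormedSpace ℝ E]
  [NormedAddCommGroup F] [NormedSpace ℝ F]

/-- The curvature `[∇_v, ∇_u] w` of the torsion-free connection with Christoffel form `Γ`. -/
def curv (Γ : E → E →L[ℝ] E →L[ℝ] E) (x u v w : E) : E :=
  fderiv ℝ Γ x v u w - fderiv ℝ Γ x u v w + Γ x v (Γ x u w) - Γ x u (Γ x v w)

/-- The covariant derivative `(∇_u S)(v, w)` of a field `S` of bilinear forms. -/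
def covD (Γ : E → E →L[ℝ] E →L[ℝ] E) (S : E → E →L[ℝ] E →L[ℝ] ℝ) (x u v w : E) : ℝ :=
  fderiv ℝ S x u v w - S x (Γ x u v) w - S x v (Γ x u w)

/-- If `y` carries the connection `Γ` to `Γ'`, it carries the curvature of `Γ` to that of `Γ'`.
The map `y` may be an immersion: `Γ'` matters only on tangent vectors of its image. -/
theorem curv_related {Γ : E → E →L[ℝ] E →L[ℝ] E} {Γ' : F → F →L[ℝ] F →L[ℝ] F} {y : E → F} {x : E}
    (hy : ContDiffAt ℝ ∞ y x) (hΓ : DifferentiableAt ℝ Γ x) (hΓ' : DifferentiableAt ℝ Γ' (y x))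
    (h : ∀ᶠ z in 𝓝 x, ∀ u v, fderiv ℝ (fderiv ℝ y) z u v
      + Γ' (y z) (fderiv ℝ y z u) (fderiv ℝ y z v) = fderiv ℝ y z (Γ z u v)) (u v w : E) :
    curv Γ' (y x) (fderiv ℝ y x u) (fderiv ℝ y x v) (fderiv ℝ y x w)
      = fderiv ℝ y x (curv Γ x u v w) := by
  have hy1 : ContDiffAt ℝ ∞ (fderiv ℝ y) x := hy.fderiv_right (by simp)
  have hy2 : ContDiffAt ℝ ∞ (fderiv ℝ (fderiv ℝ y)) x := hy1.fderiv_right (by simp)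
  have dy := (hy.differentiableAt (by simp)).hasFDerivAt
  have dJ := (hy1.differentiableAt (by simp)).hasFDerivAt
  have dH := (hy2.differentiableAt (by simp)).hasFDerivAt
  have dG : HasFDerivAt (fun z => Γ' (y z)) ((fderiv ℝ Γ' (y x)).comp (fderiv ℝ y x)) x :=
    HasFDerivAt.comp (g := Γ') x hΓ'.hasFDerivAt dy
  have key : ∀ a b c : E, fderiv ℝ (fderiv ℝ (fderiv ℝ y)) x a b c
      + (fderiv ℝ Γ' (y x) (fderiv ℝ y x a) (fderiv ℝ y x b) (fderiv ℝ y x c)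
        + Γ' (y x) (fderiv ℝ (fderiv ℝ y) x a b) (fderiv ℝ y x c)
        + Γ' (y x) (fderiv ℝ y x b) (fderiv ℝ (fderiv ℝ y) x a c))
      = fderiv ℝ (fderiv ℝ y) x a (Γ x b c) + fderiv ℝ y x (fderiv ℝ Γ x a b c) := by
    intro a b c
    have hl := ((dH.clm_apply (hasFDerivAt_const b x)).clm_apply (hasFDerivAt_const c x)).add
      ((dG.clm_apply (dJ.clm_apply (hasFDerivAt_const b x))).clm_apply
        (dJ.clm_apply (hasFDerivAt_const c x)))
    have hr := dJ.clm_apply ((hΓ.hasFDerivAt.clm_apply (hasFDerivAt_const b x)).clm_apply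
        (hasFDerivAt_const c x))
    have e := (hl.congr_of_eventuallyEq (h.mono fun z hz => (hz b c).symm)).unique hr
    have := congrArg (fun L => L a) e
    simp at this
    rw [← sub_eq_zero] at this ⊢
    rw [← this]; abel
  have sym1 : ∀ a b, fderiv ℝ (fderiv ℝ y) x a b = fderiv ℝ (fderiv ℝ y) x b a :=
    hy.isSymmSndFDerivAt minSmoothness_two_le
  have sym2 : ∀ a b, fderiv ℝ (fderiv ℝ (fderiv ℝ y)) x a b
      = fderiv ℝ (fderiv ℝ (fderiv ℝ y)) x b a :=
    hy1.isSymmSndFDerivAt minSmoothness_two_le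
  have h0 := h.self_of_nhds
  have k1 := key v u w
  have k2 := key u v w
  rw [sym2 v u, sym1 v u] at k1
  have e1 : fderiv ℝ (fderiv ℝ y) x v w = fderiv ℝ y x (Γ x v w)
      - Γ' (y x) (fderiv ℝ y x v) (fderiv ℝ y x w) := eq_sub_of_add_eq (h0 v w)
  have e2 : fderiv ℝ (fderiv ℝ y) x u w = fderiv ℝ y x (Γ x u w)
      - Γ' (y x) (fderiv ℝ y x u) (fderiv ℝ y x w) := eq_sub_of_add_eq (h0 u w)
  have e3 := h0 v (Γ x u w)
  have e4 := h0 u (Γ x v w)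
  rw [e1] at k1
  rw [e2] at k2
  simp only [curv, map_add, map_sub] at *
  linear_combination (norm := module) k1 - k2 + e3 - e4

theorem covD_related {Γ : E → E →L[ℝ] E →L[ℝ] E} {Γ' : F → F →L[ℝ] F →L[ℝ] F} {y : E → F} {x : E}
    {S : E → E →L[ℝ] E →L[ℝ] ℝ} {S' : F → F →L[ℝ] F →L[ℝ] ℝ}
    (hy : ContDiffAt ℝ ∞ y x) (hS : DifferentiableAt ℝ S x) (hS' : DifferentiableAt ℝ S' (y x))
    (h : ∀ u v, fderiv ℝ (fderiv ℝ y) x u v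
      + Γ' (y x) (fderiv ℝ y x u) (fderiv ℝ y x v) = fderiv ℝ y x (Γ x u v))
    (hSS : ∀ᶠ z in 𝓝 x, ∀ u v, S' (y z) (fderiv ℝ y z u) (fderiv ℝ y z v) = S z u v) (u v w : E) :
    covD Γ' S' (y x) (fderiv ℝ y x u) (fderiv ℝ y x v) (fderiv ℝ y x w) = covD Γ S x u v w := by
  have hy1 : ContDiffAt ℝ ∞ (fderiv ℝ y) x := hy.fderiv_right (by simp)
  have dy := (hy.differentiableAt (by simp)).hasFDerivAt
  have dJ := (hy1.differentiableAt (by simp)).hasFDerivAt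
  have dG : HasFDerivAt (fun z => S' (y z)) ((fderiv ℝ S' (y x)).comp (fderiv ℝ y x)) x :=
    HasFDerivAt.comp (g := S') x hS'.hasFDerivAt dy
  have hl := ((dG.clm_apply (dJ.clm_apply (hasFDerivAt_const v x))).clm_apply
        (dJ.clm_apply (hasFDerivAt_const w x)))
  have hr := ((hS.hasFDerivAt.clm_apply (hasFDerivAt_const v x)).clm_apply
        (hasFDerivAt_const w x))
  have e := (hl.congr_of_eventuallyEq (hSS.mono fun z hz => (hz v w).symm)).unique hr
  have e := congrArg (fun L => L u) e
  have h0 := hSS.self_of_nhds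
  simp only [covD, ← h0, ← h, map_add]
  simp at e
  simp only [add_apply]
  rw [← e]; ring

end Connections

/-! ### Levi-Civita connections and the symmetries of their curvature -/

section LeviCivita

variable {E : Type*} [NormedAddCommGroup E] [NormedSpace ℝ E]

/-- `h` is a smooth pseudo-Riemannian metric on the open set `U` of a normed space and `Γ` is the
Christoffel form of its Levi-Civita connection: `Γ` is symmetric and `∇h = 0`. -/
structure IsLeviCivita (h : E → E →L[ℝ] E →L[ℝ] ℝ) (Γ : E → E →L[ℝ] E →L[ℝ] E) (U : Set E) :
    Prop where
  isOpen : IsOpen U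
  smooth_metric : ContDiffOn ℝ ∞ h U
  smooth_conn : ContDiffOn ℝ ∞ Γ U
  symm : ∀ x ∈ U, ∀ u v, h x u v = h x v u
  nondeg : ∀ x ∈ U, ∀ u, (∀ v, h x u v = 0) → u = 0
  torsion_free : ∀ x ∈ U, ∀ u v, Γ x u v = Γ x v u
  compat : ∀ x ∈ U, ∀ u v w, fderiv ℝ h x u v w = h x (Γ x u v) w + h x v (Γ x u w)

theorem curv_antisymm (Γ : E → E →L[ℝ] E →L[ℝ] E) (x u v w : E) :
    curv Γ x u v w = -curv Γ x v u w := by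
  simp only [curv]; abel

/-- The second Bianchi identity; the terms with `Γ` in the first two slots of the curvature cancel
for a symmetric `Γ` and are left out. -/
theorem curv_second_bianchi {Γ : E → E →L[ℝ] E →L[ℝ] E} {x : E} (hΓ : ContDiffAt ℝ ∞ Γ x)
    (u v w z : E) :
    (fderiv ℝ (fun y => curv Γ y u v z) x w + Γ x w (curv Γ x u v z) - curv Γ x u v (Γ x w z))
    + (fderiv ℝ (fun y => curv Γ y v w z) x u + Γ x u (curv Γ x v w z) - curv Γ x v w (Γ x u z))
    + (fderiv ℝ (fun y => curv Γ y w u z) x v + Γ x v (curv Γ x w u z) - curv Γ x w u (Γ x v z))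
      = 0 := by
  have hΓ1 : ContDiffAt ℝ ∞ (fderiv ℝ Γ) x := hΓ.fderiv_right (by simp)
  have dΓ := (hΓ.differentiableAt (by simp)).hasFDerivAt
  have dΓ1 := (hΓ1.differentiableAt (by simp)).hasFDerivAt
  have sym : ∀ a b, fderiv ℝ (fderiv ℝ Γ) x a b = fderiv ℝ (fderiv ℝ Γ) x b a :=
    hΓ.isSymmSndFDerivAt minSmoothness_two_le
  have key : ∀ a b c d : E, fderiv ℝ (fun y => curv Γ y a b c) x d
      = fderiv ℝ (fderiv ℝ Γ) x d b a c - fderiv ℝ (fderiv ℝ Γ) x d a b c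
        + (fderiv ℝ Γ x d b (Γ x a c) + Γ x b (fderiv ℝ Γ x d a c))
        - (fderiv ℝ Γ x d a (Γ x b c) + Γ x a (fderiv ℝ Γ x d b c)) := by
    intro a b c d
    have c2 : ∀ p q : E, HasFDerivAt (fun y => Γ y p q) (((fderiv ℝ Γ x).flip p).flip q) x := by
      intro p q
      simpa using (dΓ.clm_apply (hasFDerivAt_const p x)).clm_apply (hasFDerivAt_const q x)
    have c1 : ∀ p : E, HasFDerivAt (fun y => Γ y p) ((fderiv ℝ Γ x).flip p) x := by
      intro p
      simpa using (dΓ.clm_apply (hasFDerivAt_const p x))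
    have c3 : ∀ p q r : E, HasFDerivAt (fun y => fderiv ℝ Γ y p q r)
        ((((fderiv ℝ (fderiv ℝ Γ) x).flip p).flip q).flip r) x := by
      intro p q r
      simpa using ((dΓ1.clm_apply (hasFDerivAt_const p x)).clm_apply
        (hasFDerivAt_const q x)).clm_apply (hasFDerivAt_const r x)
    have := ((((c3 b a c).sub (c3 a b c)).add ((c1 b).clm_apply (c2 a c))).sub
      ((c1 a).clm_apply (c2 b c))).fderiv
    have e : (fun y => curv Γ y a b c) = fun y => fderiv ℝ Γ y b a c - fderiv ℝ Γ y a b c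
      + Γ y b (Γ y a c) - Γ y a (Γ y b c) := rfl
    have t := congrArg (fun L => L d) this
    rw [e]
    refine Eq.trans t ?_
    simp
    abel
  rw [key, key, key, sym w v, sym w u, sym u v]
  simp only [curv, map_add, map_sub]
  abel

variable {h : E → E →L[ℝ] E →L[ℝ] ℝ} {Γ : E → E →L[ℝ] E →L[ℝ] E} {U : Set E}

namespace IsLeviCivita

theorem contDiffAt_metric (L : IsLeviCivita h Γ U) {x : E} (hx : x ∈ U) : ContDiffAt ℝ ∞ h x :=
  L.smooth_metric.contDiffAt (L.isOpen.mem_nhds hx)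

theorem contDiffAt_conn (L : IsLeviCivita h Γ U) {x : E} (hx : x ∈ U) : ContDiffAt ℝ ∞ Γ x :=
  L.smooth_conn.contDiffAt (L.isOpen.mem_nhds hx)

theorem eq_of_metric (L : IsLeviCivita h Γ U) {x : E} (hx : x ∈ U) {u v : E}
    (e : ∀ w, h x u w = h x v w) : u = v :=
  sub_eq_zero.1 (L.nondeg x hx _ fun w => by simp [e w])

theorem fderiv_conn_symm (L : IsLeviCivita h Γ U) {x : E} (hx : x ∈ U) (a b c : E) :
    fderiv ℝ Γ x a b c = fderiv ℝ Γ x a c b := by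
  have dΓ := ((L.contDiffAt_conn hx).differentiableAt (by simp)).hasFDerivAt
  have c2 : ∀ p q : E, HasFDerivAt (fun y => Γ y p q) (((fderiv ℝ Γ x).flip p).flip q) x := by
    intro p q
    simpa using (dΓ.clm_apply (hasFDerivAt_const p x)).clm_apply (hasFDerivAt_const q x)
  have := ((c2 b c).congr_of_eventuallyEq (Filter.eventuallyEq_of_mem (L.isOpen.mem_nhds hx)
    fun y hy => L.torsion_free y hy c b)).unique (c2 c b)
  simpa using congrArg (fun L => L a) this

theorem curv_first_bianchi (L : IsLeviCivita h Γ U) {x : E} (hx : x ∈ U) (u v w : E) :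
    curv Γ x u v w + curv Γ x v w u + curv Γ x w u v = 0 := by
  simp only [curv]
  rw [L.fderiv_conn_symm hx v w u, L.fderiv_conn_symm hx u v w, L.fderiv_conn_symm hx w v u,
    L.torsion_free x hx w u, L.torsion_free x hx v w, L.torsion_free x hx u v]
  abel

theorem curv_metric_antisymm (L : IsLeviCivita h Γ U) {x : E} (hx : x ∈ U) (a b v w : E) :
    h x (curv Γ x a b v) w = - h x (curv Γ x a b w) v := by
  have dΓ := ((L.contDiffAt_conn hx).differentiableAt (by simp)).hasFDerivAt
  have dh := ((L.contDiffAt_metric hx).differentiableAt (by simp)).hasFDerivAt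
  have dh1 := (((L.contDiffAt_metric hx).fderiv_right (m := ∞) (by simp)).differentiableAt
    (by simp)).hasFDerivAt
  have sym : ∀ a b, fderiv ℝ (fderiv ℝ h) x a b = fderiv ℝ (fderiv ℝ h) x b a :=
    (L.contDiffAt_metric hx).isSymmSndFDerivAt minSmoothness_two_le
  have c2 : ∀ p q : E, HasFDerivAt (fun y => Γ y p q) (((fderiv ℝ Γ x).flip p).flip q) x := by
    intro p q
    simpa using (dΓ.clm_apply (hasFDerivAt_const p x)).clm_apply (hasFDerivAt_const q x)
  have key : ∀ b a : E, fderiv ℝ (fderiv ℝ h) x b a v w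
      = fderiv ℝ h x b (Γ x a v) w + h x (fderiv ℝ Γ x b a v) w
        + fderiv ℝ h x b v (Γ x a w) + h x v (fderiv ℝ Γ x b a w) := by
    intro b a
    have l := ((dh1.clm_apply (hasFDerivAt_const a x)).clm_apply
        (hasFDerivAt_const v x)).clm_apply (hasFDerivAt_const w x)
    have r := ((dh.clm_apply (c2 a v)).clm_apply (hasFDerivAt_const w x)).add
      ((dh.clm_apply (hasFDerivAt_const v x)).clm_apply (c2 a w))
    have := (l.congr_of_eventuallyEq (Filter.eventuallyEq_of_mem (L.isOpen.mem_nhds hx)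
      fun y hy => (L.compat y hy a v w).symm)).unique r
    have := congrArg (fun L => L b) this
    simp at this
    rw [this]; ring
  have k1 := key b a
  have k2 := key a b
  rw [sym a b, k1] at k2
  simp only [L.compat x hx] at k2
  rw [L.symm x hx (curv Γ x a b w)]
  simp only [curv, map_add, map_sub, add_apply, sub_apply]
  linear_combination k2

theorem curv_pair_symm (L : IsLeviCivita h Γ U) {x : E} (hx : x ∈ U) (a b c d : E) :
    h x (curv Γ x a b c) d = h x (curv Γ x c d a) b := by
  have anti : ∀ a b c d, h x (curv Γ x a b c) d = - h x (curv Γ x b a c) d := fun a b c d => by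
    rw [curv_antisymm]; simp
  have bi : ∀ a b c d, h x (curv Γ x a b c) d + h x (curv Γ x b c a) d
      + h x (curv Γ x c a b) d = 0 := fun a b c d => by
    have := congrArg (fun y => h x y d) (L.curv_first_bianchi hx a b c)
    simpa using this
  have an2 := L.curv_metric_antisymm hx
  linarith [bi a b c d, bi b c d a, bi c d a b, bi d a b c, anti a b c d, anti c d a b,
    an2 a b c d, an2 c d a b, an2 b c a d, an2 c a b d, an2 b c d a, an2 c d b a, an2 d b c a,
    an2 d a c b, an2 a c d b, an2 a b d c, an2 b d a c, an2 d a b c, anti a c b d, anti b d a c,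
    anti d b c a, anti c a b d, anti d a b c, anti b c d a, anti b c a d, anti a c d b]

theorem unique (L : IsLeviCivita h Γ U) {Γ' : E → E →L[ℝ] E →L[ℝ] E} {U' : Set E}
    (L' : IsLeviCivita h Γ' U') {x : E} (hx : x ∈ U) (hx' : x ∈ U') : Γ x = Γ' x := by
  ext u v
  refine L.eq_of_metric hx fun w => ?_
  have c := fun a b c => (L.compat x hx a b c).symm.trans (L'.compat x hx' a b c)
  have c1 := c u v w
  have c2 := c v w u
  have c3 := c w u v
  rw [L.symm x hx w, L'.symm x hx' w] at c2
  rw [L.symm x hx u, L'.symm x hx' u] at c3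
  rw [L.torsion_free x hx v u] at c2
  rw [L.torsion_free x hx w u, L.torsion_free x hx w v] at c3
  rw [L'.torsion_free x hx' v u] at c2
  rw [L'.torsion_free x hx' w u, L'.torsion_free x hx' w v] at c3
  rw [L.symm x hx v, L'.symm x hx' v] at c1
  linarith

end IsLeviCivita
end LeviCivita

/-! ### Orthogonal bases and algebraic curvature tensors -/

section Algebra

variable {E : Type*} [NormedAddCommGroup E] [NormedSpace ℝ E] {ι : Type*}

theorem isLinearMap_eq_zero (b : Basis ι ℝ E) {f : E → ℝ} (hf : IsLinearMap ℝ f)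
    (h : ∀ i, f (b i) = 0) (u : E) : f u = 0 := by
  have : hf.mk' f = 0 := b.ext fun i => by simpa using h i
  simpa using congrArg (fun g => g u) this

theorem trilinear_eq_zero (b : Basis ι ℝ E) {f : E → E → E → ℝ}
    (h1 : ∀ v w, IsLinearMap ℝ fun u => f u v w) (h2 : ∀ u w, IsLinearMap ℝ fun v => f u v w)
    (h3 : ∀ u v, IsLinearMap ℝ fun w => f u v w)
    (h : ∀ i j k, f (b i) (b j) (b k) = 0) (u v w : E) : f u v w = 0 :=
  isLinearMap_eq_zero b (h1 v w) (fun i => isLinearMap_eq_zero b (h2 _ w)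
    (fun j => isLinearMap_eq_zero b (h3 _ _) (fun k => h i j k) w) v) u

theorem exists_orthogonal_basis_of_nondegenerate [FiniteDimensional ℝ E]
    (B : E →L[ℝ] E →L[ℝ] ℝ) (hs : ∀ u v, B u v = B v u) (hn : ∀ u, (∀ v, B u v = 0) → u = 0) :
    ∃ b : Basis (Fin (finrank ℝ E)) ℝ E, (∀ i j, i ≠ j → B (b i) (b j) = 0) ∧
      ∀ i, B (b i) (b i) ≠ 0 := by
  let B' : LinearMap.BilinForm ℝ E := LinearMap.mk₂ ℝ (fun u v => B u v)
    (by simp) (by simp) (by simp) (by simp)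
  have hB' : LinearMap.IsSymm B' := ⟨fun u v => hs u v⟩
  obtain ⟨b, hb⟩ := LinearMap.BilinForm.exists_orthogonal_basis (B := B') hB'
  have ho : ∀ i j, i ≠ j → B (b i) (b j) = 0 := fun i j hij => by
    simpa [B', Function.onFun] using hb hij
  refine ⟨b, ho, fun i hi => b.ne_zero i (hn _ fun v => ?_)⟩
  refine isLinearMap_eq_zero b (f := fun v => B (b i) v) ⟨by simp, by simp⟩ (fun j => ?_) v
  by_cases hij : i = j
  · rw [← hij, hi]
  · exact ho i j hij

theorem repr_eq_of_orthogonal {B : E →L[ℝ] E →L[ℝ] ℝ} (b : Basis ι ℝ E)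
    (ho : ∀ i j, i ≠ j → B (b i) (b j) = 0) (hd : ∀ i, B (b i) (b i) ≠ 0) (u : E) (i : ι) :
    b.repr u i = B u (b i) / B (b i) (b i) := by
  rw [eq_div_iff (hd i), ← sub_eq_zero]
  refine isLinearMap_eq_zero b (f := fun u => b.repr u i * B (b i) (b i) - B u (b i))
    ⟨fun u v => by simp; ring, fun c u => by simp; ring⟩ (fun j => ?_) u
  by_cases hij : j = i
  · subst hij; simp
  · simp [ho j i hij, hij]

theorem trace_eq_of_orthogonal [Fintype ι] [DecidableEq ι] {B : E →L[ℝ] E →L[ℝ] ℝ}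
    (b : Basis ι ℝ E) (ho : ∀ i j, i ≠ j → B (b i) (b j) = 0) (hd : ∀ i, B (b i) (b i) ≠ 0)
    (f : E →ₗ[ℝ] E) :
    LinearMap.trace ℝ E f = ∑ i, B (f (b i)) (b i) / B (b i) (b i) := by
  rw [LinearMap.trace_eq_matrix_trace ℝ b, Matrix.trace]
  exact Finset.sum_congr rfl fun i _ => by
    rw [Matrix.diag_apply, LinearMap.toMatrix_apply, repr_eq_of_orthogonal b ho hd]

/-- The identity in the hypothesis `hX` is the contraction-free form of the contracted second
Bianchi identity for the Cotton tensor `C`. It is evaluated on an orthogonal basis. -/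
theorem cotton_eq_zero_of_bianchi [FiniteDimensional ℝ E] (hdim : 4 ≤ finrank ℝ E)
    (B : E →L[ℝ] E →L[ℝ] ℝ) (hs : ∀ u v, B u v = B v u) (hn : ∀ u, (∀ v, B u v = 0) → u = 0)
    {C : E → E → E → ℝ} (h1 : ∀ v w, IsLinearMap ℝ fun u => C u v w)
    (h2 : ∀ u w, IsLinearMap ℝ fun v => C u v w) (h3 : ∀ u v, IsLinearMap ℝ fun w => C u v w)
    (ha : ∀ u v w, C u v w = -C v u w)
    (hX : ∀ u v w z t, C w u z * B v t + C u v z * B w t + C v w z * B u t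
      = B u z * C v w t + B v z * C w u t + B w z * C u v t) (u v w : E) : C u v w = 0 := by
  obtain ⟨b, ho, hd⟩ := exists_orthogonal_basis_of_nondegenerate B hs hn
  refine trilinear_eq_zero b h1 h2 h3 (fun i j k => ?_) u v w
  -- four indices: three given ones leave room for another one
  have room : ∀ i j k : Fin (finrank ℝ E), ∃ l, l ≠ i ∧ l ≠ j ∧ l ≠ k := by
    intro i j k
    by_contra! hc
    have : (Finset.univ : Finset (Fin (finrank ℝ E))) ⊆ {i, j, k} := by
      intro l _
      simp only [Finset.mem_insert, Finset.mem_singleton]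
      by_cases h1 : l = i
      · exact Or.inl h1
      by_cases h2 : l = j
      · exact Or.inr (Or.inl h2)
      exact Or.inr (Or.inr (hc l h1 h2))
    have := (Finset.card_le_card this).trans Finset.card_le_three
    simp at this
    omega
  have hself : ∀ u w, C u u w = 0 := fun u w => by linarith [ha u u w]
  have hoff : ∀ i j k, k ≠ i → k ≠ j → C (b i) (b j) (b k) = 0 := by
    intro i j k hki hkj
    obtain ⟨l, hli, hlj, hlk⟩ := room i j k
    have := hX (b j) (b l) (b i) (b k) (b l)
    rw [ho i l hli.symm, ho j l hlj.symm, ho j k hkj.symm, ho l k hlk, ho i k hki.symm] at this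
    simpa [hd l] using this
  have hpair : ∀ i j l, l ≠ i → l ≠ j → i ≠ j →
      C (b i) (b j) (b i) * B (b l) (b l) = - (B (b i) (b i) * C (b l) (b j) (b l)) := by
    intro i j l hli hlj hij
    have := hX (b j) (b l) (b i) (b i) (b l)
    rw [ho i l hli.symm, ho j l hlj.symm, ho j i hij.symm, ho l i hli] at this
    linear_combination this + B (b i) (b i) * ha (b j) (b l) (b l)
  have hdiag : ∀ i j, i ≠ j → C (b i) (b j) (b i) = 0 := by
    intro i j hij
    obtain ⟨l, hli, hlj, -⟩ := room i j j
    obtain ⟨m, hmi, hmj, hml⟩ := room i j l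
    have e1 := hpair i j l hli hlj hij
    have e2 := hpair i j m hmi hmj hij
    have e3 := hpair l j m hml hmj hlj
    have : (2 * B (b l) (b l) * B (b m) (b m)) * C (b i) (b j) (b i) = 0 := by
      linear_combination B (b m) (b m) * e1 + B (b l) (b l) * e2 - B (b i) (b i) * e3
    exact (mul_eq_zero.1 this).resolve_left
      (mul_ne_zero (mul_ne_zero two_ne_zero (hd l)) (hd m))
  by_cases hij : i = j
  · rw [hij, hself]
  by_cases hki : k = i
  · rw [hki, hdiag i j hij]
  by_cases hkj : k = j
  · rw [hkj, ha, hdiag j i (Ne.symm hij), neg_zero]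
  exact hoff i j k hki hkj

/-- In dimension three an algebraic curvature tensor with vanishing Ricci contraction vanishes. -/
theorem curvature_eq_zero_of_finrank_three [FiniteDimensional ℝ E] (hdim : finrank ℝ E = 3)
    (B : E →L[ℝ] E →L[ℝ] ℝ) (hs : ∀ u v, B u v = B v u) (hn : ∀ u, (∀ v, B u v = 0) → u = 0)
    {R : E → E → E →ₗ[ℝ] E} {W : E → E → E → E → ℝ}
    (h1 : ∀ v w t, IsLinearMap ℝ fun u => W u v w t)
    (h2 : ∀ u w t, IsLinearMap ℝ fun v => W u v w t)
    (h3 : ∀ u v t, IsLinearMap ℝ fun w => W u v w t)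
    (h4 : ∀ u v w, IsLinearMap ℝ fun t => W u v w t)
    (ha : ∀ u v w t, W u v w t = -W v u w t) (ha' : ∀ u v w t, W u v w t = -W u v t w)
    (hp : ∀ u v w t, W u v w t = W w t u v)
    (hR : ∀ u w v t, B (R u w v) t = W u v w t)
    (htr : ∀ u w, LinearMap.trace ℝ E (R u w) = 0) (u v w t : E) : W u v w t = 0 := by
  obtain ⟨b, ho, hd⟩ := exists_orthogonal_basis_of_nondegenerate B hs hn
  revert b
  rw [hdim]
  intro b ho hd
  refine isLinearMap_eq_zero b (h4 u v w) (fun l => ?_) t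
  refine trilinear_eq_zero b (f := fun u v w => W u v w (b l)) (fun _ _ => h1 _ _ _)
    (fun _ _ => h2 _ _ _) (fun _ _ => h3 _ _ _) (fun i j k => ?_) u v w
  have tr : ∀ i k, W (b i) (b 0) (b k) (b 0) / B (b 0) (b 0)
      + W (b i) (b 1) (b k) (b 1) / B (b 1) (b 1) + W (b i) (b 2) (b k) (b 2) / B (b 2) (b 2)
      = 0 := by
    intro i k
    have := htr (b i) (b k)
    rw [trace_eq_of_orthogonal b ho hd, Fin.sum_univ_three] at this
    simpa [hR] using this
  have s1 : ∀ u w t, W u u w t = 0 := fun u w t => by linarith [ha u u w t]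
  have s2 : ∀ u v w, W u v w w = 0 := fun u v w => by linarith [ha' u v w w]
  have d0 := hd 0
  have d1 := hd 1
  have d2 := hd 2
  have t00 := tr 0 0
  have t11 := tr 1 1
  have t22 := tr 2 2
  have t01 := tr 0 1
  have t02 := tr 0 2
  have t12 := tr 1 2
  simp only [s1, s2, zero_div, zero_add, add_zero, div_eq_zero_iff, d0, d1, d2, or_false]
    at t00 t11 t22 t01 t02 t12
  have a2 : ∀ u v w t, W u v w t = W v u t w := fun u v w t => by rw [ha, ha', neg_neg]
  rw [a2 (b 1) (b 0)] at t11
  rw [a2 (b 2) (b 0), a2 (b 2) (b 1)] at t22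
  rw [ha (b 1) (b 0), ha' (b 0) (b 1)] at t12
  rw [ha' (b 0) (b 1)] at t02
  simp only [neg_neg, neg_eq_zero] at t02 t12
  field_simp at t00 t11 t22
  have w1 : W (b 0) (b 1) (b 0) (b 1) = 0 := by
    have : (2 * B (b 2) (b 2)) * W (b 0) (b 1) (b 0) (b 1) = 0 := by
      linear_combination t00 + t11 - t22
    exact (mul_eq_zero.1 this).resolve_left (mul_ne_zero two_ne_zero d2)
  have w2 : W (b 0) (b 2) (b 0) (b 2) = 0 := by
    have : B (b 1) (b 1) * W (b 0) (b 2) (b 0) (b 2) = 0 := by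
      linear_combination t00 - B (b 2) (b 2) * w1
    exact (mul_eq_zero.1 this).resolve_left d1
  have w3 : W (b 1) (b 2) (b 1) (b 2) = 0 := by
    have : B (b 0) (b 0) * W (b 1) (b 2) (b 1) (b 2) = 0 := by
      linear_combination t11 - B (b 2) (b 2) * w1
    exact (mul_eq_zero.1 this).resolve_left d0
  -- the mixed components vanish by the traces off the diagonal, the others by `w1`, `w2`, `w3`
  have ord : ∀ i j k l : Fin 3, i < j → k < l → W (b i) (b j) (b k) (b l) = 0 := by
    have two : ∀ i j : Fin 3, i < j → (i = 0 ∧ j = 1) ∨ (i = 0 ∧ j = 2) ∨ (i = 1 ∧ j = 2) := by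
      decide
    intro i j k l hij hkl
    rcases two i j hij with ⟨rfl, rfl⟩ | ⟨rfl, rfl⟩ | ⟨rfl, rfl⟩ <;>
    rcases two k l hkl with ⟨rfl, rfl⟩ | ⟨rfl, rfl⟩ | ⟨rfl, rfl⟩ <;>
    first | assumption | (rw [hp]; assumption)
  have ord' : ∀ i j k l : Fin 3, i < j → W (b i) (b j) (b k) (b l) = 0 := by
    intro i j k l hij
    rcases lt_trichotomy k l with hkl | rfl | hkl
    · exact ord i j k l hij hkl
    · exact s2 _ _ _
    · rw [ha', ord i j l k hij hkl, neg_zero]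
  rcases lt_trichotomy i j with hij | rfl | hij
  · exact ord' i j k l hij
  · exact s1 _ _ _
  · rw [ha, ord' j i k l hij, neg_zero]

end Algebra

/-! ### Schouten, Weyl and Cotton tensors -/

section Schouten

variable {E : Type*} [NormedAddCommGroup E] [NormedSpace ℝ E]

/-- The endomorphism `v ↦ R(u, v) w`, whose trace is the Ricci tensor `Ric(u, w)`. -/
def curvEnd (Γ : E → E →L[ℝ] E →L[ℝ] E) (x u w : E) : E →ₗ[ℝ] E where
  toFun v := curv Γ x u v w
  map_add' v v' := by simp only [curv, map_add, add_apply]; abel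
  map_smul' c v := by
    simp only [curv, map_smul, smul_apply, RingHom.id_apply, smul_sub, smul_add]

theorem isLinearMap_curv₁ (Γ : E → E →L[ℝ] E →L[ℝ] E) (x v w : E) :
    IsLinearMap ℝ fun u => curv Γ x u v w :=
  ⟨fun u u' => by simp only [curv, map_add, add_apply]; abel, fun c u => by
    simp only [curv, map_smul, smul_apply, smul_sub, smul_add]⟩

theorem isLinearMap_curv₂ (Γ : E → E →L[ℝ] E →L[ℝ] E) (x u w : E) :
    IsLinearMap ℝ fun v => curv Γ x u v w := (curvEnd Γ x u w).isLinear

theorem isLinearMap_curv₃ (Γ : E → E →L[ℝ] E →L[ℝ] E) (x u v : E) :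
    IsLinearMap ℝ fun w => curv Γ x u v w :=
  ⟨fun u u' => by simp only [curv, map_add]; abel, fun c u => by
    simp only [curv, map_smul, smul_sub, smul_add]⟩

/-- The Weyl tensor vanishes at `x`: the curvature is the Kulkarni–Nomizu product of the metric `h`
and the form `S`, where `Q` is the endomorphism field with `h (Q u, v) = S (u, v)`. -/
def WeylFree (h S : E → E →L[ℝ] E →L[ℝ] ℝ) (Q : E → E →L[ℝ] E) (Γ : E → E →L[ℝ] E →L[ℝ] E)
    (x : E) : Prop :=
  ∀ u v z, curv Γ x u v z = S x u z • v - S x v z • u + h x u z • Q x v - h x v z • Q x u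

/-- The Cotton tensor vanishes at `x`. -/
def CottonFree (S : E → E →L[ℝ] E →L[ℝ] ℝ) (Γ : E → E →L[ℝ] E →L[ℝ] E) (x : E) : Prop :=
  ∀ u v z, covD Γ S x u v z = covD Γ S x v u z

/-- `S` is the Schouten tensor of the metric `h`, and `Q` is the same tensor with one index raised.
The field `ricci` says `Ric = (n - 2) S + (tr Q) h`. -/
structure IsSchouten (h S : E → E →L[ℝ] E →L[ℝ] ℝ) (Q : E → E →L[ℝ] E)
    (Γ : E → E →L[ℝ] E →L[ℝ] E) (U : Set E) : Prop where
  smooth_form : ContDiffOn ℝ ∞ S U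
  smooth_end : ContDiffOn ℝ ∞ Q U
  metric_apply : ∀ x ∈ U, ∀ u v, h x (Q x u) v = S x u v
  symm : ∀ x ∈ U, ∀ u v, S x u v = S x v u
  ricci : ∀ x ∈ U, ∀ u z, LinearMap.trace ℝ E (curvEnd Γ x u z)
    = ((finrank ℝ E : ℝ) - 2) * S x u z + LinearMap.trace ℝ E (Q x).toLinearMap * h x u z

variable {h S : E → E →L[ℝ] E →L[ℝ] ℝ} {Γ : E → E →L[ℝ] E →L[ℝ] E} {Q : E → E →L[ℝ] E} {U : Set E}

theorem trace_kulkarniNomizu [FiniteDimensional ℝ E] {f : E →ₗ[ℝ] E} {S h : E →L[ℝ] E →L[ℝ] ℝ}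
    {Q : E →L[ℝ] E} {u z : E} (hQ : h (Q u) z = S u z) (hs : ∀ u v, h u v = h v u)
    (hS : ∀ u v, S u v = S v u)
    (hf : ∀ v, f v = S u z • v - S v z • u + h u z • Q v - h v z • Q u) :
    LinearMap.trace ℝ E f
      = ((finrank ℝ E : ℝ) - 2) * S u z + LinearMap.trace ℝ E Q.toLinearMap * h u z := by
  have : f = S u z • LinearMap.id - (S z).toLinearMap.smulRight u + h u z • Q.toLinearMap
      - (h z).toLinearMap.smulRight (Q u) := by
    ext v
    simp [hf, hS z, hs z]
  rw [this]
  simp only [map_sub, map_add, map_smul, LinearMap.trace_id, LinearMap.trace_smulRight]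
  have : h z (Q u) = S u z := by rw [hs, hQ]
  simp [this, hS z]
  ring

/-- The Ricci tensor is symmetric, by the pair symmetry of the curvature. -/
theorem IsLeviCivita.ricci_symm [FiniteDimensional ℝ E] (L : IsLeviCivita h Γ U) {x : E}
    (hx : x ∈ U) (u z : E) :
    LinearMap.trace ℝ E (curvEnd Γ x u z) = LinearMap.trace ℝ E (curvEnd Γ x z u) := by
  obtain ⟨b, ho, hd⟩ := exists_orthogonal_basis_of_nondegenerate (h x) (L.symm x hx) (L.nondeg x hx)
  rw [trace_eq_of_orthogonal b ho hd, trace_eq_of_orthogonal b ho hd]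
  exact Finset.sum_congr rfl fun i _ => by
    congr 1
    exact L.curv_pair_symm hx u (b i) z (b i)

/-- In dimension three the Weyl tensor vanishes: it is an algebraic curvature tensor without
trace. -/
theorem WeylFree.of_finrank_three [FiniteDimensional ℝ E] (hdim : finrank ℝ E = 3)
    (L : IsLeviCivita h Γ U) (hSch : IsSchouten h S Q Γ U) {x : E} (hx : x ∈ U) :
    WeylFree h S Q Γ x := by
  set K : E → E → E → E := fun u v z =>
    S x u z • v - S x v z • u + h x u z • Q x v - h x v z • Q x u with hK
  let W : E → E → E → E → ℝ := fun u v z t => h x (curv Γ x u v z - K u v z) t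
  let KE : E → E → E →ₗ[ℝ] E := fun u z => S x u z • LinearMap.id
    - (S x z).toLinearMap.smulRight u + h x u z • (Q x).toLinearMap
      - (h x z).toLinearMap.smulRight (Q x u)
  have hKE : ∀ u z v, KE u z v = K u v z := fun u z v => by
    simp [KE, hK, hSch.symm x hx z, L.symm x hx z]
  have hW : ∀ u v z t, W u v z t = h x (curv Γ x u v z) t
      - (S x u z * h x v t - S x v z * h x u t + h x u z * S x v t - h x v z * S x u t) := by
    intro u v z t
    simp [W, hK, hSch.metric_apply x hx]
  -- `W` is the Weyl tensor, and `KE` writes the Kulkarni–Nomizu product as an endomorphism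
  have main := curvature_eq_zero_of_finrank_three hdim (h x) (L.symm x hx) (L.nondeg x hx)
    (R := fun u z => curvEnd Γ x u z - KE u z) (W := W) ?_ ?_ ?_ ?_ ?_ ?_ ?_ ?_ ?_
  · intro u v z
    rw [← sub_eq_zero]
    exact L.nondeg x hx _ fun t => main u v z t
  · intro v w t
    have := isLinearMap_curv₁ Γ x v w
    refine ⟨fun a b => ?_, fun c a => ?_⟩
    · simp only [hW, this.map_add, map_add, add_apply]; ring
    · simp only [hW, this.map_smul, map_smul, smul_apply, smul_eq_mul]; ring
  · intro u w t
    have := isLinearMap_curv₂ Γ x u w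
    refine ⟨fun a b => ?_, fun c a => ?_⟩
    · simp only [hW, this.map_add, map_add, add_apply]; ring
    · simp only [hW, this.map_smul, map_smul, smul_apply, smul_eq_mul]; ring
  · intro u v t
    have := isLinearMap_curv₃ Γ x u v
    refine ⟨fun a b => ?_, fun c a => ?_⟩
    · simp only [hW, this.map_add, map_add, add_apply]; ring
    · simp only [hW, this.map_smul, map_smul, smul_apply, smul_eq_mul]; ring
  · intro u v w
    refine ⟨fun a b => ?_, fun c a => ?_⟩
    · simp only [hW, map_add]; ring
    · simp only [hW, map_smul, smul_eq_mul]; ring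
  · intro u v w t
    rw [hW, hW, curv_antisymm]; simp; ring
  · intro u v w t
    rw [hW, hW, L.curv_metric_antisymm hx]; ring
  · intro u v w t
    rw [hW, hW, L.curv_pair_symm hx, hSch.symm x hx u w, hSch.symm x hx v t, L.symm x hx u w,
      L.symm x hx v t, hSch.symm x hx u t, hSch.symm x hx v w, L.symm x hx u t, L.symm x hx v w]
    ring
  · intro u w v t
    simp only [LinearMap.sub_apply, hKE]; rfl
  · intro u w
    rw [map_sub, hSch.ricci x hx, trace_kulkarniNomizu (f := KE u w) (S := S x) (h := h x)
      (Q := Q x) (hSch.metric_apply x hx u w) (L.symm x hx) (hSch.symm x hx) (hKE u w), sub_self]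

/-- A curvature of Kulkarni–Nomizu form determines the Schouten tensor. -/
theorem IsSchouten.eq_of_kulkarniNomizu [FiniteDimensional ℝ E] (hdim : 3 ≤ finrank ℝ E)
    (L : IsLeviCivita h Γ U) (hSch : IsSchouten h S Q Γ U) {x : E} (hx : x ∈ U) {A : E →L[ℝ] E}
    (hA : ∀ u v, h x (A u) v = h x (A v) u)
    (hR : ∀ u v z, curv Γ x u v z
      = h x (A u) z • v - h x (A v) z • u + h x u z • A v - h x v z • A u) : A = Q x := by
  have hn : (3 : ℝ) ≤ finrank ℝ E := by exact_mod_cast hdim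
  have e : ∀ u z, ((finrank ℝ E : ℝ) - 2) * h x (A u) z
      + LinearMap.trace ℝ E A.toLinearMap * h x u z
      = ((finrank ℝ E : ℝ) - 2) * h x (Q x u) z
        + LinearMap.trace ℝ E (Q x).toLinearMap * h x u z := by
    intro u z
    rw [hSch.metric_apply x hx, ← hSch.ricci x hx]
    exact (trace_kulkarniNomizu (f := curvEnd Γ x u z) (S := (h x).comp A) (h := h x) (Q := A) rfl
      (L.symm x hx) hA (fun v => hR u v z)).symm
  set n : ℝ := (finrank ℝ E : ℝ)
  set a := LinearMap.trace ℝ E A.toLinearMap with ha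
  set q := LinearMap.trace ℝ E (Q x).toLinearMap with hq
  have e' : (n - 2) • A.toLinearMap + a • LinearMap.id
      = (n - 2) • (Q x).toLinearMap + q • LinearMap.id := by
    ext u
    refine L.eq_of_metric hx fun z => ?_
    simpa using e u z
  have t := congrArg (LinearMap.trace ℝ E) e'
  simp only [map_add, map_smul, LinearMap.trace_id, smul_eq_mul, ← ha, ← hq] at t
  have haq : a = q := by
    have : (2 * n - 2) * (a - q) = 0 := by linear_combination t
    rcases mul_eq_zero.1 this with h' | h'
    · linarith
    · linarith
  ext u
  refine L.eq_of_metric hx fun z => ?_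
  have := e u z
  rw [haq] at this
  have h2 : n - 2 ≠ 0 := by linarith
  exact mul_left_cancel₀ h2 (add_right_cancel this)

theorem IsSchouten.metric_fderiv_end (L : IsLeviCivita h Γ U) (hSch : IsSchouten h S Q Γ U)
    {x : E} (hx : x ∈ U) (w v t : E) : h x (fderiv ℝ Q x w v) t
      = fderiv ℝ S x w v t - h x (Γ x w (Q x v)) t - S x v (Γ x w t) := by
  have dh := ((L.contDiffAt_metric hx).differentiableAt (by simp)).hasFDerivAt
  have dS := ((hSch.smooth_form.contDiffAt (L.isOpen.mem_nhds hx)).differentiableAt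
    (by simp)).hasFDerivAt
  have dQ := ((hSch.smooth_end.contDiffAt (L.isOpen.mem_nhds hx)).differentiableAt
    (by simp)).hasFDerivAt
  have l := (dh.clm_apply (dQ.clm_apply (hasFDerivAt_const v x))).clm_apply (hasFDerivAt_const t x)
  have r := (dS.clm_apply (hasFDerivAt_const v x)).clm_apply (hasFDerivAt_const t x)
  have := (l.congr_of_eventuallyEq (Filter.eventuallyEq_of_mem (L.isOpen.mem_nhds hx)
      fun y hy => (hSch.metric_apply y hy v t).symm)).unique r
  have := congrArg (fun L => L w) this
  simp [L.compat x hx, hSch.metric_apply x hx] at this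
  linarith

/-- In dimension at least four the Cotton tensor vanishes if the Weyl tensor does: the second
Bianchi identity for a curvature of Kulkarni–Nomizu form is an algebraic identity for the Cotton
tensor. -/
theorem CottonFree.of_weylFree [FiniteDimensional ℝ E] (hdim : 4 ≤ finrank ℝ E)
    (L : IsLeviCivita h Γ U) (hSch : IsSchouten h S Q Γ U)
    (hW : ∀ x ∈ U, WeylFree h S Q Γ x) {x : E} (hx : x ∈ U) : CottonFree S Γ x := by
  have dh := ((L.contDiffAt_metric hx).differentiableAt (by simp)).hasFDerivAt
  have dS := ((hSch.smooth_form.contDiffAt (L.isOpen.mem_nhds hx)).differentiableAt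
    (by simp)).hasFDerivAt
  have dQ := ((hSch.smooth_end.contDiffAt (L.isOpen.mem_nhds hx)).differentiableAt
    (by simp)).hasFDerivAt
  have c2 : ∀ {B : E → E →L[ℝ] E →L[ℝ] ℝ} (_ : HasFDerivAt B (fderiv ℝ B x) x) (p q : E),
      HasFDerivAt (fun y => B y p q) (((fderiv ℝ B x).flip p).flip q) x := by
    intro B dB p q
    simpa using (dB.clm_apply (hasFDerivAt_const p x)).clm_apply (hasFDerivAt_const q x)
  have c1 : ∀ p : E, HasFDerivAt (fun y => Q y p) ((fderiv ℝ Q x).flip p) x := by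
    intro p
    simpa using dQ.clm_apply (hasFDerivAt_const p x)
  have dR : ∀ u v z w, fderiv ℝ (fun y => curv Γ y u v z) x w
      = fderiv ℝ S x w u z • v - fderiv ℝ S x w v z • u
        + (h x u z • fderiv ℝ Q x w v + fderiv ℝ h x w u z • Q x v)
        - (h x v z • fderiv ℝ Q x w u + fderiv ℝ h x w v z • Q x u) := by
    intro u v z w
    have r := (((((c2 dS u z).smul_const v).sub ((c2 dS v z).smul_const u)).add
      ((c2 dh u z).smul (c1 v))).sub ((c2 dh v z).smul (c1 u)))
    have := (r.congr_of_eventuallyEq (Filter.eventuallyEq_of_mem (L.isOpen.mem_nhds hx)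
      fun y hy => hW y hy u v z)).fderiv
    rw [this]
    simp
  have lin1 : ∀ v w, IsLinearMap ℝ fun u => covD Γ S x u v w - covD Γ S x v u w := fun v w =>
    ⟨fun a b => by simp only [covD, map_add, add_apply]; ring,
      fun c a => by simp only [covD, map_smul, smul_apply, smul_eq_mul]; ring⟩
  have lin2 : ∀ u w, IsLinearMap ℝ fun v => covD Γ S x u v w - covD Γ S x v u w := fun v w =>
    ⟨fun a b => by simp only [covD, map_add, add_apply]; ring,
      fun c a => by simp only [covD, map_smul, smul_apply, smul_eq_mul]; ring⟩
  have lin3 : ∀ u v, IsLinearMap ℝ fun w => covD Γ S x u v w - covD Γ S x v u w := fun v w =>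
    ⟨fun a b => by simp only [covD, map_add]; ring,
      fun c a => by simp only [covD, map_smul, smul_eq_mul]; ring⟩
  have := cotton_eq_zero_of_bianchi hdim (h x) (L.symm x hx) (L.nondeg x hx) lin1 lin2 lin3
    (fun u v w => by ring) ?_
  · intro u v z
    linarith [this u v z]
  intro u v w z t
  have B := congrArg (fun y => h x y t) (curv_second_bianchi (L.contDiffAt_conn hx) u v w z)
  simp only [dR, hW x hx _ _ _, L.compat x hx, map_add, map_sub, map_smul, add_apply, sub_apply,
    smul_apply, smul_eq_mul, hSch.metric_fderiv_end L hx, hSch.metric_apply x hx, map_zero,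
    zero_apply] at B
  simp only [covD]
  rw [L.torsion_free x hx w u, L.torsion_free x hx w v, L.torsion_free x hx v u] at *
  rw [hSch.symm x hx (Γ x u v) z, hSch.symm x hx (Γ x u w) z, hSch.symm x hx (Γ x v w) z] at *
  linear_combination B

end Schouten

/-! ### Conformal changes of the metric -/

section Conformal

variable {E : Type*} [NormedAddCommGroup E] [NormedSpace ℝ E]

/-- The Christoffel form `Γ(u, v) + ⟨k, u⟩ v + ⟨k, v⟩ u - ⟨u, v⟩ k` of the metric `e^{2f} h`, where
`k` is the gradient of `f`. -/
def confConn (h : E → E →L[ℝ] E →L[ℝ] ℝ) (Γ : E → E →L[ℝ] E →L[ℝ] E) (k : E → E) (x : E) :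
    E →L[ℝ] E →L[ℝ] E :=
  Γ x + (h x (k x)).smulRight (ContinuousLinearMap.id ℝ E)
    + ContinuousLinearMap.smulRightL ℝ E E (h x (k x))
    - ((ContinuousLinearMap.smulRightL ℝ E E).flip (k x)).comp (h x)

theorem confConn_apply (h : E → E →L[ℝ] E →L[ℝ] ℝ) (Γ : E → E →L[ℝ] E →L[ℝ] E) (k : E → E)
    (x u v : E) : confConn h Γ k x u v
      = Γ x u v + h x (k x) u • v + h x (k x) v • u - h x u v • k x := by
  simp [confConn]

/-- The tensor `∇k - k ⊗ k + ½ |k|²` by which the Schouten tensor changes under a conformal change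
with gradient `k`. -/
def confSchouten (h : E → E →L[ℝ] E →L[ℝ] ℝ) (Γ : E → E →L[ℝ] E →L[ℝ] E) (k : E → E) (x : E) :
    E →L[ℝ] E :=
  fderiv ℝ k x + (Γ x).flip (k x) - (h x (k x)).smulRight (k x)
    + ((1 / 2) * h x (k x) (k x)) • ContinuousLinearMap.id ℝ E

theorem confSchouten_apply (h : E → E →L[ℝ] E →L[ℝ] ℝ) (Γ : E → E →L[ℝ] E →L[ℝ] E) (k : E → E)
    (x v : E) : confSchouten h Γ k x v
      = fderiv ℝ k x v + Γ x v (k x) - h x (k x) v • k x + ((1 / 2) * h x (k x) (k x)) • v := by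
  simp [confSchouten]

variable {h : E → E →L[ℝ] E →L[ℝ] ℝ} {Γ : E → E →L[ℝ] E →L[ℝ] E} {U : Set E} {f : E → ℝ}
  {k : E → E}

theorem IsLeviCivita.contDiffOn_confConn (L : IsLeviCivita h Γ U) (hk : ContDiffOn ℝ ∞ k U) :
    ContDiffOn ℝ ∞ (confConn h Γ k) U := by
  have hh := L.smooth_metric
  have hΓ := L.smooth_conn
  have hκ : ContDiffOn ℝ ∞ (fun x => h x (k x)) U := hh.clm_apply hk
  refine ((hΓ.add ?_).add ?_).sub ?_
  · have := ((ContinuousLinearMap.smulRightL ℝ E (E →L[ℝ] E)).flip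
      (ContinuousLinearMap.id ℝ E)).contDiff.comp_contDiffOn hκ
    exact this
  · exact (ContinuousLinearMap.smulRightL ℝ E E).contDiff.comp_contDiffOn hκ
  · exact ((ContinuousLinearMap.smulRightL ℝ E E).flip.contDiff.comp_contDiffOn hk).clm_comp hh

/-- `confConn` is the Levi-Civita connection of the metric `e^{2f} h`. -/
theorem IsLeviCivita.conformal (L : IsLeviCivita h Γ U) (hf : ContDiffOn ℝ ∞ f U)
    (hk : ContDiffOn ℝ ∞ k U) (hfk : ∀ x ∈ U, ∀ v, h x (k x) v = fderiv ℝ f x v) :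
    IsLeviCivita (fun x => Real.exp (2 * f x) • h x) (confConn h Γ k) U where
  isOpen := L.isOpen
  smooth_metric := (contDiffOn_const.mul hf).exp.smul L.smooth_metric
  smooth_conn := L.contDiffOn_confConn hk
  symm x hx u v := by simp [L.symm x hx u v]
  nondeg x hx u hu := L.nondeg x hx u fun v => by simpa using hu v
  torsion_free x hx u v := by
    rw [confConn_apply, confConn_apply, L.symm x hx u v, L.torsion_free x hx u v]; abel
  compat x hx u v w := by
    have dh := ((L.contDiffAt_metric hx).differentiableAt (by simp)).hasFDerivAt
    have df := ((hf.contDiffAt (L.isOpen.mem_nhds hx)).differentiableAt (by simp)).hasFDerivAt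
    have := ((df.const_mul 2).exp.smul dh).fderiv
    have e : fderiv ℝ (fun x => Real.exp (2 * f x) • h x) x u v w
        = Real.exp (2 * f x) * (fderiv ℝ h x u v w + 2 * fderiv ℝ f x u * h x v w) := by
      refine (congrArg (fun L => L u v w) this).trans ?_
      simp
      ring
    rw [e, confConn_apply, confConn_apply, L.compat x hx, ← hfk x hx u]
    simp
    rw [L.symm x hx v u, L.symm x hx v (k x)]
    ring

theorem IsLeviCivita.confSchouten_symm (L : IsLeviCivita h Γ U) (hf : ContDiffOn ℝ ∞ f U)
    (hk : ContDiffOn ℝ ∞ k U) (hfk : ∀ x ∈ U, ∀ v, h x (k x) v = fderiv ℝ f x v) {x : E}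
    (hx : x ∈ U) (u v : E) :
    h x (confSchouten h Γ k x u) v = h x (confSchouten h Γ k x v) u := by
  have dh := ((L.contDiffAt_metric hx).differentiableAt (by simp)).hasFDerivAt
  have hf' := hf.contDiffAt (L.isOpen.mem_nhds hx)
  have df1 := ((hf'.fderiv_right (m := ∞) (by simp)).differentiableAt (by simp)).hasFDerivAt
  have dk := ((hk.contDiffAt (L.isOpen.mem_nhds hx)).differentiableAt (by simp)).hasFDerivAt
  have sym : ∀ a b, fderiv ℝ (fderiv ℝ f) x a b = fderiv ℝ (fderiv ℝ f) x b a :=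
    hf'.isSymmSndFDerivAt minSmoothness_two_le
  have key : ∀ a b, fderiv ℝ h x a (k x) b + h x (fderiv ℝ k x a) b
      = fderiv ℝ (fderiv ℝ f) x a b := by
    intro a b
    have l := (dh.clm_apply dk).clm_apply (hasFDerivAt_const b x)
    have r := df1.clm_apply (hasFDerivAt_const b x)
    have := (r.congr_of_eventuallyEq (Filter.eventuallyEq_of_mem (L.isOpen.mem_nhds hx)
      fun y hy => hfk y hy b)).unique l
    have := congrArg (fun L => L a) this
    simp at this
    rw [this, add_comm]
  have k1 := key u v
  have k2 := key v u
  rw [sym v u, ← k1] at k2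
  rw [confSchouten_apply, confSchouten_apply]
  simp [L.compat x hx] at k2 ⊢
  rw [L.torsion_free x hx v u] at k2
  rw [L.symm x hx v u]
  linear_combination -k2

/-- The change of curvature under a conformal change of the metric: the Schouten tensor changes by
`confSchouten`, and the Weyl tensor does not change. -/
theorem IsLeviCivita.curv_confConn (L : IsLeviCivita h Γ U) (hf : ContDiffOn ℝ ∞ f U)
    (hk : ContDiffOn ℝ ∞ k U) (hfk : ∀ x ∈ U, ∀ v, h x (k x) v = fderiv ℝ f x v) {x : E}
    (hx : x ∈ U) (u v w : E) :
    curv (confConn h Γ k) x u v w = curv Γ x u v w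
      - (h x (confSchouten h Γ k x u) w • v - h x (confSchouten h Γ k x v) w • u
        + h x u w • confSchouten h Γ k x v - h x v w • confSchouten h Γ k x u) := by
  have dh := ((L.contDiffAt_metric hx).differentiableAt (by simp)).hasFDerivAt
  have dΓ := ((L.contDiffAt_conn hx).differentiableAt (by simp)).hasFDerivAt
  have dk := ((hk.contDiffAt (L.isOpen.mem_nhds hx)).differentiableAt (by simp)).hasFDerivAt
  have dC := (((L.contDiffOn_confConn hk).contDiffAt (L.isOpen.mem_nhds hx)).differentiableAt
    (by simp)).hasFDerivAt
  have ck : ∀ p : E, HasFDerivAt (fun y => h y (k y) p)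
      ((((fderiv ℝ h x).flip (k x)).flip p) + ((h x).flip p).comp (fderiv ℝ k x)) x := by
    intro p
    exact ((dh.clm_apply dk).clm_apply (hasFDerivAt_const p x)).congr_fderiv
      (by ext; simp [add_comm])
  have ch : ∀ p q : E, HasFDerivAt (fun y => h y p q) (((fderiv ℝ h x).flip p).flip q) x := by
    intro p q
    simpa using (dh.clm_apply (hasFDerivAt_const p x)).clm_apply (hasFDerivAt_const q x)
  have cΓ : ∀ p q : E, HasFDerivAt (fun y => Γ y p q) (((fderiv ℝ Γ x).flip p).flip q) x := by
    intro p q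
    simpa using (dΓ.clm_apply (hasFDerivAt_const p x)).clm_apply (hasFDerivAt_const q x)
  have key : ∀ a b c, fderiv ℝ (confConn h Γ k) x a b c = fderiv ℝ Γ x a b c
      + (fderiv ℝ h x a (k x) b + h x (fderiv ℝ k x a) b) • c
      + (fderiv ℝ h x a (k x) c + h x (fderiv ℝ k x a) c) • b
      - (h x b c • fderiv ℝ k x a + fderiv ℝ h x a b c • k x) := by
    intro a b c
    have l := (dC.clm_apply (hasFDerivAt_const b x)).clm_apply (hasFDerivAt_const c x)
    have r := (((cΓ b c).add ((ck b).smul_const c)).add ((ck c).smul_const b)).sub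
      ((ch b c).smul dk)
    have := l.unique (r.congr_of_eventuallyEq (Filter.Eventually.of_forall fun y =>
      confConn_apply h Γ k y b c))
    have := congrArg (fun L => L a) this
    simpa using this
  have s := L.confSchouten_symm hf hk hfk hx u v
  rw [confSchouten_apply, confSchouten_apply] at s
  refine L.eq_of_metric hx fun t => ?_
  simp only [confSchouten_apply, curv, key, confConn_apply, L.compat x hx, map_add, map_sub,
    map_smul, add_apply, sub_apply, smul_apply, smul_eq_mul] at s ⊢
  rw [L.symm x hx v (k x), L.symm x hx u (k x), L.symm x hx v u,
    L.symm x hx v (Γ x u w), L.symm x hx u (Γ x v w)] at *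
  rw [L.torsion_free x hx v u] at *
  linear_combination (-h x w t) * s

end Conformal

/-! ### Frobenius' theorem for linear systems -/

section TotalDifferential

open Metric Set
open scoped NNReal

variable {E W : Type*} [NormedAddCommGroup E] [NormedSpace ℝ E] [NormedAddCommGroup W]
  [NormedSpace ℝ W]

/-- The linear equation `y' = A(x₀ + t ξ) ξ y` along a short ray has a solution up to time one. -/
theorem exists_solution_along_ray [CompleteSpace W] {A : E → E →L[ℝ] W →L[ℝ] W} {x₀ ξ : E} {M : ℝ}
    (hA : ∀ t ∈ Icc (0 : ℝ) 1, ContinuousAt A (x₀ + t • ξ))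
    (hM : ∀ t ∈ Icc (0 : ℝ) 1, ‖A (x₀ + t • ξ)‖ ≤ M) (hξ : M * ‖ξ‖ ≤ 1 / 2) (y₀ : W) :
    ∃ y : ℝ → W, y 0 = y₀ ∧ ∀ t ∈ Icc (0 : ℝ) 1,
      HasDerivWithinAt y (A (x₀ + t • ξ) ξ (y t)) (Icc 0 1) t := by
  have hop : ∀ t ∈ Icc (0 : ℝ) 1, ‖A (x₀ + t • ξ) ξ‖ ≤ 1 / 2 := fun t ht =>
    ((A (x₀ + t • ξ)).le_opNorm ξ).trans
      ((mul_le_mul_of_nonneg_right (hM t ht) (norm_nonneg ξ)).trans hξ)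
  let a : ℝ≥0 := ⟨‖y₀‖ + 1, by positivity⟩
  have hPL : IsPicardLindelof (fun t y => A (x₀ + t • ξ) ξ y) (tmin := 0) (tmax := 1)
      (⟨0, by simp⟩ : Icc (0 : ℝ) 1) y₀ a 0 a (1 / 2) := by
    refine ⟨fun t ht => ?_, fun y _ t ht => ?_, fun t ht y hy => ?_, ?_⟩
    · refine LipschitzOnWith.of_dist_le_mul fun y _ z _ => ?_
      rw [dist_eq_norm, dist_eq_norm, ← map_sub]
      refine ((A (x₀ + t • ξ) ξ).le_opNorm _).trans ?_
      exact mul_le_mul_of_nonneg_right (by simpa using hop t ht) (norm_nonneg _)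
    · have c1 : ContinuousAt (fun t : ℝ => A (x₀ + t • ξ)) t :=
        ContinuousAt.comp (f := fun t : ℝ => x₀ + t • ξ) (hA t ht) (by fun_prop)
      exact ((c1.clm_apply continuousAt_const).clm_apply continuousAt_const).continuousWithinAt
    · have hy' : ‖y‖ ≤ ‖y₀‖ + a := by
        have := norm_sub_norm_le y y₀
        rw [mem_closedBall, dist_eq_norm] at hy
        linarith
      have ha : (a : ℝ) = ‖y₀‖ + 1 := rfl
      refine ((A (x₀ + t • ξ) ξ).le_opNorm _).trans ?_
      refine (mul_le_mul (hop t ht) hy' (norm_nonneg _) (by norm_num)).trans ?_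
      rw [ha]; linarith [norm_nonneg y₀]
    · simp
  exact hPL.exists_eq_forall_mem_Icc_hasDerivWithinAt₀

/-- Comparison of the solutions along two neighbouring rays. If `y` solves the linear equation
along the ray `ξ`, then under the integrability condition `y + t A(x₀ + t ξ) η y` solves the
equation along the ray `ξ + η` up to an error of order `‖η‖²`. -/
theorem norm_sub_le_of_solutions_along_rays {A : E → E →L[ℝ] W →L[ℝ] W} {x₀ ξ η : E} {M Y₀ : ℝ}
    {s : Set E} (hs : Convex ℝ s) (hM0 : 0 < M) (hY0 : 0 ≤ Y₀)
    (hxs : ∀ t ∈ Icc (0 : ℝ) 1, x₀ + t • ξ ∈ s) (hxs' : ∀ t ∈ Icc (0 : ℝ) 1, x₀ + t • (ξ + η) ∈ s)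
    (hA : ∀ x ∈ s, DifferentiableAt ℝ A x) (hM : ∀ x ∈ s, ‖A x‖ ≤ M)
    (hM' : ∀ x ∈ s, ‖fderiv ℝ A x‖ ≤ M)
    (hL : ∀ x ∈ s, ∀ x' ∈ s, ‖fderiv ℝ A x' - fderiv ℝ A x‖ ≤ M * ‖x' - x‖)
    (hξ : ‖ξ‖ ≤ 1) (hξη : ‖ξ + η‖ ≤ 1) (hη : ‖η‖ ≤ 1)
    (hint : ∀ x ∈ s, ∀ u v Y, fderiv ℝ A x u v Y + A x v (A x u Y)
      = fderiv ℝ A x v u Y + A x u (A x v Y))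
    {y z : ℝ → W} (h0 : y 0 = z 0)
    (hy : ∀ t ∈ Icc (0 : ℝ) 1, HasDerivWithinAt y (A (x₀ + t • ξ) ξ (y t)) (Icc 0 1) t)
    (hz : ∀ t ∈ Icc (0 : ℝ) 1,
      HasDerivWithinAt z (A (x₀ + t • (ξ + η)) (ξ + η) (z t)) (Icc 0 1) t)
    (hyb : ∀ t ∈ Icc (0 : ℝ) 1, ‖y t‖ ≤ Y₀) :
    ‖z 1 - y 1 - A (x₀ + ξ) η (y 1)‖
      ≤ (4 * M * (1 + M) * Y₀ * ‖η‖ ^ 2) / M * (Real.exp M - 1) := by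
  have hwi : ∀ {q : ℝ → W} {q' : W} {t : ℝ}, t ∈ Ico (0 : ℝ) 1 →
      HasDerivWithinAt q q' (Icc 0 1) t → HasDerivWithinAt q q' (Ici t) t := fun {q q' t} ht hq =>
    (hq.mono (Icc_subset_Icc_left ht.1)).mono_of_mem_nhdsWithin
      (Icc_mem_nhdsGE_of_mem ⟨le_rfl, ht.2⟩)
  -- the approximate solution along the second ray and its derivative
  let Q : ℝ → W := fun t => y t + t • A (x₀ + t • ξ) η (y t)
  let Q' : ℝ → W := fun t => A (x₀ + t • ξ) ξ (y t) + (t • (fderiv ℝ A (x₀ + t • ξ) ξ η (y t)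
    + A (x₀ + t • ξ) η (A (x₀ + t • ξ) ξ (y t))) + (1 : ℝ) • A (x₀ + t • ξ) η (y t))
  have hQ : ∀ t ∈ Icc (0 : ℝ) 1, HasDerivWithinAt Q (Q' t) (Icc 0 1) t := by
    intro t ht
    have p : HasDerivAt (fun t : ℝ => x₀ + t • ξ) ξ t := by
      simpa using ((hasDerivAt_id t).smul_const ξ).const_add x₀
    have a : HasDerivAt (fun t : ℝ => A (x₀ + t • ξ)) (fderiv ℝ A (x₀ + t • ξ) ξ) t :=
      HasFDerivAt.comp_hasDerivAt (l := A) t (hA _ (hxs t ht)).hasFDerivAt p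
    have b := (a.clm_apply (hasDerivAt_const t η)).hasDerivWithinAt (s := Icc 0 1)
    have := (hy t ht).add ((hasDerivWithinAt_id t (Icc (0 : ℝ) 1)).smul (b.clm_apply (hy t ht)))
    exact HasDerivWithinAt.congr_deriv (f := Q) this (by simp [Q'])
  have hQy : ∀ t ∈ Icc (0 : ℝ) 1, ‖t • A (x₀ + t • ξ) η (y t)‖ ≤ M * ‖η‖ * Y₀ := by
    intro t ht
    rw [norm_smul, Real.norm_of_nonneg ht.1]
    have : ‖A (x₀ + t • ξ) η (y t)‖ ≤ M * ‖η‖ * Y₀ :=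
      ((A (x₀ + t • ξ) η).le_opNorm _).trans (mul_le_mul
        (((A (x₀ + t • ξ)).le_opNorm _).trans
          (mul_le_mul_of_nonneg_right (hM _ (hxs t ht)) (norm_nonneg _))) (hyb t ht)
          (norm_nonneg _) (by positivity))
    exact (mul_le_of_le_one_left (norm_nonneg _) ht.2).trans this
  have hQb : ∀ t ∈ Icc (0 : ℝ) 1, ‖Q t‖ ≤ (1 + M) * Y₀ := by
    intro t ht
    refine (norm_add_le _ _).trans ?_
    have : M * ‖η‖ * Y₀ ≤ M * Y₀ :=
      mul_le_mul_of_nonneg_right (mul_le_of_le_one_right hM0.le hη) hY0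
    linarith [hyb t ht, hQy t ht]
  have hB : ∀ t ∈ Icc (0 : ℝ) 1,
      ‖A (x₀ + t • (ξ + η)) - A (x₀ + t • ξ) - t • fderiv ℝ A (x₀ + t • ξ) η‖
        ≤ M * ‖η‖ ^ 2 := by
    intro t ht
    have hsub : segment ℝ (x₀ + t • ξ) (x₀ + t • (ξ + η)) ⊆ s :=
      hs.segment_subset (hxs t ht) (hxs' t ht)
    have e : x₀ + t • (ξ + η) - (x₀ + t • ξ) = t • η := by module
    have nt : ‖t • η‖ ≤ ‖η‖ := by
      rw [norm_smul, Real.norm_of_nonneg ht.1]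
      exact mul_le_of_le_one_left (norm_nonneg _) ht.2
    have bd : ∀ x ∈ segment ℝ (x₀ + t • ξ) (x₀ + t • (ξ + η)),
        ‖fderiv ℝ A x - fderiv ℝ A (x₀ + t • ξ)‖ ≤ M * ‖η‖ := by
      intro x hx
      refine (hL _ (hxs t ht) x (hsub hx)).trans (mul_le_mul_of_nonneg_left ?_ hM0.le)
      rw [segment_eq_image'] at hx
      obtain ⟨θ, hθ, rfl⟩ := hx
      rw [e, add_sub_cancel_left, norm_smul, Real.norm_of_nonneg hθ.1]
      exact (mul_le_of_le_one_left (norm_nonneg _) hθ.2).trans nt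
    have := Convex.norm_image_sub_le_of_norm_fderiv_le' (𝕜 := ℝ) (f := A)
      (fun x hx => hA x (hsub hx)) bd (convex_segment (𝕜 := ℝ) _ _)
      (left_mem_segment ℝ _ _) (right_mem_segment ℝ _ _)
    rw [e, map_smul] at this
    refine this.trans ?_
    rw [pow_two, ← mul_assoc]
    exact mul_le_mul_of_nonneg_left nt (by positivity)
  have herr : ∀ t ∈ Icc (0 : ℝ) 1, ‖A (x₀ + t • (ξ + η)) (ξ + η) (Q t) - Q' t‖
      ≤ 4 * M * (1 + M) * Y₀ * ‖η‖ ^ 2 := by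
    intro t ht
    have e : A (x₀ + t • (ξ + η)) (ξ + η) (Q t) - Q' t
        = (A (x₀ + t • (ξ + η)) - A (x₀ + t • ξ) - t • fderiv ℝ A (x₀ + t • ξ) η) (ξ + η) (Q t)
          + t • fderiv ℝ A (x₀ + t • ξ) η η (Q t)
          + t • fderiv ℝ A (x₀ + t • ξ) η ξ (t • A (x₀ + t • ξ) η (y t))
          + A (x₀ + t • ξ) η (t • A (x₀ + t • ξ) η (y t)) := by
      have i := hint _ (hxs t ht) ξ η (y t)
      simp only [Q, Q', map_add, map_smul, sub_apply, smul_apply, add_apply, smul_add]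
      linear_combination (norm := module) (-t) • i
    have n3 : ∀ (T : E →L[ℝ] W →L[ℝ] W) (p : E) (w : W) {c d e : ℝ}, ‖T‖ ≤ c → ‖p‖ ≤ d →
        ‖w‖ ≤ e → 0 ≤ c → 0 ≤ d → ‖T p w‖ ≤ c * d * e := fun T p w c d e hc hd he c0 d0 =>
      (T.le_opNorm₂ p w).trans (mul_le_mul (mul_le_mul hc hd (norm_nonneg _) c0) he
        (norm_nonneg _) (by positivity))
    have hD : ‖fderiv ℝ A (x₀ + t • ξ) η‖ ≤ M * ‖η‖ :=
      (ContinuousLinearMap.le_opNorm _ _).trans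
        (mul_le_mul_of_nonneg_right (hM' _ (hxs t ht)) (norm_nonneg _))
    have nt : ∀ w : W, ‖t • w‖ ≤ ‖w‖ := fun w => by
      rw [norm_smul, Real.norm_of_nonneg ht.1]
      exact mul_le_of_le_one_left (norm_nonneg _) ht.2
    have b1 := n3 _ (ξ + η) (Q t) (hB t ht) hξη (hQb t ht) (by positivity) zero_le_one
    have b2 := (nt _).trans (n3 _ η (Q t) hD le_rfl (hQb t ht) (by positivity) (norm_nonneg _))
    have b3 := (nt _).trans (n3 _ ξ _ hD hξ (hQy t ht) (by positivity) zero_le_one)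
    have b4 := n3 _ η _ (hM _ (hxs t ht)) le_rfl (hQy t ht) hM0.le (norm_nonneg _)
    rw [e]
    refine (norm_add_le _ _).trans ?_
    refine (add_le_add_left (norm_add_le _ _) _).trans ?_
    refine (add_le_add_left (add_le_add_left (norm_add_le _ _) _) _).trans ?_
    have : 0 ≤ M * Y₀ * ‖η‖ ^ 2 := by positivity
    nlinarith [b1, b2, b3, b4]
  have fin := norm_le_gronwallBound_of_norm_deriv_right_le (f := fun t => z t - Q t) (δ := 0)
    (f' := fun t => A (x₀ + t • (ξ + η)) (ξ + η) (z t) - Q' t) (K := M)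
    (ε := 4 * M * (1 + M) * Y₀ * ‖η‖ ^ 2) (a := 0) (b := 1)
    (fun t ht => ((hz t ht).sub (hQ t ht)).continuousWithinAt)
    (fun t ht => (hwi ht (hz t (Ico_subset_Icc_self ht))).sub
      (hwi ht (hQ t (Ico_subset_Icc_self ht)))) (by simp [Q, h0]) ?_ 1 (by simp)
  · rw [gronwallBound_of_K_ne_0 hM0.ne'] at fin
    simp only [zero_mul, sub_zero, mul_one, zero_add, Q, one_smul] at fin
    rwa [sub_sub]
  · intro t ht
    have ht := Ico_subset_Icc_self ht
    have e : A (x₀ + t • (ξ + η)) (ξ + η) (z t) - Q' t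
        = A (x₀ + t • (ξ + η)) (ξ + η) (z t - Q t)
          + (A (x₀ + t • (ξ + η)) (ξ + η) (Q t) - Q' t) := by
      rw [map_sub]; abel
    rw [e]
    refine (norm_add_le _ _).trans (add_le_add ?_ (herr t ht))
    refine ((A _).le_opNorm₂ _ _).trans (mul_le_mul_of_nonneg_right ?_ (norm_nonneg _))
    exact (mul_le_mul (hM _ (hxs' t ht)) hξη (norm_nonneg _) hM0.le).trans (by simp)

theorem eventually_norm_lt_add_one {f : E → W} {x : E} (hf : ContDiffAt ℝ ∞ f x) :
    ∀ᶠ z in 𝓝 x, ‖f z‖ < ‖f x‖ + 1 :=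
  Filter.Tendsto.eventually_lt_const (lt_add_one _) hf.continuousAt.norm

set_option maxHeartbeats 1600000 in
/-- **Frobenius' theorem for linear systems.** A linear total differential equation
`dY(v) = A(v) Y` with smooth coefficients satisfying the integrability condition has a local
solution with any given initial value, obtained by solving along the rays from `x₀`. -/
theorem exists_solution_totalDifferential [CompleteSpace W] {A : E → E →L[ℝ] W →L[ℝ] W}
    {U : Set E} (hU : IsOpen U) (hA : ContDiffOn ℝ ∞ A U)
    (hint : ∀ x ∈ U, ∀ u v Y, fderiv ℝ A x u v Y + A x v (A x u Y)
      = fderiv ℝ A x v u Y + A x u (A x v Y)) {x₀ : E} (hx₀ : x₀ ∈ U) (y₀ : W) :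
    ∃ r > 0, ball x₀ r ⊆ U ∧ ∃ Y : E → W, Y x₀ = y₀ ∧ ContDiffOn ℝ ∞ Y (ball x₀ r) ∧
      ∀ x ∈ ball x₀ r, ∀ v, fderiv ℝ Y x v = A x v (Y x) := by
  have hA0 := hA.contDiffAt (hU.mem_nhds hx₀)
  have hA1 : ContDiffAt ℝ ∞ (fderiv ℝ A) x₀ := hA0.fderiv_right (by simp)
  obtain ⟨K, t, ht, hLip⟩ := (hA1.of_le (m := 1) (by simp)).exists_lipschitzOnWith
  -- one constant bounds the coefficients, their derivative and its Lipschitz constant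
  set M : ℝ := max (max (‖A x₀‖ + 1) (‖fderiv ℝ A x₀‖ + 1)) K with hMdef
  have hM0 : 0 < M := lt_of_lt_of_le (by positivity) ((le_max_left _ _).trans (le_max_left _ _))
  have ev1 := eventually_norm_lt_add_one hA0
  have ev2 := eventually_norm_lt_add_one hA1
  have ev : ∀ᶠ x in 𝓝 x₀, x ∈ U ∧ x ∈ t ∧ ‖A x‖ < ‖A x₀‖ + 1 ∧
      ‖fderiv ℝ A x‖ < ‖fderiv ℝ A x₀‖ + 1 :=
    Filter.Eventually.and (hU.mem_nhds hx₀) (Filter.Eventually.and ht (ev1.and ev2))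
  obtain ⟨ρ, hρ, hball⟩ := Metric.eventually_nhds_iff_ball.1 ev
  let r := min ρ (min 1 (1 / (2 * M)))
  have hr : 0 < r := lt_min hρ (lt_min one_pos (by positivity))
  have hr1 : r ≤ 1 := (min_le_right _ _).trans (min_le_left _ _)
  have hrM : M * r ≤ 1 / 2 := by
    have : r ≤ 1 / (2 * M) := (min_le_right _ _).trans (min_le_right _ _)
    calc M * r ≤ M * (1 / (2 * M)) := mul_le_mul_of_nonneg_left this hM0.le
      _ = 1 / 2 := by field_simp
  have hb : ∀ x ∈ ball x₀ r, x ∈ U ∧ x ∈ t ∧ ‖A x‖ < ‖A x₀‖ + 1 ∧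
      ‖fderiv ℝ A x‖ < ‖fderiv ℝ A x₀‖ + 1 := fun x hx =>
    hball x (ball_subset_ball (min_le_left _ _) hx)
  have hM : ∀ x ∈ ball x₀ r, ‖A x‖ ≤ M := fun x hx =>
    (hb x hx).2.2.1.le.trans ((le_max_left _ _).trans (le_max_left _ _))
  have hM' : ∀ x ∈ ball x₀ r, ‖fderiv ℝ A x‖ ≤ M := fun x hx =>
    (hb x hx).2.2.2.le.trans ((le_max_right _ _).trans (le_max_left _ _))
  have hL : ∀ x ∈ ball x₀ r, ∀ x' ∈ ball x₀ r,
      ‖fderiv ℝ A x' - fderiv ℝ A x‖ ≤ M * ‖x' - x‖ := by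
    intro x hx x' hx'
    have := hLip.dist_le_mul x' (hb x' hx').2.1 x (hb x hx).2.1
    rw [dist_eq_norm, dist_eq_norm] at this
    exact this.trans (mul_le_mul_of_nonneg_right (le_max_right _ _) (norm_nonneg _))
  have hUb : ball x₀ r ⊆ U := fun x hx => (hb x hx).1
  have hAd : ∀ x ∈ ball x₀ r, DifferentiableAt ℝ A x := fun x hx =>
    (hA.contDiffAt (hU.mem_nhds (hUb hx))).differentiableAt (by simp)
  have hray : ∀ ξ : E, ‖ξ‖ < r → ∀ t ∈ Icc (0 : ℝ) 1, x₀ + t • ξ ∈ ball x₀ r := by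
    intro ξ hξ t ht
    rw [mem_ball, dist_eq_norm, add_sub_cancel_left, norm_smul, Real.norm_of_nonneg ht.1]
    exact (mul_le_of_le_one_left (norm_nonneg _) ht.2).trans_lt hξ
  have hex : ∀ ξ : E, ∃ y : ℝ → W, ‖ξ‖ < r → y 0 = y₀ ∧ ∀ t ∈ Icc (0 : ℝ) 1,
      HasDerivWithinAt y (A (x₀ + t • ξ) ξ (y t)) (Icc 0 1) t := by
    intro ξ
    by_cases hξ : ‖ξ‖ < r
    · obtain ⟨y, hy⟩ := exists_solution_along_ray (A := A) (x₀ := x₀) (ξ := ξ) (M := M)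
        (fun t ht => (hAd _ (hray ξ hξ t ht)).continuousAt) (fun t ht => hM _ (hray ξ hξ t ht))
        ((mul_le_mul_of_nonneg_left hξ.le hM0.le).trans hrM) y₀
      exact ⟨y, fun _ => hy⟩
    · exact ⟨fun _ => y₀, fun h => absurd h hξ⟩
  choose y hy using hex
  -- neighbouring rays agree to first order, by the comparison lemma
  have hder : ∀ x ∈ ball x₀ r, HasFDerivAt (fun x => y (x - x₀) 1)
      ((A x).flip (y (x - x₀) 1)) x := by
    intro x hx
    have hξ : ‖x - x₀‖ < r := by rwa [mem_ball, dist_eq_norm] at hx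
    obtain ⟨y0, hy1⟩ := hy _ hξ
    obtain ⟨Y₀, hY₀⟩ := isCompact_Icc.exists_bound_of_continuousOn
      (fun t ht => (hy1 t ht).continuousWithinAt)
    have hY0 : 0 ≤ Y₀ := (norm_nonneg _).trans (hY₀ 0 (by simp))
    rw [hasFDerivAt_iff_isLittleO_nhds_zero]
    refine Asymptotics.IsBigO.trans_isLittleO (g := fun η : E => ‖η‖ ^ 2) ?_
      (Asymptotics.isLittleO_norm_pow_id one_lt_two)
    refine Asymptotics.IsBigO.of_bound (4 * M * (1 + M) * Y₀ / M * (Real.exp M - 1)) ?_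
    have hev : ∀ᶠ η in 𝓝 (0 : E), ‖η‖ < r - ‖x - x₀‖ :=
      continuous_norm.continuousAt.eventually_lt_const (by simpa using hξ)
    filter_upwards [hev] with η hη
    have hξη : ‖x - x₀ + η‖ < r := (norm_add_le _ _).trans_lt (by linarith)
    obtain ⟨z0, hz1⟩ := hy _ hξη
    have := norm_sub_le_of_solutions_along_rays (convex_ball x₀ r) hM0 hY0 (hray _ hξ)
      (hray _ hξη) hAd hM hM' hL (by linarith) (by linarith)
      (by linarith [norm_nonneg (x - x₀)]) (fun x hx => hint x (hUb hx)) (y0.trans z0.symm)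
      hy1 hz1 hY₀
    rw [add_sub_cancel] at this
    rw [norm_pow, norm_norm, ContinuousLinearMap.flip_apply, show x + η - x₀ = x - x₀ + η by abel]
    refine this.trans (le_of_eq ?_)
    ring
  refine ⟨r, hr, hUb, fun x => y (x - x₀) 1, ?_, ?_, fun x hx v => by rw [(hder x hx).fderiv]; rfl⟩
  · obtain ⟨y0, hy1⟩ := hy 0 (by simpa using hr)
    have hc := constant_of_has_deriv_right_zero (f := y 0) (a := 0) (b := 1)
      (fun t ht => (hy1 t ht).continuousWithinAt) (fun t ht => by
        have := hy1 t (Ico_subset_Icc_self ht)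
        simp only [map_zero, zero_apply] at this
        exact (this.mono (Icc_subset_Icc_left ht.1)).mono_of_mem_nhdsWithin
          (Icc_mem_nhdsGE_of_mem ⟨le_rfl, ht.2⟩)) 1 (by simp)
    simp [hc, y0]
  · rw [contDiffOn_infty]
    intro n
    induction n with
    | zero =>
      exact contDiffOn_zero.2 fun x hx => (hder x hx).continuousAt.continuousWithinAt
    | succ n ih =>
      have : ((n + 1 : ℕ) : WithTop ℕ∞) = (n : WithTop ℕ∞) + 1 := by simp
      rw [this, contDiffOn_succ_iff_fderiv_of_isOpen isOpen_ball]
      refine ⟨fun x hx => (hder x hx).differentiableAt.differentiableWithinAt, by simp, ?_⟩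
      have hAn : ContDiffOn ℝ n A (ball x₀ r) := (hA.mono hUb).of_le (by exact_mod_cast le_top)
      have := ((ContinuousLinearMap.flipₗᵢ ℝ E W W).contDiff.comp_contDiffOn hAn).clm_apply ih
      exact this.congr fun x hx => (hder x hx).fderiv

end TotalDifferential

/-! ### Conformal flatness and the tractor connection -/

section WeylSchouten

variable {E : Type*} [NormedAddCommGroup E] [NormedSpace ℝ E]
  {h S : E → E →L[ℝ] E →L[ℝ] ℝ} {Γ : E → E →L[ℝ] E →L[ℝ] E} {Q : E → E →L[ℝ] E} {U : Set E}

theorem IsLeviCivita.mono (L : IsLeviCivita h Γ U) {V : Set E} (hV : IsOpen V) (hVU : V ⊆ U) :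
    IsLeviCivita h Γ V where
  isOpen := hV
  smooth_metric := L.smooth_metric.mono hVU
  smooth_conn := L.smooth_conn.mono hVU
  symm x hx := L.symm x (hVU hx)
  nondeg x hx := L.nondeg x (hVU hx)
  torsion_free x hx := L.torsion_free x (hVU hx)
  compat x hx := L.compat x (hVU hx)

theorem IsSchouten.fderiv_symm (hSch : IsSchouten h S Q Γ U) (L : IsLeviCivita h Γ U) {x : E}
    (hx : x ∈ U) (a b c : E) : fderiv ℝ S x a b c = fderiv ℝ S x a c b := by
  have dS := ((hSch.smooth_form.contDiffAt (L.isOpen.mem_nhds hx)).differentiableAt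
    (by simp)).hasFDerivAt
  have c2 : ∀ p q : E, HasFDerivAt (fun y => S y p q) (((fderiv ℝ S x).flip p).flip q) x := by
    intro p q
    simpa using (dS.clm_apply (hasFDerivAt_const p x)).clm_apply (hasFDerivAt_const q x)
  have := ((c2 b c).congr_of_eventuallyEq (Filter.eventuallyEq_of_mem (L.isOpen.mem_nhds hx)
    fun y hy => hSch.symm y hy c b)).unique (c2 c b)
  simpa using congrArg (fun L => L a) this

section Necessity

variable {f : E → ℝ} {k : E → E}

theorem IsSchouten.confSchouten_eq_of_flat [FiniteDimensional ℝ E] (hdim : 3 ≤ finrank ℝ E)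
    (L : IsLeviCivita h Γ U) (hSch : IsSchouten h S Q Γ U) (hf : ContDiffOn ℝ ∞ f U)
    (hk : ContDiffOn ℝ ∞ k U) (hfk : ∀ x ∈ U, ∀ v, h x (k x) v = fderiv ℝ f x v) {x : E}
    (hx : x ∈ U) (hflat : ∀ u v w, curv (confConn h Γ k) x u v w = 0) :
    confSchouten h Γ k x = Q x := by
  refine hSch.eq_of_kulkarniNomizu hdim L hx (L.confSchouten_symm hf hk hfk hx) fun u v z => ?_
  have := L.curv_confConn hf hk hfk hx u v z
  rw [hflat] at this
  exact (sub_eq_zero.1 this.symm)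

theorem WeylFree.of_flat [FiniteDimensional ℝ E] (hdim : 3 ≤ finrank ℝ E)
    (L : IsLeviCivita h Γ U) (hSch : IsSchouten h S Q Γ U) (hf : ContDiffOn ℝ ∞ f U)
    (hk : ContDiffOn ℝ ∞ k U) (hfk : ∀ x ∈ U, ∀ v, h x (k x) v = fderiv ℝ f x v) {x : E}
    (hx : x ∈ U) (hflat : ∀ u v w, curv (confConn h Γ k) x u v w = 0) : WeylFree h S Q Γ x := by
  intro u v z
  have := L.curv_confConn hf hk hfk hx u v z
  rw [hflat, hSch.confSchouten_eq_of_flat hdim L hf hk hfk hx hflat, hSch.metric_apply x hx,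
    hSch.metric_apply x hx] at this
  exact (sub_eq_zero.1 this.symm)

/-- The identity `∇k = Q + k ⊗ k - ½ |k|²`, which holds when `e^{2f} h` is flat, is
differentiated once more and antisymmetrized. -/
theorem CottonFree.of_flat [FiniteDimensional ℝ E] (hdim : 3 ≤ finrank ℝ E)
    (L : IsLeviCivita h Γ U) (hSch : IsSchouten h S Q Γ U) (hf : ContDiffOn ℝ ∞ f U)
    (hk : ContDiffOn ℝ ∞ k U) (hfk : ∀ x ∈ U, ∀ v, h x (k x) v = fderiv ℝ f x v)
    (hflat : ∀ x ∈ U, ∀ u v w, curv (confConn h Γ k) x u v w = 0) {x : E} (hx : x ∈ U) :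
    CottonFree S Γ x := by
  have hW := WeylFree.of_flat hdim L hSch hf hk hfk hx (hflat x hx)
  have hk' := hk.contDiffAt (L.isOpen.mem_nhds hx)
  have dh := ((L.contDiffAt_metric hx).differentiableAt (by simp)).hasFDerivAt
  have dΓ := ((L.contDiffAt_conn hx).differentiableAt (by simp)).hasFDerivAt
  have dk := (hk'.differentiableAt (by simp)).hasFDerivAt
  have dk1 := ((hk'.fderiv_right (m := ∞) (by simp)).differentiableAt (by simp)).hasFDerivAt
  have dQ := ((hSch.smooth_end.contDiffAt (L.isOpen.mem_nhds hx)).differentiableAt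
    (by simp)).hasFDerivAt
  have sym : ∀ a b, fderiv ℝ (fderiv ℝ k) x a b = fderiv ℝ (fderiv ℝ k) x b a :=
    hk'.isSymmSndFDerivAt minSmoothness_two_le
  have hDk : ∀ y ∈ U, ∀ v, fderiv ℝ k y v
      = Q y v - Γ y v (k y) + h y (k y) v • k y - ((1 / 2) * h y (k y) (k y)) • v := by
    intro y hy v
    have := congrArg (fun T => T v) (hSch.confSchouten_eq_of_flat hdim L hf hk hfk hy (hflat y hy))
    rw [confSchouten_apply] at this
    rw [← this]; abel
  have key : ∀ v u, fderiv ℝ (fderiv ℝ k) x u v = fderiv ℝ Q x u v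
      - (fderiv ℝ Γ x u v (k x) + Γ x v (fderiv ℝ k x u))
      + (h x (k x) v • fderiv ℝ k x u
        + (fderiv ℝ h x u (k x) v + h x (fderiv ℝ k x u) v) • k x)
      - ((1 / 2) * (fderiv ℝ h x u (k x) (k x) + h x (fderiv ℝ k x u) (k x)
        + h x (k x) (fderiv ℝ k x u))) • v := by
    intro v u
    have l := dk1.clm_apply (hasFDerivAt_const v x)
    have r := (((dQ.clm_apply (hasFDerivAt_const v x)).sub
      ((dΓ.clm_apply (hasFDerivAt_const v x)).clm_apply dk)).add
      (((dh.clm_apply dk).clm_apply (hasFDerivAt_const v x)).smul dk)).sub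
      (((((dh.clm_apply dk).clm_apply dk).const_mul (1 / 2 : ℝ))).smul_const v)
    have := (r.congr_of_eventuallyEq (Filter.eventuallyEq_of_mem (L.isOpen.mem_nhds hx)
      fun y hy => hDk y hy v)).unique l
    have := congrArg (fun T => T u) this.symm
    simp only [add_apply, sub_apply,
      ContinuousLinearMap.comp_apply, ContinuousLinearMap.flip_apply, zero_apply,
      map_zero, zero_add, smul_apply, ContinuousLinearMap.smulRight_apply,
      smul_eq_mul] at this
    rw [this]
    module
  intro u v t
  have e := congrArg (fun T => h x T t) ((key v u).symm.trans ((sym u v).trans (key u v)))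
  have w := congrArg (fun T => h x T t) (hW u v (k x))
  simp only [curv, hDk x hx, L.compat x hx, map_add, map_sub, map_smul, add_apply, sub_apply,
    smul_apply, smul_eq_mul, hSch.metric_fderiv_end L hx, hSch.metric_apply x hx] at e w
  simp only [covD]
  rw [L.symm x hx (Γ x u (k x)) (k x), L.symm x hx (Γ x v (k x)) (k x)] at *
  rw [L.torsion_free x hx v u] at *
  have q : ∀ p, h x (k x) (Q x p) = S x p (k x) := fun p => by
    rw [L.symm x hx, hSch.metric_apply x hx]
  rw [q, q, L.symm x hx v u, hSch.symm x hx v u] at e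
  rw [L.symm x hx u (k x), L.symm x hx v (k x)] at e w
  linear_combination e - w

end Necessity

section Sufficiency

variable [FiniteDimensional ℝ E]

/-- The conformal tractor connection: `v ↦ ((σ, m, ρ) ↦ (⟨m, v⟩, -Γ(v, m) - σ Q v - ρ v, S(m, v)))`.
The parallel sections of this linear connection with `2 σ ρ + |m|² = 0` and `σ > 0` are the
conformal factors `σ⁻²` for which `σ⁻² h` is flat. -/
def tractor (h S : E → E →L[ℝ] E →L[ℝ] ℝ) (Γ : E → E →L[ℝ] E →L[ℝ] E) (Q : E → E →L[ℝ] E) (x : E) :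
    E →L[ℝ] (ℝ × E × ℝ) →L[ℝ] ℝ × E × ℝ :=
  LinearMap.toContinuousLinearMap
    { toFun := fun v => LinearMap.toContinuousLinearMap
        { toFun := fun Y => (h x Y.2.1 v, -Γ x v Y.2.1 - Y.1 • Q x v - Y.2.2 • v, S x Y.2.1 v)
          map_add' := fun Y Z => by
            refine Prod.ext ?_ (Prod.ext ?_ ?_) <;> simp [add_smul]
            abel
          map_smul' := fun c Y => by
            refine Prod.ext ?_ (Prod.ext ?_ ?_) <;> simp [mul_smul, smul_sub] }
      map_add' := fun v w => by
        refine ContinuousLinearMap.ext fun Y => Prod.ext ?_ (Prod.ext ?_ ?_) <;> simp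
        abel
      map_smul' := fun c v => by
        refine ContinuousLinearMap.ext fun Y => Prod.ext ?_ (Prod.ext ?_ ?_) <;> simp
        module }

theorem tractor_apply (x v : E) (Y : ℝ × E × ℝ) : tractor h S Γ Q x v Y
    = (h x Y.2.1 v, -Γ x v Y.2.1 - Y.1 • Q x v - Y.2.2 • v, S x Y.2.1 v) := rfl

theorem contDiffOn_tractor (L : IsLeviCivita h Γ U) (hSch : IsSchouten h S Q Γ U) :
    ContDiffOn ℝ ∞ (tractor h S Γ Q) U := by
  rw [contDiffOn_clm_apply]
  intro v
  rw [contDiffOn_clm_apply]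
  intro Y
  simp only [tractor_apply]
  exact ((L.smooth_metric.clm_apply contDiffOn_const).clm_apply contDiffOn_const).prodMk
    ((((((L.smooth_conn.clm_apply contDiffOn_const).clm_apply contDiffOn_const).neg).sub
      (contDiffOn_const.smul (hSch.smooth_end.clm_apply contDiffOn_const))).sub
        contDiffOn_const).prodMk
    ((hSch.smooth_form.clm_apply contDiffOn_const).clm_apply contDiffOn_const))

/-- The tractor connection of a metric with vanishing Weyl and Cotton tensors is flat. -/
theorem tractor_integrable (L : IsLeviCivita h Γ U) (hSch : IsSchouten h S Q Γ U) {x : E}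
    (hx : x ∈ U) (hW : WeylFree h S Q Γ x) (hC : CottonFree S Γ x) (u v : E) (Y : ℝ × E × ℝ) :
    fderiv ℝ (tractor h S Γ Q) x u v Y + tractor h S Γ Q x v (tractor h S Γ Q x u Y)
      = fderiv ℝ (tractor h S Γ Q) x v u Y + tractor h S Γ Q x u (tractor h S Γ Q x v Y) := by
  have dh := ((L.contDiffAt_metric hx).differentiableAt (by simp)).hasFDerivAt
  have dΓ := ((L.contDiffAt_conn hx).differentiableAt (by simp)).hasFDerivAt
  have dS := ((hSch.smooth_form.contDiffAt (L.isOpen.mem_nhds hx)).differentiableAt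
    (by simp)).hasFDerivAt
  have dQ := ((hSch.smooth_end.contDiffAt (L.isOpen.mem_nhds hx)).differentiableAt
    (by simp)).hasFDerivAt
  have dT := (((contDiffOn_tractor L hSch).contDiffAt (L.isOpen.mem_nhds hx)).differentiableAt
    (by simp)).hasFDerivAt
  obtain ⟨σ, m, ρ⟩ := Y
  have key : ∀ u v, fderiv ℝ (tractor h S Γ Q) x u v (σ, m, ρ)
      = (fderiv ℝ h x u m v, -fderiv ℝ Γ x u v m - σ • fderiv ℝ Q x u v, fderiv ℝ S x u m v) := by
    intro u v
    have l := (dT.clm_apply (hasFDerivAt_const v x)).clm_apply (hasFDerivAt_const (σ, m, ρ) x)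
    have c : ∀ {B : E → E →L[ℝ] E →L[ℝ] ℝ} (_ : HasFDerivAt B (fderiv ℝ B x) x) (p q : E),
        HasFDerivAt (fun y => B y p q) (((fderiv ℝ B x).flip p).flip q) x := by
      intro B dB p q
      simpa using (dB.clm_apply (hasFDerivAt_const p x)).clm_apply (hasFDerivAt_const q x)
    have c1 : HasFDerivAt (fun y => Q y v) ((fderiv ℝ Q x).flip v) x := by
      simpa using dQ.clm_apply (hasFDerivAt_const v x)
    have cΓ : HasFDerivAt (fun y => Γ y v m) (((fderiv ℝ Γ x).flip v).flip m) x := by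
      simpa using (dΓ.clm_apply (hasFDerivAt_const v x)).clm_apply (hasFDerivAt_const m x)
    have r := (c dh m v).prodMk (((cΓ.neg.sub (c1.const_smul σ)).sub
      (hasFDerivAt_const (ρ • v) x)).prodMk (c dS m v))
    have := congrArg (fun T => T u) (l.unique r)
    simpa using this
  have hw := hW u v m
  have hcQ : fderiv ℝ Q x u v - fderiv ℝ Q x v u + Γ x u (Q x v) - Γ x v (Q x u) = 0 := by
    refine L.nondeg x hx _ fun t => ?_
    have := hC u v t
    simp only [covD] at this
    rw [L.torsion_free x hx v u] at this
    simp only [map_sub, map_add, add_apply, sub_apply, hSch.metric_fderiv_end L hx]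
    linear_combination this
  rw [key, key]
  simp only [tractor_apply]
  refine Prod.ext ?_ (Prod.ext ?_ ?_)
  · simp [L.compat x hx, hSch.metric_apply x hx]
    rw [L.torsion_free x hx v u, hSch.symm x hx v u, L.symm x hx v u]
    ring
  · simp only [curv] at hw
    simp only [Prod.fst_add, Prod.snd_add, map_sub, map_neg, map_smul]
    rw [hSch.symm x hx m v, hSch.symm x hx m u, L.symm x hx m v, L.symm x hx m u]
    rw [L.torsion_free x hx v u]
    linear_combination (norm := module) hw - σ • hcQ
  · have := hC u v m
    simp only [covD] at this
    rw [L.torsion_free x hx v u] at this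
    have q : S x (Q x u) v = S x (Q x v) u := by
      rw [hSch.symm x hx, ← hSch.metric_apply x hx, L.symm x hx, hSch.metric_apply x hx,
        hSch.symm x hx]
    rw [hSch.fderiv_symm L hx u v, hSch.fderiv_symm L hx v u] at this
    simp only [Prod.snd_add, map_sub, map_neg, map_smul, sub_apply, neg_apply, smul_apply,
      smul_eq_mul]
    rw [q, hSch.symm x hx (Γ x u m), hSch.symm x hx (Γ x v m), hSch.symm x hx v u]
    linear_combination this

open Metric in
/-- A metric with vanishing Weyl and Cotton tensors is locally conformally flat. -/
theorem exists_flat_conformal (L : IsLeviCivita h Γ U) (hSch : IsSchouten h S Q Γ U)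
    (hW : ∀ x ∈ U, WeylFree h S Q Γ x) (hC : ∀ x ∈ U, CottonFree S Γ x) {x₀ : E} (hx₀ : x₀ ∈ U) :
    ∃ r > 0, ball x₀ r ⊆ U ∧ ∃ (f : E → ℝ) (k : E → E), ContDiffOn ℝ ∞ f (ball x₀ r) ∧
      ContDiffOn ℝ ∞ k (ball x₀ r) ∧ (∀ x ∈ ball x₀ r, ∀ v, h x (k x) v = fderiv ℝ f x v) ∧
      ∀ x ∈ ball x₀ r, ∀ u v w, curv (confConn h Γ k) x u v w = 0 := by
  obtain ⟨r₁, hr₁, hU₁, Y, hY0, hYs, hYd⟩ := exists_solution_totalDifferential L.isOpen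
    (contDiffOn_tractor L hSch)
    (fun x hx u v Y => tractor_integrable L hSch hx (hW x hx) (hC x hx) u v Y) hx₀ (1, 0, 0)
  -- `Y` extends the null vector `(1, 0, 0)`, and the conformal factor is `e^{2f} = σ⁻²`
  let σ : E → ℝ := fun x => (Y x).1
  let m : E → E := fun x => (Y x).2.1
  let ρ : E → ℝ := fun x => (Y x).2.2
  have hσs : ContDiffOn ℝ ∞ σ (ball x₀ r₁) := contDiff_fst.comp_contDiffOn hYs
  have hms : ContDiffOn ℝ ∞ m (ball x₀ r₁) :=
    contDiff_fst.comp_contDiffOn (contDiff_snd.comp_contDiffOn hYs)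
  have hYD : ∀ x ∈ ball x₀ r₁, HasFDerivAt Y (fderiv ℝ Y x) x := fun x hx =>
    ((hYs.contDiffAt (isOpen_ball.mem_nhds hx)).differentiableAt (by simp)).hasFDerivAt
  have hσD : ∀ x ∈ ball x₀ r₁, HasFDerivAt σ ((h x) (m x)) x := fun x hx =>
    (hYD x hx).fst.congr_fderiv (by ext v; simp [hYd x hx, tractor_apply, m])
  have hmD : ∀ x ∈ ball x₀ r₁, HasFDerivAt m (-(Γ x).flip (m x) - σ x • Q x
      - ρ x • ContinuousLinearMap.id ℝ E) x := fun x hx =>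
    (hYD x hx).snd.fst.congr_fderiv (by ext v; simp [hYd x hx, tractor_apply, m, σ, ρ])
  have hρD : ∀ x ∈ ball x₀ r₁, HasFDerivAt ρ ((S x) (m x)) x := fun x hx =>
    (hYD x hx).snd.snd.congr_fderiv (by ext v; simp [hYd x hx, tractor_apply, m])
  -- the squared tractor norm is parallel, and it vanishes at the centre
  have hnull : ∀ x ∈ ball x₀ r₁, 2 * (σ x * ρ x) + h x (m x) (m x) = 0 := by
    have hd : ∀ x ∈ ball x₀ r₁,
        HasFDerivAt (fun x => 2 * (σ x * ρ x) + h x (m x) (m x)) (0 : E →L[ℝ] ℝ) x := by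
      intro x hx
      have hxU := hU₁ hx
      have dh := ((L.contDiffAt_metric hxU).differentiableAt (by simp)).hasFDerivAt
      refine ((((hσD x hx).mul (hρD x hx)).const_mul 2).add
        ((dh.clm_apply (hmD x hx)).clm_apply (hmD x hx))).congr_fderiv ?_
      ext v
      have q : h x (m x) (Q x v) = S x (m x) v := by
        rw [L.symm x hxU, hSch.metric_apply x hxU, hSch.symm x hxU]
      simp [L.compat x hxU, hSch.metric_apply x hxU]
      rw [q, hSch.symm x hxU v, L.symm x hxU v]
      ring
    intro x hx
    have hc : (fun x => 2 * (σ x * ρ x) + h x (m x) (m x)) x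
        = (fun x => 2 * (σ x * ρ x) + h x (m x) (m x)) x₀ :=
      (isOpen_ball).is_const_of_fderiv_eq_zero (𝕜 := ℝ) (convex_ball x₀ r₁).isPreconnected
        (fun x hx => (hd x hx).differentiableAt.differentiableWithinAt)
        (fun x hx => (hd x hx).fderiv) hx (mem_ball_self hr₁)
    simpa [σ, ρ, m, hY0] using hc
  have hpos : ∀ᶠ x in 𝓝 x₀, 0 < σ x := by
    have : ContinuousAt σ x₀ := (hσD x₀ (mem_ball_self hr₁)).continuousAt
    refine this.eventually_const_lt ?_
    simp [σ, hY0]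
  obtain ⟨r₂, hr₂, hb₂⟩ := Metric.eventually_nhds_iff_ball.1 hpos
  have hsub : ball x₀ (min r₁ r₂) ⊆ ball x₀ r₁ := ball_subset_ball (min_le_left _ _)
  have hσ : ∀ x ∈ ball x₀ (min r₁ r₂), σ x ≠ 0 := fun x hx =>
    (hb₂ x (ball_subset_ball (min_le_right _ _) hx)).ne'
  have hfs : ContDiffOn ℝ ∞ (fun x => -Real.log (σ x)) (ball x₀ (min r₁ r₂)) :=
    ((hσs.mono hsub).log hσ).neg
  have hks : ContDiffOn ℝ ∞ (fun x => (-(σ x)⁻¹) • m x) (ball x₀ (min r₁ r₂)) :=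
    (((hσs.mono hsub).inv hσ).neg).smul (hms.mono hsub)
  have hfk : ∀ x ∈ ball x₀ (min r₁ r₂), ∀ v, h x ((-(σ x)⁻¹) • m x) v
      = fderiv ℝ (fun x => -Real.log (σ x)) x v := by
    intro x hx v
    have d : HasFDerivAt (fun x => -Real.log (σ x)) (-((σ x)⁻¹ • h x (m x))) x :=
      ((hσD x (hsub hx)).log (hσ x hx)).neg
    rw [d.fderiv]
    simp
  refine ⟨min r₁ r₂, lt_min hr₁ hr₂, hsub.trans hU₁, _, _, hfs, hks, hfk, fun x hx u v w => ?_⟩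
  have L' := L.mono isOpen_ball (hsub.trans hU₁)
  have hxU := hU₁ (hsub hx)
  have hσx := hσ x hx
  have hkQ : confSchouten h Γ (fun x => (-(σ x)⁻¹) • m x) x = Q x := by
    ext v
    have dσ := hσD x (hsub hx)
    have dinv : HasFDerivAt (fun x => (σ x)⁻¹) (-(σ x ^ 2)⁻¹ • h x (m x)) x := by
      have := (hasDerivAt_inv hσx).comp_hasFDerivAt x dσ
      exact this
    have n := hnull x (hsub hx)
    have d : HasFDerivAt (fun x => (-(σ x)⁻¹) • m x) _ x := dinv.neg.smul (hmD x (hsub hx))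
    rw [confSchouten_apply, d.fderiv]
    have e : (1 / 2 : ℝ) * h x (-(σ x)⁻¹ • m x) (-(σ x)⁻¹ • m x) = -((σ x)⁻¹ * ρ x) := by
      simp
      field_simp
      linear_combination n
    rw [e]
    simp
    have h1 : (σ x)⁻¹ * σ x = 1 := inv_mul_cancel₀ hσx
    linear_combination (norm := module) h1 • Q x v
  rw [L'.curv_confConn hfs hks hfk hx, hkQ, hW x hxU u v w, hSch.metric_apply x hxU,
    hSch.metric_apply x hxU, sub_self]

end Sufficiency
end WeylSchouten

/-! ### Components of tensors on `ℝᵐ` -/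

section Components

variable {m : ℕ}

/-- The standard basis vector `∂_a`. -/
abbrev stdVec (a : Fin m) : EuclideanSpace ℝ (Fin m) := EuclideanSpace.single a 1

/-- The bilinear form with components `B a b`. -/
def bilCLM (B : Matrix (Fin m) (Fin m) ℝ) :
    EuclideanSpace ℝ (Fin m) →L[ℝ] EuclideanSpace ℝ (Fin m) →L[ℝ] ℝ :=
  ∑ a, ∑ b, B a b • (EuclideanSpace.proj a : EuclideanSpace ℝ (Fin m) →L[ℝ] ℝ).smulRight
    (EuclideanSpace.proj b : EuclideanSpace ℝ (Fin m) →L[ℝ] ℝ)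

/-- The vector-valued bilinear map with components `Γ c a b`, the upper index first. -/
def connCLM (Γ : Fin m → Fin m → Fin m → ℝ) :
    EuclideanSpace ℝ (Fin m) →L[ℝ] EuclideanSpace ℝ (Fin m) →L[ℝ] EuclideanSpace ℝ (Fin m) :=
  ∑ c, ∑ a, ∑ b, Γ c a b • (EuclideanSpace.proj a : EuclideanSpace ℝ (Fin m) →L[ℝ] ℝ).smulRight
    ((EuclideanSpace.proj b : EuclideanSpace ℝ (Fin m) →L[ℝ] ℝ).smulRight (stdVec c))

/-- The endomorphism with matrix `A`. -/
def endCLM (A : Matrix (Fin m) (Fin m) ℝ) :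
    EuclideanSpace ℝ (Fin m) →L[ℝ] EuclideanSpace ℝ (Fin m) :=
  ∑ c, ∑ a, A c a • (EuclideanSpace.proj a : EuclideanSpace ℝ (Fin m) →L[ℝ] ℝ).smulRight (stdVec c)

theorem bilCLM_apply (B : Matrix (Fin m) (Fin m) ℝ) (u v : EuclideanSpace ℝ (Fin m)) :
    bilCLM B u v = ∑ a, ∑ b, B a b * (u a * v b) := by
  simp [bilCLM]

theorem connCLM_apply (Γ : Fin m → Fin m → Fin m → ℝ) (u v : EuclideanSpace ℝ (Fin m))
    (c : Fin m) : connCLM Γ u v c = ∑ a, ∑ b, Γ c a b * (u a * v b) := by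
  simp [connCLM, Pi.single_apply]

theorem endCLM_apply (A : Matrix (Fin m) (Fin m) ℝ) (u : EuclideanSpace ℝ (Fin m))
    (c : Fin m) : endCLM A u c = ∑ a, A c a * u a := by
  simp [endCLM, Pi.single_apply]

@[simp] theorem bilCLM_stdVec (B : Matrix (Fin m) (Fin m) ℝ) (a b : Fin m) :
    bilCLM B (stdVec a) (stdVec b) = B a b := by
  simp [bilCLM_apply]

@[simp] theorem connCLM_stdVec (Γ : Fin m → Fin m → Fin m → ℝ) (a b c : Fin m) :
    connCLM Γ (stdVec a) (stdVec b) c = Γ c a b := by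
  simp [connCLM_apply]

theorem connCLM_stdVec_left (Γ : Fin m → Fin m → Fin m → ℝ) (a c : Fin m)
    (v : EuclideanSpace ℝ (Fin m)) : connCLM Γ (stdVec a) v c = ∑ b, Γ c a b * v b := by
  simp [connCLM_apply]

@[simp] theorem endCLM_stdVec (A : Matrix (Fin m) (Fin m) ℝ) (a c : Fin m) :
    endCLM A (stdVec a) c = A c a := by
  simp [endCLM_apply]

theorem bilCLM_stdVec_left (B : Matrix (Fin m) (Fin m) ℝ) (a : Fin m)
    (v : EuclideanSpace ℝ (Fin m)) : bilCLM B (stdVec a) v = ∑ b, B a b * v b := by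
  simp [bilCLM_apply]

theorem bilCLM_stdVec_right (B : Matrix (Fin m) (Fin m) ℝ) (b : Fin m)
    (v : EuclideanSpace ℝ (Fin m)) : bilCLM B v (stdVec b) = ∑ a, B a b * v a := by
  simp [bilCLM_apply]

/-- The standard basis of `ℝᵐ`. -/
def stdBasis (m : ℕ) : Basis (Fin m) ℝ (EuclideanSpace ℝ (Fin m)) :=
  (EuclideanSpace.basisFun (Fin m) ℝ).toBasis

@[simp] theorem stdBasis_apply (a : Fin m) : stdBasis m a = stdVec a := by
  simp [stdBasis]

theorem trace_eq_sum (f : EuclideanSpace ℝ (Fin m) →ₗ[ℝ] EuclideanSpace ℝ (Fin m)) :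
    LinearMap.trace ℝ _ f = ∑ d, f (stdVec d) d := by
  rw [LinearMap.trace_eq_matrix_trace ℝ (stdBasis m), Matrix.trace]
  refine Finset.sum_congr rfl fun d _ => ?_
  rw [Matrix.diag_apply, LinearMap.toMatrix_apply]
  simp [stdBasis]

theorem eq_sum_stdVec (u : EuclideanSpace ℝ (Fin m)) : u = ∑ a, u a • stdVec a := by
  ext b
  simp [Pi.single_apply]

theorem clm_ext {F : Type*} [NormedAddCommGroup F] [NormedSpace ℝ F]
    {f g : EuclideanSpace ℝ (Fin m) →L[ℝ] F} (h : ∀ a, f (stdVec a) = g (stdVec a)) : f = g := by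
  ext u
  rw [eq_sum_stdVec u, map_sum, map_sum]
  simp [h]

section Smooth

variable {X : Type*} [NormedAddCommGroup X] [NormedSpace ℝ X] {U : Set X}

theorem contDiffOn_bilCLM {B : X → Matrix (Fin m) (Fin m) ℝ}
    (hB : ∀ a b, ContDiffOn ℝ ∞ (fun x => B x a b) U) :
    ContDiffOn ℝ ∞ (fun x => bilCLM (B x)) U :=
  ContDiffOn.sum fun a _ => ContDiffOn.sum fun b _ => (hB a b).smul contDiffOn_const

theorem contDiffOn_connCLM {Γ : X → Fin m → Fin m → Fin m → ℝ}
    (hΓ : ∀ c a b, ContDiffOn ℝ ∞ (fun x => Γ x c a b) U) :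
    ContDiffOn ℝ ∞ (fun x => connCLM (Γ x)) U :=
  ContDiffOn.sum fun c _ => ContDiffOn.sum fun a _ => ContDiffOn.sum fun b _ =>
    (hΓ c a b).smul contDiffOn_const

theorem contDiffOn_endCLM {A : X → Matrix (Fin m) (Fin m) ℝ}
    (hA : ∀ c a, ContDiffOn ℝ ∞ (fun x => A x c a) U) :
    ContDiffOn ℝ ∞ (fun x => endCLM (A x)) U :=
  ContDiffOn.sum fun c _ => ContDiffOn.sum fun a _ => (hA c a).smul contDiffOn_const

theorem contDiffOn_det {A : X → Matrix (Fin m) (Fin m) ℝ}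
    (hA : ∀ c a, ContDiffOn ℝ ∞ (fun x => A x c a) U) : ContDiffOn ℝ ∞ (fun x => (A x).det) U := by
  simp only [Matrix.det_apply]
  exact ContDiffOn.sum fun σ _ => (contDiffOn_prod fun i _ => hA _ _).const_smul _

theorem contDiffOn_matrix_inv {A : X → Matrix (Fin m) (Fin m) ℝ}
    (hA : ∀ c a, ContDiffOn ℝ ∞ (fun x => A x c a) U) (hd : ∀ x ∈ U, (A x).det ≠ 0) (c a : Fin m) :
    ContDiffOn ℝ ∞ (fun x => (A x)⁻¹ c a) U := by
  have e : (fun x => (A x)⁻¹ c a) = fun x => ((A x).det)⁻¹ * (A x).adjugate c a := by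
    ext x; rw [Matrix.inv_def, Matrix.smul_apply, Ring.inverse_eq_inv', smul_eq_mul]
  rw [e]
  refine ((contDiffOn_det hA).inv hd).mul ?_
  simp only [Matrix.adjugate_apply]
  refine contDiffOn_det fun i j => ?_
  by_cases h : i = a
  · subst h; simpa using contDiffOn_const
  · simpa [Matrix.updateRow_apply, h] using hA i j

end Smooth

variable {U : Set (EuclideanSpace ℝ (Fin m))}

theorem contDiffOn_pd (hU : IsOpen U) {f : EuclideanSpace ℝ (Fin m) → ℝ} (hf : ContDiffOn ℝ ∞ f U)
    (a : Fin m) : ContDiffOn ℝ ∞ (pd a f) U :=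
  (hf.fderiv_of_isOpen hU (by simp)).clm_apply contDiffOn_const

theorem contDiffOn_christoffel (hU : IsOpen U)
    {G : EuclideanSpace ℝ (Fin m) → Matrix (Fin m) (Fin m) ℝ}
    (hG : ∀ a b, ContDiffOn ℝ ∞ (fun x => G x a b) U) (hd : ∀ x ∈ U, (G x).det ≠ 0)
    (c a b : Fin m) : ContDiffOn ℝ ∞ (fun x => christoffel G x c a b) U :=
  contDiffOn_const.mul (ContDiffOn.sum fun d _ => (contDiffOn_matrix_inv hG hd c d).mul
    (((contDiffOn_pd hU (hG d b) a).add (contDiffOn_pd hU (hG d a) b)).sub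
      (contDiffOn_pd hU (hG a b) d)))

theorem contDiffOn_curvature (hU : IsOpen U)
    {Γ : EuclideanSpace ℝ (Fin m) → Fin m → Fin m → Fin m → ℝ}
    (hΓ : ∀ c a b, ContDiffOn ℝ ∞ (fun x => Γ x c a b) U) (a b c d : Fin m) :
    ContDiffOn ℝ ∞ (fun x => curvature Γ x a b c d) U :=
  ((contDiffOn_pd hU (hΓ d a c) b).sub (contDiffOn_pd hU (hΓ d b c) a)).add
    (ContDiffOn.sum fun e _ => ((hΓ d b e).mul (hΓ e a c)).sub ((hΓ d a e).mul (hΓ e b c)))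

theorem curvature_eq_curv (hU : IsOpen U)
    {Γ : EuclideanSpace ℝ (Fin m) → Fin m → Fin m → Fin m → ℝ}
    (hΓ : ∀ c a b, ContDiffOn ℝ ∞ (fun x => Γ x c a b) U) {x : EuclideanSpace ℝ (Fin m)}
    (hx : x ∈ U) (a b c d : Fin m) : curvature Γ x a b c d
      = curv (fun y => connCLM (Γ y)) x (stdVec a) (stdVec b) (stdVec c) d := by
  have dΓ := (((contDiffOn_connCLM hΓ).contDiffAt (hU.mem_nhds hx)).differentiableAt
    (by simp)).hasFDerivAt
  have key : ∀ (a b c d : Fin m), pd b (fun y => Γ y d a c) x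
      = fderiv ℝ (fun y => connCLM (Γ y)) x (stdVec b) (stdVec a) (stdVec c) d := by
    intro a b c d
    have l := (EuclideanSpace.proj (𝕜 := ℝ) d).hasFDerivAt.comp x
      ((dΓ.clm_apply (hasFDerivAt_const (stdVec a) x)).clm_apply (hasFDerivAt_const (stdVec c) x))
    have e : (fun y => Γ y d a c) = (EuclideanSpace.proj (𝕜 := ℝ) d : _ →L[ℝ] ℝ) ∘
      (fun y => connCLM (Γ y) (stdVec a) (stdVec c)) := by
      ext y; simp
    rw [pd, e, l.fderiv]
    simp
  rw [curvature, curv, key, key, Finset.sum_sub_distrib]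
  simp only [PiLp.add_apply, PiLp.sub_apply, connCLM_stdVec_left]
  simp
  ring

theorem covDeriv_eq_covD (hU : IsOpen U)
    {Γ : EuclideanSpace ℝ (Fin m) → Fin m → Fin m → Fin m → ℝ}
    {S : EuclideanSpace ℝ (Fin m) → Fin m → Fin m → ℝ}
    (hS : ∀ a b, ContDiffOn ℝ ∞ (fun x => S x a b) U) {x : EuclideanSpace ℝ (Fin m)}
    (hx : x ∈ U) (c a b : Fin m) : covDeriv Γ S x c a b
      = covD (fun y => connCLM (Γ y)) (fun y => bilCLM (Matrix.of (S y))) x (stdVec c) (stdVec a)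
        (stdVec b) := by
  have dS := (((contDiffOn_bilCLM (B := fun y => Matrix.of (S y)) hS).contDiffAt
    (hU.mem_nhds hx)).differentiableAt (by simp)).hasFDerivAt
  have l := ((dS.clm_apply (hasFDerivAt_const (stdVec a) x)).clm_apply
    (hasFDerivAt_const (stdVec b) x))
  have e : (fun y => S y a b) = (fun y => bilCLM (Matrix.of (S y)) (stdVec a) (stdVec b)) := by
    ext y; simp
  rw [covDeriv, covD, pd, e, l.fderiv, bilCLM_stdVec_right, bilCLM_stdVec_left,
    Finset.sum_add_distrib]
  simp only [connCLM_stdVec]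
  simp
  simp only [mul_comm, sub_sub]

/-- The Christoffel symbols are the components of the Levi-Civita connection. -/
theorem isLeviCivita_christoffel (hU : IsOpen U)
    {G : EuclideanSpace ℝ (Fin m) → Matrix (Fin m) (Fin m) ℝ}
    (hG : ∀ a b, ContDiffOn ℝ ∞ (fun x => G x a b) U) (hd : ∀ x ∈ U, (G x).det ≠ 0)
    (hs : ∀ x ∈ U, ∀ a b, G x a b = G x b a) :
    IsLeviCivita (fun x => bilCLM (G x)) (fun x => connCLM (christoffel G x)) U where
  isOpen := hU
  smooth_metric := contDiffOn_bilCLM hG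
  smooth_conn := contDiffOn_connCLM (contDiffOn_christoffel hU hG hd)
  symm x hx u v := by
    rw [bilCLM_apply, bilCLM_apply, Finset.sum_comm]
    refine Finset.sum_congr rfl fun a _ => Finset.sum_congr rfl fun b _ => ?_
    rw [hs x hx b a]; ring
  nondeg x hx u hu := by
    have h0 : Matrix.vecMul (fun a => u a) (G x) = 0 := by
      ext b
      have := hu (stdVec b)
      rw [bilCLM_stdVec_right] at this
      simp only [Matrix.vecMul, dotProduct, Pi.zero_apply]
      rw [← this]
      exact Finset.sum_congr rfl fun a _ => mul_comm _ _
    have := Matrix.eq_zero_of_vecMul_eq_zero (hd x hx) h0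
    ext a
    exact congrFun this a
  torsion_free x hx u v := by
    have hsym : ∀ c a b, christoffel G x c a b = christoffel G x c b a := by
      intro c a b
      have : ∀ d, pd d (fun y => G y a b) x = pd d (fun y => G y b a) x := fun d => by
        rw [pd, pd, Filter.EventuallyEq.fderiv_eq (Filter.eventuallyEq_of_mem (hU.mem_nhds hx)
          fun y hy => hs y hy a b)]
      simp only [christoffel, this]
      congr 1
      exact Finset.sum_congr rfl fun d _ => by ring
    ext c
    rw [connCLM_apply, connCLM_apply, Finset.sum_comm]
    refine Finset.sum_congr rfl fun a _ => Finset.sum_congr rfl fun b _ => ?_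
    rw [hsym]; ring
  compat x hx u v w := by
    have dG := (((contDiffOn_bilCLM hG).contDiffAt (hU.mem_nhds hx)).differentiableAt
      (by simp)).hasFDerivAt
    have hpd : ∀ a b c, fderiv ℝ (fun x => bilCLM (G x)) x (stdVec a) (stdVec b) (stdVec c)
        = pd a (fun y => G y b c) x := by
      intro a b c
      have l := ((dG.clm_apply (hasFDerivAt_const (stdVec b) x)).clm_apply
        (hasFDerivAt_const (stdVec c) x))
      have e : (fun y => G y b c) = (fun y => bilCLM (G y) (stdVec b) (stdVec c)) := by
        ext y; simp
      rw [pd, e, l.fderiv]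
      simp
    have psym : ∀ d a b, pd d (fun y => G y a b) x = pd d (fun y => G y b a) x := fun d a b => by
      rw [pd, pd, Filter.EventuallyEq.fderiv_eq (Filter.eventuallyEq_of_mem (hU.mem_nhds hx)
        fun y hy => hs y hy a b)]
    have low : ∀ a b c, ∑ d, G x d c * christoffel G x d a b = (1 / 2) *
        (pd a (fun y => G y c b) x + pd b (fun y => G y c a) x - pd c (fun y => G y a b) x) := by
      intro a b c
      have hinv : G x * (G x)⁻¹ = 1 := Matrix.mul_nonsing_inv _ (isUnit_iff_ne_zero.2 (hd x hx))
      let T : Fin m → ℝ := fun e =>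
        pd a (fun y => G y e b) x + pd b (fun y => G y e a) x - pd e (fun y => G y a b) x
      have : ∑ d, G x d c * christoffel G x d a b
          = (1 / 2) * ∑ e, (∑ d, G x c d * (G x)⁻¹ d e) * T e := by
        simp only [christoffel, Finset.mul_sum, Finset.sum_mul]
        rw [Finset.sum_comm]
        refine Finset.sum_congr rfl fun e _ => Finset.sum_congr rfl fun d _ => ?_
        rw [hs x hx d c]
        ring
      rw [this]
      have h1 : ∀ e, (∑ d, G x c d * (G x)⁻¹ d e) = if c = e then 1 else 0 := fun e => by
        rw [← Matrix.mul_apply, hinv, Matrix.one_apply]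
      simp only [h1, ite_mul, one_mul, zero_mul, Finset.sum_ite_eq, Finset.mem_univ, if_true]
      rfl
    have hb : ∀ a b c, fderiv ℝ (fun x => bilCLM (G x)) x (stdVec a) (stdVec b) (stdVec c)
        = bilCLM (G x) (connCLM (christoffel G x) (stdVec a) (stdVec b)) (stdVec c)
          + bilCLM (G x) (stdVec b) (connCLM (christoffel G x) (stdVec a) (stdVec c)) := by
      intro a b c
      rw [hpd, bilCLM_stdVec_right, bilCLM_stdVec_left]
      simp only [connCLM_stdVec]
      have e : ∑ d, G x b d * christoffel G x d a c = ∑ d, G x d b * christoffel G x d a c :=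
        Finset.sum_congr rfl fun d _ => by rw [hs x hx b d]
      rw [e, low, low, psym a c b, psym c b a, psym b c a]
      ring
    have := trilinear_eq_zero (stdBasis m) (f := fun u v w =>
      fderiv ℝ (fun x => bilCLM (G x)) x u v w - (bilCLM (G x) (connCLM (christoffel G x) u v) w
        + bilCLM (G x) v (connCLM (christoffel G x) u w)))
      (fun v w => ⟨fun _ _ => by simp; ring, fun _ _ => by simp; ring⟩)
      (fun v w => ⟨fun _ _ => by simp; ring, fun _ _ => by simp; ring⟩)
      (fun v w => ⟨fun _ _ => by simp; ring, fun _ _ => by simp; ring⟩)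
      (fun a b c => by simp only [stdBasis_apply, hb]; ring) u v w
    linarith

end Components

/-! ### The Weyl–Schouten theorem in coordinates -/

section ComponentSchouten

variable {m : ℕ}

/-- The matrices `H x` are the components of a smooth metric on the open set `U ⊆ ℝᵐ`. -/
structure IsMetricOn (H : EuclideanSpace ℝ (Fin m) → Matrix (Fin m) (Fin m) ℝ)
    (U : Set (EuclideanSpace ℝ (Fin m))) : Prop where
  isOpen : IsOpen U
  smooth : ∀ a b, ContDiffOn ℝ ∞ (fun x => H x a b) U
  det_ne_zero : ∀ x ∈ U, (H x).det ≠ 0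
  symm : ∀ x ∈ U, ∀ a b, H x a b = H x b a

variable {H : EuclideanSpace ℝ (Fin m) → Matrix (Fin m) (Fin m) ℝ}
  {U : Set (EuclideanSpace ℝ (Fin m))}

namespace IsMetricOn

theorem isLeviCivita (hH : IsMetricOn H U) :
    IsLeviCivita (fun x => bilCLM (H x)) (fun x => connCLM (christoffel H x)) U :=
  isLeviCivita_christoffel hH.isOpen hH.smooth hH.det_ne_zero hH.symm

theorem mono (hH : IsMetricOn H U) {V : Set (EuclideanSpace ℝ (Fin m))} (hV : IsOpen V)
    (hVU : V ⊆ U) : IsMetricOn H V where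
  isOpen := hV
  smooth a b := (hH.smooth a b).mono hVU
  det_ne_zero x hx := hH.det_ne_zero x (hVU hx)
  symm x hx := hH.symm x (hVU hx)

theorem mul_inv (hH : IsMetricOn H U) {x : EuclideanSpace ℝ (Fin m)} (hx : x ∈ U) :
    H x * (H x)⁻¹ = 1 := Matrix.mul_nonsing_inv _ (isUnit_iff_ne_zero.2 (hH.det_ne_zero x hx))

theorem inv_mul (hH : IsMetricOn H U) {x : EuclideanSpace ℝ (Fin m)} (hx : x ∈ U) :
    (H x)⁻¹ * H x = 1 := Matrix.nonsing_inv_mul _ (isUnit_iff_ne_zero.2 (hH.det_ne_zero x hx))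

theorem transpose_eq (hH : IsMetricOn H U) {x : EuclideanSpace ℝ (Fin m)} (hx : x ∈ U) :
    (H x).transpose = H x := by
  ext a b; exact hH.symm x hx b a

end IsMetricOn

/-- The Ricci tensor of the metric with components `H`. -/
def ricciComp (H : EuclideanSpace ℝ (Fin m) → Matrix (Fin m) (Fin m) ℝ)
    (x : EuclideanSpace ℝ (Fin m)) (b c : Fin m) : ℝ :=
  ∑ d, curvature (christoffel H) x b d c d

/-- The scalar curvature of the metric with components `H`. -/
def scalComp (H : EuclideanSpace ℝ (Fin m) → Matrix (Fin m) (Fin m) ℝ)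
    (x : EuclideanSpace ℝ (Fin m)) : ℝ :=
  ∑ b, ∑ c, ricciComp H x b c * (H x)⁻¹ c b

/-- The Schouten tensor `(Ric - R / (2 (m - 1)) H) / (m - 2)` of the metric with components `H`. -/
def schoutenComp (H : EuclideanSpace ℝ (Fin m) → Matrix (Fin m) (Fin m) ℝ)
    (x : EuclideanSpace ℝ (Fin m)) : Matrix (Fin m) (Fin m) ℝ :=
  Matrix.of fun b c =>
    1 / ((m : ℝ) - 2) * (ricciComp H x b c - scalComp H x / (2 * ((m : ℝ) - 1)) * H x b c)

/-- The Schouten tensor with the first index raised. -/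
def schoutenEnd (H : EuclideanSpace ℝ (Fin m) → Matrix (Fin m) (Fin m) ℝ)
    (x : EuclideanSpace ℝ (Fin m)) : Matrix (Fin m) (Fin m) ℝ :=
  (H x)⁻¹ * schoutenComp H x

namespace IsMetricOn

theorem contDiffOn_curvature (hH : IsMetricOn H U) (a b c d : Fin m) :
    ContDiffOn ℝ ∞ (fun x => curvature (christoffel H) x a b c d) U :=
  BiConformal.contDiffOn_curvature hH.isOpen
    (contDiffOn_christoffel hH.isOpen hH.smooth hH.det_ne_zero) a b c d

theorem contDiffOn_inv (hH : IsMetricOn H U) (a b : Fin m) :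
    ContDiffOn ℝ ∞ (fun x => (H x)⁻¹ a b) U :=
  contDiffOn_matrix_inv hH.smooth hH.det_ne_zero a b

theorem contDiffOn_schoutenComp (hH : IsMetricOn H U) (b c : Fin m) :
    ContDiffOn ℝ ∞ (fun x => schoutenComp H x b c) U := by
  have hR : ∀ b c, ContDiffOn ℝ ∞ (fun x => ricciComp H x b c) U := fun b c =>
    ContDiffOn.sum fun d _ => hH.contDiffOn_curvature b d c d
  have hS : ContDiffOn ℝ ∞ (scalComp H) U :=
    ContDiffOn.sum fun b _ => ContDiffOn.sum fun c _ => (hR b c).mul (hH.contDiffOn_inv c b)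
  exact contDiffOn_const.mul ((hR b c).sub ((hS.div_const _).mul (hH.smooth b c)))

theorem contDiffOn_schoutenEnd (hH : IsMetricOn H U) (b c : Fin m) :
    ContDiffOn ℝ ∞ (fun x => schoutenEnd H x b c) U := by
  simp only [schoutenEnd, Matrix.mul_apply]
  exact ContDiffOn.sum fun d _ => (hH.contDiffOn_inv b d).mul (hH.contDiffOn_schoutenComp d c)

theorem curvature_eq (hH : IsMetricOn H U) {x : EuclideanSpace ℝ (Fin m)} (hx : x ∈ U)
    (a b c d : Fin m) : curvature (christoffel H) x a b c d
      = curv (fun y => connCLM (christoffel H y)) x (stdVec a) (stdVec b) (stdVec c) d :=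
  curvature_eq_curv hH.isOpen (contDiffOn_christoffel hH.isOpen hH.smooth hH.det_ne_zero) hx a b c d

theorem ricciComp_eq_trace (hH : IsMetricOn H U) {x : EuclideanSpace ℝ (Fin m)} (hx : x ∈ U)
    (b c : Fin m) : ricciComp H x b c
      = LinearMap.trace ℝ _ (curvEnd (fun y => connCLM (christoffel H y)) x (stdVec b)
        (stdVec c)) := by
  rw [trace_eq_sum]
  exact Finset.sum_congr rfl fun d _ => hH.curvature_eq hx b d c d

theorem ricciComp_symm (hH : IsMetricOn H U) {x : EuclideanSpace ℝ (Fin m)} (hx : x ∈ U)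
    (b c : Fin m) : ricciComp H x b c = ricciComp H x c b := by
  rw [hH.ricciComp_eq_trace hx, hH.ricciComp_eq_trace hx, hH.isLeviCivita.ricci_symm hx]

theorem schoutenComp_symm (hH : IsMetricOn H U) {x : EuclideanSpace ℝ (Fin m)} (hx : x ∈ U)
    (b c : Fin m) : schoutenComp H x b c = schoutenComp H x c b := by
  simp only [schoutenComp, Matrix.of_apply]
  rw [hH.ricciComp_symm hx, hH.symm x hx]

theorem trace_schoutenEnd (hH : IsMetricOn H U) (hm : 3 ≤ m) {x : EuclideanSpace ℝ (Fin m)}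
    (hx : x ∈ U) : (schoutenEnd H x).trace = scalComp H x / (2 * ((m : ℝ) - 1)) := by
  have e : schoutenComp H x = (1 / ((m : ℝ) - 2)) • (Matrix.of (ricciComp H x)
      - (scalComp H x / (2 * ((m : ℝ) - 1))) • H x) := by
    ext; simp [schoutenComp]
  have e2 : ((H x)⁻¹ * Matrix.of (ricciComp H x)).trace = scalComp H x := by
    rw [Matrix.trace_mul_comm]
    simp only [Matrix.trace, Matrix.diag_apply, Matrix.mul_apply, scalComp, Matrix.of_apply]
  rw [schoutenEnd, e, Matrix.mul_smul, Matrix.mul_sub, Matrix.mul_smul, hH.inv_mul hx]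
  simp only [Matrix.trace_smul, Matrix.trace_sub, e2, Matrix.trace_one, Fintype.card_fin,
    smul_eq_mul]
  have h3 : (3 : ℝ) ≤ m := by exact_mod_cast hm
  have h1 : (m : ℝ) - 1 ≠ 0 := by linarith
  have h2 : (m : ℝ) - 2 ≠ 0 := by linarith
  field_simp
  ring

/-- The components `schoutenComp` are those of the Schouten tensor. -/
theorem isSchouten (hH : IsMetricOn H U) (hm : 3 ≤ m) :
    IsSchouten (fun x => bilCLM (H x)) (fun x => bilCLM (schoutenComp H x))
      (fun x => endCLM (schoutenEnd H x)) (fun x => connCLM (christoffel H x)) U where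
  smooth_form := contDiffOn_bilCLM hH.contDiffOn_schoutenComp
  smooth_end := contDiffOn_endCLM hH.contDiffOn_schoutenEnd
  metric_apply x hx u v := by
    have : (bilCLM (H x)).comp (endCLM (schoutenEnd H x)) = bilCLM (schoutenComp H x) := by
      refine clm_ext fun a => clm_ext fun b => ?_
      have hm : H x * schoutenEnd H x = schoutenComp H x := by
        rw [schoutenEnd, ← Matrix.mul_assoc, hH.mul_inv hx, Matrix.one_mul]
      rw [ContinuousLinearMap.comp_apply, bilCLM_stdVec_right, bilCLM_stdVec,
        hH.schoutenComp_symm hx, ← hm, Matrix.mul_apply]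
      refine Finset.sum_congr rfl fun c _ => ?_
      rw [endCLM_stdVec, hH.symm x hx c b]
    exact congrArg (fun T => T u v) this
  symm x hx u v := by
    have : bilCLM (schoutenComp H x) = (bilCLM (schoutenComp H x)).flip :=
      clm_ext fun a => clm_ext fun b => by
        rw [ContinuousLinearMap.flip_apply, bilCLM_stdVec, bilCLM_stdVec, hH.schoutenComp_symm hx]
    exact congrArg (fun T => T u v) this
  ricci x hx u z := by
    have h3 : (3 : ℝ) ≤ m := by exact_mod_cast hm
    have h1 : (m : ℝ) - 1 ≠ 0 := by linarith
    have h2 : (m : ℝ) - 2 ≠ 0 := by linarith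
    have ht : LinearMap.trace ℝ _ (endCLM (schoutenEnd H x)).toLinearMap
        = scalComp H x / (2 * ((m : ℝ) - 1)) := by
      rw [← hH.trace_schoutenEnd hm hx, trace_eq_sum]
      simp [Matrix.trace]
    have hb : ∀ a b, LinearMap.trace ℝ _ (curvEnd (fun y => connCLM (christoffel H y)) x
        (stdVec a) (stdVec b)) = ((m : ℝ) - 2) * schoutenComp H x a b
          + scalComp H x / (2 * ((m : ℝ) - 1)) * H x a b := by
      intro a b
      rw [← hH.ricciComp_eq_trace hx, schoutenComp, Matrix.of_apply]
      field_simp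
      ring
    rw [finrank_euclideanSpace_fin, ht, ← sub_eq_zero]
    refine isLinearMap_eq_zero (stdBasis m) (f := fun u => LinearMap.trace ℝ _
      (curvEnd (fun y => connCLM (christoffel H y)) x u z)
      - (((m : ℝ) - 2) * bilCLM (schoutenComp H x) u z
        + scalComp H x / (2 * ((m : ℝ) - 1)) * bilCLM (H x) u z)) ?_ (fun a =>
      isLinearMap_eq_zero (stdBasis m) (f := fun z => LinearMap.trace ℝ _
      (curvEnd (fun y => connCLM (christoffel H y)) x (stdBasis m a) z)
      - (((m : ℝ) - 2) * bilCLM (schoutenComp H x) (stdBasis m a) z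
        + scalComp H x / (2 * ((m : ℝ) - 1)) * bilCLM (H x) (stdBasis m a) z)) ?_
        (fun b => ?_) z) u
    · have hadd : ∀ u u', curvEnd (fun y => connCLM (christoffel H y)) x (u + u') z
          = curvEnd (fun y => connCLM (christoffel H y)) x u z
            + curvEnd (fun y => connCLM (christoffel H y)) x u' z := fun u u' =>
        LinearMap.ext fun v => (isLinearMap_curv₁ _ x v z).map_add u u'
      have hsmul : ∀ (c : ℝ) u, curvEnd (fun y => connCLM (christoffel H y)) x (c • u) z
          = c • curvEnd (fun y => connCLM (christoffel H y)) x u z := fun c u =>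
        LinearMap.ext fun v => (isLinearMap_curv₁ _ x v z).map_smul c u
      exact ⟨fun u u' => by simp only [hadd, map_add, add_apply]; ring,
        fun c u => by simp only [hsmul, map_smul, smul_apply, smul_eq_mul]; ring⟩
    · have hadd : ∀ u z z', curvEnd (fun y => connCLM (christoffel H y)) x u (z + z')
          = curvEnd (fun y => connCLM (christoffel H y)) x u z
            + curvEnd (fun y => connCLM (christoffel H y)) x u z' := fun u z z' =>
        LinearMap.ext fun v => (isLinearMap_curv₃ _ x u v).map_add z z'
      have hsmul : ∀ (c : ℝ) u z, curvEnd (fun y => connCLM (christoffel H y)) x u (c • z)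
          = c • curvEnd (fun y => connCLM (christoffel H y)) x u z := fun c u z =>
        LinearMap.ext fun v => (isLinearMap_curv₃ _ x u v).map_smul c z
      exact ⟨fun u u' => by simp only [hadd, map_add]; ring,
        fun c u => by simp only [hsmul, map_smul, smul_eq_mul]; ring⟩
    · simp only [stdBasis_apply, hb, bilCLM_stdVec, sub_self]

end IsMetricOn

/-- Vanishing of the Weyl tensor of the metric with components `H`. -/
abbrev WeylFreeComp (H : EuclideanSpace ℝ (Fin m) → Matrix (Fin m) (Fin m) ℝ)
    (x : EuclideanSpace ℝ (Fin m)) : Prop :=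
  WeylFree (fun x => bilCLM (H x)) (fun x => bilCLM (schoutenComp H x))
    (fun x => endCLM (schoutenEnd H x)) (fun x => connCLM (christoffel H x)) x

/-- Vanishing of the Cotton tensor of the metric with components `H`. -/
abbrev CottonFreeComp (H : EuclideanSpace ℝ (Fin m) → Matrix (Fin m) (Fin m) ℝ)
    (x : EuclideanSpace ℝ (Fin m)) : Prop :=
  CottonFree (fun x => bilCLM (schoutenComp H x)) (fun x => connCLM (christoffel H x)) x

theorem curv_congr {E : Type*} [NormedAddCommGroup E] [NormedSpace ℝ E]
    {Γ Γ' : E → E →L[ℝ] E →L[ℝ] E} {x : E} (h : Γ =ᶠ[𝓝 x] Γ') (u v w : E) :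
    curv Γ x u v w = curv Γ' x u v w := by
  rw [curv, curv, h.fderiv_eq, h.self_of_nhds]

theorem bilCLM_smul (c : ℝ) (B : Matrix (Fin m) (Fin m) ℝ) : bilCLM (c • B) = c • bilCLM B :=
  clm_ext fun a => clm_ext fun b => by simp

/-- The metric `e^{2f} H` is flat iff its Levi-Civita connection, expressed by `confConn`, is. -/
theorem IsMetricOn.curvature_conformal_eq_zero_iff (hH : IsMetricOn H U)
    {f : EuclideanSpace ℝ (Fin m) → ℝ} {k : EuclideanSpace ℝ (Fin m) → EuclideanSpace ℝ (Fin m)}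
    (hf : ContDiffOn ℝ ∞ f U) (hk : ContDiffOn ℝ ∞ k U)
    (hfk : ∀ x ∈ U, ∀ v, bilCLM (H x) (k x) v = fderiv ℝ f x v) {x : EuclideanSpace ℝ (Fin m)}
    (hx : x ∈ U) :
    (∀ a b c d, curvature (christoffel (fun z => Real.exp (2 * f z) • H z)) x a b c d = 0) ↔
    ∀ u v w, curv (confConn (fun x => bilCLM (H x)) (fun x => connCLM (christoffel H x)) k) x u v w
      = 0 := by
  have hH' : IsMetricOn (fun z => Real.exp (2 * f z) • H z) U :=
    { isOpen := hH.isOpen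
      smooth := fun a b => ((contDiffOn_const.mul hf).exp).mul (hH.smooth a b)
      det_ne_zero := fun x hx => by
        rw [Matrix.det_smul]
        exact mul_ne_zero (pow_ne_zero _ (Real.exp_pos _).ne') (hH.det_ne_zero x hx)
      symm := fun x hx a b => by simp [hH.symm x hx a b] }
  have L := hH.isLeviCivita.conformal hf hk hfk
  have L' := hH'.isLeviCivita
  simp only [bilCLM_smul] at L'
  have e : ∀ u v w, curv (fun y => connCLM (christoffel (fun z => Real.exp (2 * f z) • H z) y)) x
      u v w = curv (confConn (fun x => bilCLM (H x)) (fun x => connCLM (christoffel H x)) k)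
        x u v w :=
    curv_congr (Filter.eventuallyEq_of_mem (hH.isOpen.mem_nhds hx) fun y hy => L'.unique L hy hy)
  simp only [hH'.curvature_eq hx, e]
  constructor
  · intro h u v w
    ext d
    set Γ' := confConn (fun x => bilCLM (H x)) (fun x => connCLM (christoffel H x)) k
    refine trilinear_eq_zero (stdBasis m) (f := fun u v w => curv Γ' x u v w d) ?_ ?_ ?_
      (fun a b c => by simpa using h a b c d) u v w
    · exact fun v w => ⟨fun a b => by rw [(isLinearMap_curv₁ Γ' x v w).map_add]; rfl,
        fun c a => by rw [(isLinearMap_curv₁ Γ' x v w).map_smul]; rfl⟩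
    · exact fun v w => ⟨fun a b => by rw [(isLinearMap_curv₂ Γ' x v w).map_add]; rfl,
        fun c a => by rw [(isLinearMap_curv₂ Γ' x v w).map_smul]; rfl⟩
    · exact fun v w => ⟨fun a b => by rw [(isLinearMap_curv₃ Γ' x v w).map_add]; rfl,
        fun c a => by rw [(isLinearMap_curv₃ Γ' x v w).map_smul]; rfl⟩
  · intro h a b c d
    rw [h]; rfl

theorem IsMetricOn.weylFree_cottonFree_of_flat (hH : IsMetricOn H U) (hm : 3 ≤ m)
    {f : EuclideanSpace ℝ (Fin m) → ℝ} (hf : ContDiffOn ℝ ∞ f U)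
    (hflat : ∀ x ∈ U, ∀ a b c d,
      curvature (christoffel (fun z => Real.exp (2 * f z) • H z)) x a b c d = 0)
    {x : EuclideanSpace ℝ (Fin m)} (hx : x ∈ U) : WeylFreeComp H x ∧ CottonFreeComp H x := by
  have hdim : 3 ≤ finrank ℝ (EuclideanSpace ℝ (Fin m)) := by rwa [finrank_euclideanSpace_fin]
  let k : EuclideanSpace ℝ (Fin m) → EuclideanSpace ℝ (Fin m) := fun x =>
    ∑ a, (∑ b, (H x)⁻¹ a b * pd b f x) • stdVec a
  have hk : ContDiffOn ℝ ∞ k U := ContDiffOn.sum fun a _ =>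
    (ContDiffOn.sum fun b _ => (hH.contDiffOn_inv a b).mul
      (contDiffOn_pd hH.isOpen hf b)).smul contDiffOn_const
  have hfk : ∀ x ∈ U, ∀ v, bilCLM (H x) (k x) v = fderiv ℝ f x v := by
    intro x hx v
    have : bilCLM (H x) (k x) = fderiv ℝ f x := by
      refine clm_ext fun b => ?_
      have hkx : ∀ a, k x a = ((H x)⁻¹.mulVec fun b => pd b f x) a := fun a => by
        simp [k, Matrix.mulVec, dotProduct, Pi.single_apply]
      rw [bilCLM_stdVec_right]
      have : ∑ a, H x a b * k x a = ((H x).mulVec ((H x)⁻¹.mulVec fun b => pd b f x)) b := by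
        simp only [hkx]
        rw [Matrix.mulVec, dotProduct]
        exact Finset.sum_congr rfl fun a _ => by rw [hH.symm x hx a b]
      rw [this, Matrix.mulVec_mulVec, hH.mul_inv hx, Matrix.one_mulVec]
      rfl
    rw [this]
  have hflat' := fun x hx => (hH.curvature_conformal_eq_zero_iff hf hk hfk hx).1 (hflat x hx)
  exact ⟨WeylFree.of_flat hdim hH.isLeviCivita (hH.isSchouten hm) hf hk hfk hx (hflat' x hx),
    CottonFree.of_flat hdim hH.isLeviCivita (hH.isSchouten hm) hf hk hfk hflat' hx⟩

theorem IsMetricOn.exists_flat_of_weylFree_cottonFree (hH : IsMetricOn H U) (hm : 3 ≤ m)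
    (hW : ∀ x ∈ U, WeylFreeComp H x) (hC : ∀ x ∈ U, CottonFreeComp H x)
    {x₀ : EuclideanSpace ℝ (Fin m)} (hx₀ : x₀ ∈ U) : ∃ r > 0, Metric.ball x₀ r ⊆ U ∧
      ∃ f : EuclideanSpace ℝ (Fin m) → ℝ, ContDiffOn ℝ ∞ f (Metric.ball x₀ r) ∧
        ∀ x ∈ Metric.ball x₀ r, ∀ a b c d,
          curvature (christoffel (fun z => Real.exp (2 * f z) • H z)) x a b c d = 0 := by
  obtain ⟨r, hr, hrU, f, k, hf, hk, hfk, hflat⟩ :=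
    exists_flat_conformal hH.isLeviCivita (hH.isSchouten hm) hW hC hx₀
  refine ⟨r, hr, hrU, f, hf, fun x hx => ?_⟩
  exact ((hH.mono Metric.isOpen_ball hrU).curvature_conformal_eq_zero_iff hf hk hfk hx).2
    (hflat x hx)

/-- **The Weyl–Schouten theorem** in dimension at least four, local form. -/
theorem IsMetricOn.exists_flat_of_weylFree (hH : IsMetricOn H U) (hm : 4 ≤ m)
    (hW : ∀ x ∈ U, WeylFreeComp H x) {x₀ : EuclideanSpace ℝ (Fin m)} (hx₀ : x₀ ∈ U) :
    ∃ r > 0, Metric.ball x₀ r ⊆ U ∧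
      ∃ f : EuclideanSpace ℝ (Fin m) → ℝ, ContDiffOn ℝ ∞ f (Metric.ball x₀ r) ∧
        ∀ x ∈ Metric.ball x₀ r, ∀ a b c d,
          curvature (christoffel (fun z => Real.exp (2 * f z) • H z)) x a b c d = 0 :=
  hH.exists_flat_of_weylFree_cottonFree (by omega) hW (fun x hx =>
    CottonFree.of_weylFree (by rwa [finrank_euclideanSpace_fin]) hH.isLeviCivita
      (hH.isSchouten (by omega)) hW hx) hx₀

/-- **The Weyl–Schouten theorem** in dimension three, local form. -/
theorem IsMetricOn.exists_flat_of_cottonFree (hH : IsMetricOn H U) (hm : m = 3)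
    (hC : ∀ x ∈ U, CottonFreeComp H x) {x₀ : EuclideanSpace ℝ (Fin m)} (hx₀ : x₀ ∈ U) :
    ∃ r > 0, Metric.ball x₀ r ⊆ U ∧
      ∃ f : EuclideanSpace ℝ (Fin m) → ℝ, ContDiffOn ℝ ∞ f (Metric.ball x₀ r) ∧
        ∀ x ∈ Metric.ball x₀ r, ∀ a b c d,
          curvature (christoffel (fun z => Real.exp (2 * f z) • H z)) x a b c d = 0 :=
  hH.exists_flat_of_weylFree_cottonFree hm.ge (fun x hx =>
    WeylFree.of_finrank_three (by rw [finrank_euclideanSpace_fin, hm]) hH.isLeviCivita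
      (hH.isSchouten hm.ge) hx) hC hx₀

end ComponentSchouten

/-! ### Pairs of complementary orthogonal projectors -/

section AdaptedProjectors

variable {N n : ℕ} {G P Pi : EuclideanSpace ℝ (Fin N) → Matrix (Fin N) (Fin N) ℝ}
  {O : Set (EuclideanSpace ℝ (Fin N))}

/-- The components `G`, `P`, `Π` of a smooth metric on the open set `O` and of two smooth fields of
complementary orthogonal projectors, `Π` of rank `n`. -/
structure IsProjectorPairOn (n : ℕ) (G P Pi : EuclideanSpace ℝ (Fin N) → Matrix (Fin N) (Fin N) ℝ)
    (O : Set (EuclideanSpace ℝ (Fin N))) : Prop where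
  metric : IsMetricOn G O
  smooth : ∀ a b, ContDiffOn ℝ ∞ (fun x => Pi x a b) O
  add_eq_one : ∀ x ∈ O, P x + Pi x = 1
  idem : ∀ x ∈ O, Pi x * Pi x = Pi x
  symm : ∀ x ∈ O, (G x * Pi x).transpose = G x * Pi x
  trace : ∀ x ∈ O, (Pi x).trace = n

theorem contDiffOn_matrix_mul {k : ℕ} {X : Type*} [NormedAddCommGroup X] [NormedSpace ℝ X]
    {U : Set X} {l m : ℕ} {A : X → Matrix (Fin k) (Fin l) ℝ} {B : X → Matrix (Fin l) (Fin m) ℝ}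
    (hA : ∀ a b, ContDiffOn ℝ ∞ (fun x => A x a b) U)
    (hB : ∀ a b, ContDiffOn ℝ ∞ (fun x => B x a b) U) (a : Fin k) (b : Fin m) :
    ContDiffOn ℝ ∞ (fun x => (A x * B x) a b) U := by
  simp only [Matrix.mul_apply]
  exact ContDiffOn.sum fun c _ => (hA a c).mul (hB c b)

theorem contDiffOn_covDeriv {m : ℕ} {U : Set (EuclideanSpace ℝ (Fin m))} (hU : IsOpen U)
    {Γ : EuclideanSpace ℝ (Fin m) → Fin m → Fin m → Fin m → ℝ}
    {S : EuclideanSpace ℝ (Fin m) → Fin m → Fin m → ℝ}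
    (hΓ : ∀ c a b, ContDiffOn ℝ ∞ (fun x => Γ x c a b) U)
    (hS : ∀ a b, ContDiffOn ℝ ∞ (fun x => S x a b) U) (c a b : Fin m) :
    ContDiffOn ℝ ∞ (fun x => covDeriv Γ S x c a b) U :=
  (contDiffOn_pd hU (hS a b) c).sub (ContDiffOn.sum fun d _ =>
    ((hΓ d c a).mul (hS d b)).add ((hΓ d c b).mul (hS a d)))

namespace IsProjectorPairOn

variable (h : IsProjectorPairOn n G P Pi O)
include h

theorem eq_one_sub {x : EuclideanSpace ℝ (Fin N)} (hx : x ∈ O) : P x = 1 - Pi x :=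
  eq_sub_of_add_eq (h.add_eq_one x hx)

theorem mul_eq_zero {x : EuclideanSpace ℝ (Fin N)} (hx : x ∈ O) : P x * Pi x = 0 := by
  rw [h.eq_one_sub hx, Matrix.sub_mul, Matrix.one_mul, h.idem x hx, sub_self]

theorem mul_self {x : EuclideanSpace ℝ (Fin N)} (hx : x ∈ O) : P x * P x = P x := by
  rw [h.eq_one_sub hx, Matrix.sub_mul, Matrix.mul_sub, Matrix.mul_sub, h.idem x hx]
  simp

theorem symm_compl {x : EuclideanSpace ℝ (Fin N)} (hx : x ∈ O) :
    (G x * P x).transpose = G x * P x := by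
  rw [h.eq_one_sub hx, Matrix.mul_sub, Matrix.transpose_sub, h.symm x hx, Matrix.mul_one,
    h.metric.transpose_eq hx]

theorem trace_compl {x : EuclideanSpace ℝ (Fin N)} (hx : x ∈ O) : (P x).trace = (N : ℝ) - n := by
  rw [h.eq_one_sub hx, Matrix.trace_sub, h.trace x hx, Matrix.trace_one, Fintype.card_fin]

theorem smooth_compl (a b : Fin N) : ContDiffOn ℝ ∞ (fun x => P x a b) O := by
  refine ContDiffOn.congr (f := fun x => (1 : Matrix (Fin N) (Fin N) ℝ) a b - Pi x a b)
    (contDiffOn_const.sub (h.smooth a b)) fun x hx => ?_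
  rw [h.eq_one_sub hx, Matrix.sub_apply]

theorem contDiffOn_lower {A : EuclideanSpace ℝ (Fin N) → Matrix (Fin N) (Fin N) ℝ}
    (hA : ∀ a b, ContDiffOn ℝ ∞ (fun x => A x a b) O) (a b : Fin N) :
    ContDiffOn ℝ ∞ (fun x => lower G A x a b) O :=
  ContDiffOn.sum fun c _ => (h.metric.smooth a c).mul (hA c b)

theorem contDiffOn_raise {A : EuclideanSpace ℝ (Fin N) → Matrix (Fin N) (Fin N) ℝ}
    (hA : ∀ a b, ContDiffOn ℝ ∞ (fun x => A x a b) O) (a b : Fin N) :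
    ContDiffOn ℝ ∞ (fun x => raise G A x a b) O :=
  ContDiffOn.sum fun c _ => (hA a c).mul (h.metric.contDiffOn_inv c b)

theorem contDiffOn_christoffel (a b c : Fin N) :
    ContDiffOn ℝ ∞ (fun x => christoffel G x a b c) O :=
  BiConformal.contDiffOn_christoffel h.metric.isOpen h.metric.smooth h.metric.det_ne_zero a b c

theorem contDiffOn_tensorM (a b c : Fin N) : ContDiffOn ℝ ∞ (fun x => tensorM G P x a b c) O := by
  have := contDiffOn_covDeriv h.metric.isOpen h.contDiffOn_christoffel
    (h.contDiffOn_lower h.smooth_compl)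
  exact ((this b a c).add (this c a b)).sub (this a b c)

theorem contDiffOn_tensorL (a b c : Fin N) :
    ContDiffOn ℝ ∞ (fun x => tensorL G P Pi x a b c) O := by
  have hM := h.contDiffOn_tensorM
  have hP := h.smooth_compl
  have hE : ∀ a, ContDiffOn ℝ ∞ (fun x => tensorE G P x a) O := fun a =>
    ContDiffOn.sum fun c _ => ContDiffOn.sum fun b _ => (hM a c b).mul (h.contDiffOn_raise hP c b)
  have hW : ∀ a, ContDiffOn ℝ ∞ (fun x => tensorW G P Pi x a) O := fun a =>
    (ContDiffOn.sum fun c _ => ContDiffOn.sum fun b _ =>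
      (hM a c b).mul (h.contDiffOn_raise h.smooth c b)).neg
  -- the traces in the denominators are constant on `O`
  have e : ∀ x ∈ O, tensorL G P Pi x a b c =
      1 / (2 * ((N : ℝ) - n)) * (tensorE G P x b * P x a c + tensorE G P x c * P x a b)
      + 1 / (2 * ((N : ℝ) - ((N : ℝ) - n))) *
        (tensorW G P Pi x b * Pi x a c + tensorW G P Pi x c * Pi x a b)
      + (1 / 2) * ∑ d, (P x a d - Pi x a d) * ∑ e, (G x)⁻¹ d e * tensorM G P x e b c := by
    intro x hx
    rw [tensorL, h.trace_compl hx]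
  refine ContDiffOn.congr ?_ e
  refine ((contDiffOn_const.mul (((hE b).mul (hP a c)).add ((hE c).mul (hP a b)))).add
    (contDiffOn_const.mul (((hW b).mul (h.smooth a c)).add ((hW c).mul (h.smooth a b))))).add
    (contDiffOn_const.mul (ContDiffOn.sum fun d _ => ((hP a d).sub (h.smooth a d)).mul
      (ContDiffOn.sum fun e _ => (h.metric.contDiffOn_inv d e).mul (hM e b c))))

theorem contDiffOn_biconfConnection (a b c : Fin N) :
    ContDiffOn ℝ ∞ (fun x => biconfConnection G P Pi x a b c) O :=
  (h.contDiffOn_christoffel a b c).add (h.contDiffOn_tensorL a b c)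

theorem contDiffOn_biconfCurvature (a b c d : Fin N) :
    ContDiffOn ℝ ∞ (fun x => biconfCurvature G P Pi x a b c d) O :=
  contDiffOn_curvature h.metric.isOpen h.contDiffOn_biconfConnection a b c d

theorem contDiffOn_tensorLPi (p : ℕ) (b c : Fin N) :
    ContDiffOn ℝ ∞ (fun x => tensorLPi G P Pi p x b c) O := by
  have hR := h.contDiffOn_biconfCurvature
  have hp := h.smooth
  have hS : ContDiffOn ℝ ∞ (scalarPi G P Pi) O :=
    ContDiffOn.sum fun b _ => ContDiffOn.sum fun c _ => ContDiffOn.sum fun d _ =>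
      ContDiffOn.sum fun r _ => ((hp d r).mul (hR b d c r)).mul (h.contDiffOn_raise hp c b)
  refine (contDiffOn_const.mul ((ContDiffOn.sum fun d _ => ContDiffOn.sum fun r _ =>
    (hp d r).mul (hR b d c r)).sub (contDiffOn_const.mul (((ContDiffOn.sum fun d _ =>
      ContDiffOn.sum fun r _ => ContDiffOn.sum fun q _ => ((hp d c).mul (hp r q)).mul
        (hR b d r q)).add (ContDiffOn.sum fun d _ =>
      ContDiffOn.sum fun r _ => ContDiffOn.sum fun q _ => ((hp d b).mul (hp r q)).mul
        (hR c d r q))).sub (ContDiffOn.sum fun r _ => ContDiffOn.sum fun q _ =>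
          (hp r q).mul (hR c b r q)))))).add ((hS.div_const _).mul (h.contDiffOn_lower hp b c))

end IsProjectorPairOn
end AdaptedProjectors

/-! ### Parametrized leaves and the Gauss formula -/

section LeafGeometry

variable {N n : ℕ} {G P Pi : EuclideanSpace ℝ (Fin N) → Matrix (Fin N) (Fin N) ℝ}
  {O : Set (EuclideanSpace ℝ (Fin N))} {H : EuclideanSpace ℝ (Fin n) → Matrix (Fin n) (Fin n) ℝ}
  {U : Set (EuclideanSpace ℝ (Fin n))} {y : EuclideanSpace ℝ (Fin n) → EuclideanSpace ℝ (Fin N)}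

theorem endCLM_mul {m : ℕ} (A B : Matrix (Fin m) (Fin m) ℝ) (u : EuclideanSpace ℝ (Fin m)) :
    endCLM (A * B) u = endCLM A (endCLM B u) := by
  ext c
  simp only [endCLM_apply, Matrix.mul_apply, Finset.mul_sum, Finset.sum_mul]
  rw [Finset.sum_comm]
  exact Finset.sum_congr rfl fun _ _ => Finset.sum_congr rfl fun _ _ => by ring

theorem endCLM_one {m : ℕ} (u : EuclideanSpace ℝ (Fin m)) :
    endCLM (1 : Matrix (Fin m) (Fin m) ℝ) u = u := by
  ext c
  simp [endCLM_apply, Matrix.one_apply]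

theorem endCLM_add {m : ℕ} (A B : Matrix (Fin m) (Fin m) ℝ) (u : EuclideanSpace ℝ (Fin m)) :
    endCLM (A + B) u = endCLM A u + endCLM B u := by
  ext c
  simp [endCLM_apply, add_mul, Finset.sum_add_distrib]

theorem bilCLM_mul {m : ℕ} (A B : Matrix (Fin m) (Fin m) ℝ) (u v : EuclideanSpace ℝ (Fin m)) :
    bilCLM (A * B) u v = bilCLM A u (endCLM B v) := by
  simp only [bilCLM_apply, endCLM_apply, Matrix.mul_apply, Finset.mul_sum, Finset.sum_mul]
  refine Finset.sum_congr rfl fun a _ => ?_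
  rw [Finset.sum_comm]
  exact Finset.sum_congr rfl fun _ _ => Finset.sum_congr rfl fun _ _ => by ring

theorem bilCLM_comm {m : ℕ} {A : Matrix (Fin m) (Fin m) ℝ} (hA : A.transpose = A)
    (u v : EuclideanSpace ℝ (Fin m)) : bilCLM A u v = bilCLM A v u := by
  rw [bilCLM_apply, bilCLM_apply, Finset.sum_comm]
  refine Finset.sum_congr rfl fun a _ => Finset.sum_congr rfl fun b _ => ?_
  rw [← Matrix.transpose_apply A, hA]; ring

theorem eq_sum_of_isLinearMap {m : ℕ} {F : Type*} [AddCommGroup F] [Module ℝ F]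
    {f : EuclideanSpace ℝ (Fin m) → F} (hf : IsLinearMap ℝ f) (u : EuclideanSpace ℝ (Fin m)) :
    f u = ∑ a, u a • f (stdVec a) := by
  have := congrArg (hf.mk' f) (eq_sum_stdVec u)
  rw [map_sum] at this
  simpa using this

theorem isLinearMap_covD₁ {E : Type*} [NormedAddCommGroup E] [NormedSpace ℝ E]
    (Γ : E → E →L[ℝ] E →L[ℝ] E) (S : E → E →L[ℝ] E →L[ℝ] ℝ) (x v w : E) :
    IsLinearMap ℝ fun u => covD Γ S x u v w :=
  ⟨fun a b => by simp only [covD, map_add, add_apply]; ring,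
    fun c a => by simp only [covD, map_smul, smul_apply, smul_eq_mul]; ring⟩

theorem isLinearMap_covD₂ {E : Type*} [NormedAddCommGroup E] [NormedSpace ℝ E]
    (Γ : E → E →L[ℝ] E →L[ℝ] E) (S : E → E →L[ℝ] E →L[ℝ] ℝ) (x u w : E) :
    IsLinearMap ℝ fun v => covD Γ S x u v w :=
  ⟨fun a b => by simp only [covD, map_add, add_apply]; ring,
    fun c a => by simp only [covD, map_smul, smul_apply, smul_eq_mul]; ring⟩

theorem isLinearMap_covD₃ {E : Type*} [NormedAddCommGroup E] [NormedSpace ℝ E]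
    (Γ : E → E →L[ℝ] E →L[ℝ] E) (S : E → E →L[ℝ] E →L[ℝ] ℝ) (x u v : E) :
    IsLinearMap ℝ fun w => covD Γ S x u v w :=
  ⟨fun a b => by simp only [covD, map_add]; ring,
    fun c a => by simp only [covD, map_smul, smul_eq_mul]; ring⟩

/-- The map `y : U → O` parametrizes an integral manifold of the range of the projectors `Π`, and
`H` are the components of the metric induced by `G`. -/
structure IsLeafParam (G Pi : EuclideanSpace ℝ (Fin N) → Matrix (Fin N) (Fin N) ℝ)
    (O : Set (EuclideanSpace ℝ (Fin N))) (H : EuclideanSpace ℝ (Fin n) → Matrix (Fin n) (Fin n) ℝ)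
    (U : Set (EuclideanSpace ℝ (Fin n)))
    (y : EuclideanSpace ℝ (Fin n) → EuclideanSpace ℝ (Fin N)) : Prop where
  metric : IsMetricOn H U
  smooth : ContDiffOn ℝ ∞ y U
  mapsTo : ∀ s ∈ U, y s ∈ O
  induced : ∀ s ∈ U, ∀ u v, bilCLM (G (y s)) (fderiv ℝ y s u) (fderiv ℝ y s v) = bilCLM (H s) u v
  tangent : ∀ s ∈ U, ∀ v, endCLM (Pi (y s)) (fderiv ℝ y s v) = fderiv ℝ y s v
  surj : ∀ s ∈ U, ∀ w, ∃ v, endCLM (Pi (y s)) w = fderiv ℝ y s v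

/-- The second derivative `K = D²y + γ(Dy, Dy)` of the parametrization with respect to the ambient
Levi-Civita connection. -/
def secondDeriv (G : EuclideanSpace ℝ (Fin N) → Matrix (Fin N) (Fin N) ℝ)
    (y : EuclideanSpace ℝ (Fin n) → EuclideanSpace ℝ (Fin N)) (s u v : EuclideanSpace ℝ (Fin n)) :
    EuclideanSpace ℝ (Fin N) :=
  fderiv ℝ (fderiv ℝ y) s u v
    + connCLM (christoffel G (y s)) (fderiv ℝ y s u) (fderiv ℝ y s v)

namespace IsLeafParam

variable (h : IsProjectorPairOn n G P Pi O) (l : IsLeafParam G Pi O H U y)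
include l

theorem contDiffAt {s : EuclideanSpace ℝ (Fin n)} (hs : s ∈ U) : ContDiffAt ℝ ∞ y s :=
  l.smooth.contDiffAt (l.metric.isOpen.mem_nhds hs)

include h

theorem normal {s : EuclideanSpace ℝ (Fin n)} (hs : s ∈ U) (v : EuclideanSpace ℝ (Fin n)) :
    endCLM (P (y s)) (fderiv ℝ y s v) = 0 := by
  have := endCLM_add (P (y s)) (Pi (y s)) (fderiv ℝ y s v)
  rw [h.add_eq_one _ (l.mapsTo s hs), endCLM_one, l.tangent s hs] at this
  simpa using this.symm


omit h in
/-- The Gauss formula: the tangential part of the second derivative of the parametrization is the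
Levi-Civita connection of the induced metric. -/
theorem gauss (hG : IsMetricOn G O) {s : EuclideanSpace ℝ (Fin n)} (hs : s ∈ U)
    (u v w : EuclideanSpace ℝ (Fin n)) :
    bilCLM (G (y s)) (secondDeriv G y s u v) (fderiv ℝ y s w)
      = bilCLM (H s) (connCLM (christoffel H s) u v) w := by
  have hy := l.contDiffAt hs
  have hy1 : ContDiffAt ℝ ∞ (fderiv ℝ y) s := hy.fderiv_right (by simp)
  have dy := (hy.differentiableAt (by simp)).hasFDerivAt
  have dJ := (hy1.differentiableAt (by simp)).hasFDerivAt
  have LG := hG.isLeviCivita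
  have LH := l.metric.isLeviCivita
  have hys := l.mapsTo s hs
  have dG := ((LG.contDiffAt_metric hys).differentiableAt (by simp)).hasFDerivAt
  have dH := ((LH.contDiffAt_metric hs).differentiableAt (by simp)).hasFDerivAt
  have dGy : HasFDerivAt (fun z => bilCLM (G (y z)))
      ((fderiv ℝ (fun x => bilCLM (G x)) (y s)).comp (fderiv ℝ y s)) s :=
    HasFDerivAt.comp (g := fun x => bilCLM (G x)) s dG dy
  have key : ∀ a b c, bilCLM (G (y s)) (secondDeriv G y s a b) (fderiv ℝ y s c)
      + bilCLM (G (y s)) (fderiv ℝ y s b) (secondDeriv G y s a c)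
      = bilCLM (H s) (connCLM (christoffel H s) a b) c
        + bilCLM (H s) b (connCLM (christoffel H s) a c) := by
    intro a b c
    have hl := (dGy.clm_apply (dJ.clm_apply (hasFDerivAt_const b s))).clm_apply
      (dJ.clm_apply (hasFDerivAt_const c s))
    have hr := (dH.clm_apply (hasFDerivAt_const b s)).clm_apply (hasFDerivAt_const c s)
    have e := (hl.congr_of_eventuallyEq (Filter.eventuallyEq_of_mem
      (l.metric.isOpen.mem_nhds hs) fun z hz => (l.induced z hz b c).symm)).unique hr
    have e := congrArg (fun T => T a) e
    simp at e
    rw [LG.compat _ hys, LH.compat _ hs] at e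
    rw [← e]
    simp only [secondDeriv, map_add, add_apply]
    ring
  have sK : ∀ a b, secondDeriv G y s a b = secondDeriv G y s b a := fun a b => by
    rw [secondDeriv, secondDeriv, LG.torsion_free _ hys,
      (hy.isSymmSndFDerivAt minSmoothness_two_le : IsSymmSndFDerivAt ℝ y s).eq]
  have k1 := key u v w
  have k2 := key v w u
  have k3 := key w u v
  have sG := LG.symm _ hys
  have sH := LH.symm _ hs
  rw [sG (fderiv ℝ y s v), sH v] at k1
  rw [sG (fderiv ℝ y s w), sH w, sK v u, LH.torsion_free _ hs v u] at k2
  rw [sG (fderiv ℝ y s u), sH u, sK w u, sK w v, LH.torsion_free _ hs w u,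
    LH.torsion_free _ hs w v] at k3
  linarith

theorem proj_secondDeriv {s : EuclideanSpace ℝ (Fin n)} (hs : s ∈ U)
    (u v : EuclideanSpace ℝ (Fin n)) : endCLM (Pi (y s)) (secondDeriv G y s u v)
      = fderiv ℝ y s (connCLM (christoffel H s) u v) := by
  obtain ⟨z, hz⟩ := l.surj s hs (secondDeriv G y s u v)
  have hys := l.mapsTo s hs
  rw [hz]
  congr 1
  refine l.metric.isLeviCivita.eq_of_metric hs fun w => ?_
  rw [← l.gauss h.metric hs, ← l.induced s hs, ← hz,
    h.metric.isLeviCivita.symm _ hys, ← bilCLM_mul, ← bilCLM_comm (h.symm _ hys), bilCLM_mul,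
    l.tangent s hs]

end IsLeafParam
end LeafGeometry

/-! ### The tensor `M` on the leaves -/

section LeafConnection

variable {N n : ℕ} {G P Pi : EuclideanSpace ℝ (Fin N) → Matrix (Fin N) (Fin N) ℝ}
  {O : Set (EuclideanSpace ℝ (Fin N))} {H : EuclideanSpace ℝ (Fin n) → Matrix (Fin n) (Fin n) ℝ}
  {U : Set (EuclideanSpace ℝ (Fin n))} {y : EuclideanSpace ℝ (Fin n) → EuclideanSpace ℝ (Fin N)}

/-- The tensor `M(w; u, v) = (∇_u P)(w, v) + (∇_v P)(w, u) - (∇_w P)(u, v)` as a trilinear form. -/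
def mForm (G P : EuclideanSpace ℝ (Fin N) → Matrix (Fin N) (Fin N) ℝ)
    (x w u v : EuclideanSpace ℝ (Fin N)) : ℝ :=
  covD (fun x => connCLM (christoffel G x)) (fun x => bilCLM (G x * P x)) x u w v
    + covD (fun x => connCLM (christoffel G x)) (fun x => bilCLM (G x * P x)) x v w u
    - covD (fun x => connCLM (christoffel G x)) (fun x => bilCLM (G x * P x)) x w u v

theorem isLinearMap_add_sub {E : Type*} [AddCommGroup E] [Module ℝ E] {f g k : E → ℝ}
    (hf : IsLinearMap ℝ f) (hg : IsLinearMap ℝ g) (hk : IsLinearMap ℝ k) :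
    IsLinearMap ℝ fun x => f x + g x - k x :=
  ((hf.mk' f + hg.mk' g - hk.mk' k : E →ₗ[ℝ] ℝ)).isLinear

theorem isLinearMap_mForm₁ (x u v : EuclideanSpace ℝ (Fin N)) :
    IsLinearMap ℝ fun w => mForm G P x w u v :=
  isLinearMap_add_sub (isLinearMap_covD₂ _ _ _ _ _) (isLinearMap_covD₂ _ _ _ _ _)
    (isLinearMap_covD₁ _ _ _ _ _)

theorem isLinearMap_mForm₂ (x w v : EuclideanSpace ℝ (Fin N)) :
    IsLinearMap ℝ fun u => mForm G P x w u v :=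
  isLinearMap_add_sub (isLinearMap_covD₁ _ _ _ _ _) (isLinearMap_covD₃ _ _ _ _ _)
    (isLinearMap_covD₂ _ _ _ _ _)

theorem isLinearMap_mForm₃ (x w u : EuclideanSpace ℝ (Fin N)) :
    IsLinearMap ℝ fun v => mForm G P x w u v :=
  isLinearMap_add_sub (isLinearMap_covD₃ _ _ _ _ _) (isLinearMap_covD₁ _ _ _ _ _)
    (isLinearMap_covD₃ _ _ _ _ _)

theorem of_lower (A : EuclideanSpace ℝ (Fin N) → Matrix (Fin N) (Fin N) ℝ)
    (x : EuclideanSpace ℝ (Fin N)) : Matrix.of (lower G A x) = G x * A x := by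
  ext a b
  simp [lower, Matrix.mul_apply]

theorem of_raise (A : EuclideanSpace ℝ (Fin N) → Matrix (Fin N) (Fin N) ℝ)
    (x : EuclideanSpace ℝ (Fin N)) : Matrix.of (raise G A x) = A x * (G x)⁻¹ := by
  ext a b
  simp [raise, Matrix.mul_apply]

theorem IsProjectorPairOn.tensorM_eq (h : IsProjectorPairOn n G P Pi O)
    {x : EuclideanSpace ℝ (Fin N)} (hx : x ∈ O) (a b c : Fin N) :
    tensorM G P x a b c = mForm G P x (stdVec a) (stdVec b) (stdVec c) := by
  have := fun c a b => covDeriv_eq_covD (Γ := christoffel G) h.metric.isOpen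
    (h.contDiffOn_lower h.smooth_compl) hx c a b
  simp only [of_lower] at this
  simp only [tensorM, mForm, this]

/-- A bilinear function on `ℝᵐ` is the bilinear form with its components. -/
theorem bilCLM_of {m : ℕ} {t : EuclideanSpace ℝ (Fin m) → EuclideanSpace ℝ (Fin m) → ℝ}
    (h1 : ∀ v, IsLinearMap ℝ fun u => t u v) (h2 : ∀ u, IsLinearMap ℝ fun v => t u v)
    (u v : EuclideanSpace ℝ (Fin m)) :
    ∑ a, ∑ b, t (stdVec a) (stdVec b) * (u a * v b) = t u v := by
  rw [eq_sum_of_isLinearMap (h1 v) u]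
  refine Finset.sum_congr rfl fun a _ => ?_
  rw [eq_sum_of_isLinearMap (h2 (stdVec a)) v, Finset.smul_sum]
  refine Finset.sum_congr rfl fun b _ => ?_
  simp only [smul_eq_mul]
  ring

namespace IsLeafParam

variable (h : IsProjectorPairOn n G P Pi O) (l : IsLeafParam G Pi O H U y)
include h l

theorem lower_compl_tangent {s : EuclideanSpace ℝ (Fin n)} (hs : s ∈ U)
    (v : EuclideanSpace ℝ (Fin n)) (w : EuclideanSpace ℝ (Fin N)) :
    bilCLM (G (y s) * P (y s)) (fderiv ℝ y s v) w = 0 := by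
  rw [bilCLM_comm (h.symm_compl (l.mapsTo s hs)), bilCLM_mul, l.normal h hs, map_zero]

omit l in
theorem contDiffAt_lower_compl {x : EuclideanSpace ℝ (Fin N)} (hx : x ∈ O) :
    ContDiffAt ℝ ∞ (fun x => bilCLM (G x * P x)) x :=
  (contDiffOn_bilCLM (contDiffOn_matrix_mul h.metric.smooth h.smooth_compl)).contDiffAt
    (h.metric.isOpen.mem_nhds hx)

/-- `P(v, w) = 0` along the leaf for tangent `v`; differentiate it in the direction `u`. -/
theorem covD_tangent_tangent {s : EuclideanSpace ℝ (Fin n)} (hs : s ∈ U)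
    (u v : EuclideanSpace ℝ (Fin n)) (w : EuclideanSpace ℝ (Fin N)) :
    covD (fun x => connCLM (christoffel G x)) (fun x => bilCLM (G x * P x)) (y s)
      (fderiv ℝ y s u) (fderiv ℝ y s v) w
      = -bilCLM (G (y s) * P (y s)) (secondDeriv G y s u v) w := by
  have hy := l.contDiffAt hs
  have hy1 : ContDiffAt ℝ ∞ (fderiv ℝ y) s := hy.fderiv_right (by simp)
  have dy := (hy.differentiableAt (by simp)).hasFDerivAt
  have dJ := (hy1.differentiableAt (by simp)).hasFDerivAt
  have dp := ((contDiffAt_lower_compl h (l.mapsTo s hs)).differentiableAt (by simp)).hasFDerivAt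
  have dpy : HasFDerivAt (fun z => bilCLM (G (y z) * P (y z)))
      ((fderiv ℝ (fun x => bilCLM (G x * P x)) (y s)).comp (fderiv ℝ y s)) s :=
    HasFDerivAt.comp (g := fun x => bilCLM (G x * P x)) s dp dy
  have hl := (dpy.clm_apply (dJ.clm_apply (hasFDerivAt_const v s))).clm_apply
    (hasFDerivAt_const w s)
  have e := (hl.congr_of_eventuallyEq (Filter.eventuallyEq_of_mem
      (l.metric.isOpen.mem_nhds hs) fun z hz => (l.lower_compl_tangent h hz v w).symm)).unique
      (hasFDerivAt_const (0 : ℝ) s)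
  have e := congrArg (fun T => T u) e
  simp at e
  simp only [covD, secondDeriv, map_add, add_apply, l.lower_compl_tangent h hs]
  linarith

/-- `∇P` vanishes on two vectors in the kernel of `P`, as `P² = P`. -/
theorem covD_of_tangent {s : EuclideanSpace ℝ (Fin n)} (hs : s ∈ U)
    (u v : EuclideanSpace ℝ (Fin n)) (w : EuclideanSpace ℝ (Fin N)) :
    covD (fun x => connCLM (christoffel G x)) (fun x => bilCLM (G x * P x)) (y s) w
      (fderiv ℝ y s u) (fderiv ℝ y s v) = 0 := by
  have hys := l.mapsTo s hs
  have dp := ((contDiffAt_lower_compl h hys).differentiableAt (by simp)).hasFDerivAt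
  have dP := ((contDiffOn_endCLM h.smooth_compl).contDiffAt
    (h.metric.isOpen.mem_nhds hys)).differentiableAt (by simp) |>.hasFDerivAt
  have hcomm := bilCLM_comm (h.symm_compl hys)
  have hid : ∀ x ∈ O, ∀ a b, bilCLM (G x * P x) (endCLM (P x) a) b = bilCLM (G x * P x) a b := by
    intro x hx a b
    rw [bilCLM_comm (h.symm_compl hx), ← bilCLM_mul, Matrix.mul_assoc, h.mul_self hx,
      bilCLM_comm (h.symm_compl hx)]
  set a := fderiv ℝ y s u
  set b := fderiv ℝ y s v
  have hl := (dp.clm_apply (dP.clm_apply (hasFDerivAt_const a _))).clm_apply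
    (hasFDerivAt_const b _)
  have hr := (dp.clm_apply (hasFDerivAt_const a _)).clm_apply (hasFDerivAt_const b _)
  have e := (hl.congr_of_eventuallyEq (Filter.eventuallyEq_of_mem
      (h.metric.isOpen.mem_nhds hys) fun z hz => (hid z hz a b).symm)).unique hr
  have e := congrArg (fun T => T w) e
  have ha : endCLM (P (y s)) a = 0 := l.normal h hs u
  have hb : ∀ z, bilCLM (G (y s) * P (y s)) z b = 0 := fun z => by
    rw [hcomm]; exact l.lower_compl_tangent h hs v z
  have ha' : ∀ z, bilCLM (G (y s) * P (y s)) a z = 0 := l.lower_compl_tangent h hs u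
  simp [ha, hb] at e
  simp only [covD, ha', hb, ← e]
  simp

/-- On tangent vectors of a leaf, the tensor `M` is `-2` times the second fundamental form. -/
theorem mForm_tangent {s : EuclideanSpace ℝ (Fin n)} (hs : s ∈ U)
    (u v : EuclideanSpace ℝ (Fin n)) (w : EuclideanSpace ℝ (Fin N)) :
    mForm G P (y s) w (fderiv ℝ y s u) (fderiv ℝ y s v)
      = -2 * bilCLM (G (y s) * P (y s)) (secondDeriv G y s u v) w := by
  have hys := l.mapsTo s hs
  have hsym : ∀ a b c, covD (fun x => connCLM (christoffel G x)) (fun x => bilCLM (G x * P x))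
      (y s) a b c = covD (fun x => connCLM (christoffel G x)) (fun x => bilCLM (G x * P x))
      (y s) a c b := by
    intro a b c
    have dp := ((contDiffAt_lower_compl h hys).differentiableAt (by simp)).hasFDerivAt
    have hl := (dp.clm_apply (hasFDerivAt_const b _)).clm_apply (hasFDerivAt_const c _)
    have hr := (dp.clm_apply (hasFDerivAt_const c _)).clm_apply (hasFDerivAt_const b _)
    have e := (hl.congr_of_eventuallyEq (Filter.eventuallyEq_of_mem
      (h.metric.isOpen.mem_nhds hys) fun z hz => bilCLM_comm (h.symm_compl hz) c b)).unique hr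
    have e := congrArg (fun T => T a) e
    simp at e
    simp only [covD, e]
    rw [bilCLM_comm (h.symm_compl hys) b, bilCLM_comm (h.symm_compl hys) _ c]
    ring
  have sK : secondDeriv G y s v u = secondDeriv G y s u v := by
    rw [secondDeriv, secondDeriv, h.metric.isLeviCivita.torsion_free _ hys,
      ((l.contDiffAt hs).isSymmSndFDerivAt minSmoothness_two_le : IsSymmSndFDerivAt ℝ y s).eq]
  rw [mForm, l.covD_of_tangent h hs, hsym _ w, hsym _ w, l.covD_tangent_tangent h hs,
    l.covD_tangent_tangent h hs, sK]
  ring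

theorem mForm_tangent_tangent {s : EuclideanSpace ℝ (Fin n)} (hs : s ∈ U)
    (u v w : EuclideanSpace ℝ (Fin n)) :
    mForm G P (y s) (fderiv ℝ y s w) (fderiv ℝ y s u) (fderiv ℝ y s v) = 0 := by
  rw [l.mForm_tangent h hs, bilCLM_comm (h.symm_compl (l.mapsTo s hs)),
    l.lower_compl_tangent h hs, mul_zero]

end IsLeafParam
end LeafConnection

/-! ### Restriction of the bi-conformal connection to the leaves -/

section LeafTraces

variable {N n : ℕ} {G P Pi : EuclideanSpace ℝ (Fin N) → Matrix (Fin N) (Fin N) ℝ}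
  {O : Set (EuclideanSpace ℝ (Fin N))} {H : EuclideanSpace ℝ (Fin n) → Matrix (Fin n) (Fin n) ℝ}
  {U : Set (EuclideanSpace ℝ (Fin n))} {y : EuclideanSpace ℝ (Fin n) → EuclideanSpace ℝ (Fin N)}

/-- A `G`-symmetric projector `Π` is determined by a frame `J` of its range:
`Π = J (Jᵀ G J)⁻¹ Jᵀ G`. -/
theorem matrix_proj_eq {G Pi : Matrix (Fin N) (Fin N) ℝ} {J : Matrix (Fin N) (Fin n) ℝ}
    {K : Matrix (Fin n) (Fin n) ℝ} (hG : G.transpose = G) (hs : (G * Pi).transpose = G * Pi)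
    (hJ : Pi * J = J) (hB : ∃ B : Matrix (Fin n) (Fin N) ℝ, Pi = J * B)
    (hK : K * (J.transpose * (G * J)) = 1) : Pi = J * (K * (J.transpose * G)) := by
  have e1 : J.transpose * G * Pi = J.transpose * G := by
    rw [Matrix.mul_assoc, ← hs, Matrix.transpose_mul, ← Matrix.mul_assoc,
      ← Matrix.transpose_mul, hJ, hG]
  obtain ⟨B, hB⟩ := hB
  calc Pi = J * (K * (J.transpose * (G * J))) * B := by rw [hK, Matrix.mul_one, hB]
    _ = J * (K * (J.transpose * G * Pi)) := by rw [hB]; simp only [Matrix.mul_assoc]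
    _ = _ := by rw [e1]

/-- The Jacobian matrix of `y` at `s`. -/
def jac (y : EuclideanSpace ℝ (Fin n) → EuclideanSpace ℝ (Fin N)) (s : EuclideanSpace ℝ (Fin n)) :
    Matrix (Fin N) (Fin n) ℝ :=
  Matrix.of fun a α => fderiv ℝ y s (stdVec α) a

theorem fderiv_apply_eq_sum_jac (s v : EuclideanSpace ℝ (Fin n)) (a : Fin N) :
    fderiv ℝ y s v a = ∑ α, jac y s a α * v α := by
  conv_lhs => rw [eq_sum_stdVec v, map_sum]
  simp [jac, mul_comm]

namespace IsLeafParam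

variable (h : IsProjectorPairOn n G P Pi O) (l : IsLeafParam G Pi O H U y)
include l

theorem jac_metric {s : EuclideanSpace ℝ (Fin n)} (hs : s ∈ U) :
    (jac y s).transpose * (G (y s) * jac y s) = H s := by
  ext α β
  rw [← bilCLM_stdVec (H s), ← l.induced s hs, bilCLM_apply]
  simp only [Matrix.mul_apply, Matrix.transpose_apply, jac, Matrix.of_apply, Finset.mul_sum]
  exact Finset.sum_congr rfl fun _ _ => Finset.sum_congr rfl fun _ _ => by ring

theorem proj_mul_jac {s : EuclideanSpace ℝ (Fin n)} (hs : s ∈ U) :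
    Pi (y s) * jac y s = jac y s := by
  ext a α
  have := congrArg (fun z : EuclideanSpace ℝ (Fin N) => z a) (l.tangent s hs (stdVec α))
  simpa [endCLM_apply, jac, Matrix.mul_apply] using this

theorem exists_proj_eq {s : EuclideanSpace ℝ (Fin n)} (hs : s ∈ U) :
    ∃ B : Matrix (Fin n) (Fin N) ℝ, Pi (y s) = jac y s * B := by
  choose v hv using fun b => l.surj s hs (stdVec b)
  refine ⟨Matrix.of fun α b => v b α, ?_⟩
  ext a b
  rw [← endCLM_stdVec (Pi (y s)) b a, hv, fderiv_apply_eq_sum_jac, Matrix.mul_apply]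
  rfl

include h

/-- The orthogonal projector onto the tangent space, in terms of the Jacobian matrix `J` of the
parametrization: `Π = J (Jᵀ G J)⁻¹ Jᵀ G`. -/
theorem proj_eq {s : EuclideanSpace ℝ (Fin n)} (hs : s ∈ U) :
    Pi (y s) = jac y s * ((H s)⁻¹ * ((jac y s).transpose * G (y s))) := by
  have hys := l.mapsTo s hs
  refine matrix_proj_eq (h.metric.transpose_eq hys) (h.symm _ hys) (l.proj_mul_jac hs)
    (l.exists_proj_eq hs) ?_
  rw [l.jac_metric hs, l.metric.inv_mul hs]

theorem raise_proj {s : EuclideanSpace ℝ (Fin n)} (hs : s ∈ U) :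
    Matrix.of (raise G Pi (y s)) = jac y s * ((H s)⁻¹ * (jac y s).transpose) := by
  rw [of_raise, l.proj_eq h hs]
  simp only [Matrix.mul_assoc]
  rw [h.metric.mul_inv (l.mapsTo s hs), Matrix.mul_one]

/-- The trace with `Π^{cb}` is the trace over the tangent space with the induced metric. -/
theorem sum_mul_raise {s : EuclideanSpace ℝ (Fin n)} (hs : s ∈ U) (T : Fin N → Fin N → ℝ) :
    ∑ c, ∑ b, T c b * raise G Pi (y s) c b = ∑ α, ∑ β, (H s)⁻¹ α β *
      ∑ c, ∑ b, T c b * (fderiv ℝ y s (stdVec α) c * fderiv ℝ y s (stdVec β) b) := by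
  have e : ∀ c b, raise G Pi (y s) c b = ∑ α, ∑ β, (H s)⁻¹ α β *
      (fderiv ℝ y s (stdVec α) c * fderiv ℝ y s (stdVec β) b) := by
    intro c b
    have := congrFun (congrFun (l.raise_proj h hs) c) b
    rw [Matrix.of_apply] at this
    simp only [this, Matrix.mul_apply, jac, Matrix.of_apply, Matrix.transpose_apply,
      Finset.mul_sum]
    exact Finset.sum_congr rfl fun _ _ => Finset.sum_congr rfl fun _ _ => by ring
  simp only [e, Finset.mul_sum]
  calc _ = ∑ c, ∑ α, ∑ b, ∑ β, T c b * ((H s)⁻¹ α β *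
        (fderiv ℝ y s (stdVec α) c * fderiv ℝ y s (stdVec β) b)) :=
        Finset.sum_congr rfl fun _ _ => Finset.sum_comm
    _ = ∑ α, ∑ c, ∑ β, ∑ b, T c b * ((H s)⁻¹ α β *
        (fderiv ℝ y s (stdVec α) c * fderiv ℝ y s (stdVec β) b)) := by
        rw [Finset.sum_comm]
        exact Finset.sum_congr rfl fun _ _ => Finset.sum_congr rfl fun _ _ => Finset.sum_comm
    _ = _ := by
        refine Finset.sum_congr rfl fun _ _ => ?_
        rw [Finset.sum_comm]
        exact Finset.sum_congr rfl fun _ _ => Finset.sum_congr rfl fun _ _ =>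
          Finset.sum_congr rfl fun _ _ => by ring

/-- The trace of the tangential part of an endomorphism that restricts to the tangent space. -/
theorem sum_proj_mul {s : EuclideanSpace ℝ (Fin n)} (hs : s ∈ U)
    {A : EuclideanSpace ℝ (Fin N) → EuclideanSpace ℝ (Fin N)} (hA : IsLinearMap ℝ A)
    {B : EuclideanSpace ℝ (Fin n) →ₗ[ℝ] EuclideanSpace ℝ (Fin n)}
    (hAB : ∀ v, A (fderiv ℝ y s v) = fderiv ℝ y s (B v)) :
    ∑ d, ∑ r, Pi (y s) d r * A (stdVec d) r = LinearMap.trace ℝ _ B := by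
  have hQ : (H s)⁻¹ * ((jac y s).transpose * G (y s)) * jac y s = 1 := by
    rw [Matrix.mul_assoc, Matrix.mul_assoc, l.jac_metric hs, l.metric.inv_mul hs]
  set Q := (H s)⁻¹ * ((jac y s).transpose * G (y s)) with hQdef
  let M : Matrix (Fin N) (Fin N) ℝ := Matrix.of fun r d => A (stdVec d) r
  let C : Matrix (Fin n) (Fin n) ℝ := Matrix.of fun r d => B (stdVec d) r
  have hMC : M * jac y s = jac y s * C := by
    ext r α
    have := congrArg (fun z : EuclideanSpace ℝ (Fin N) => z r) (hAB (stdVec α))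
    simp only [fderiv_apply_eq_sum_jac s (B (stdVec α)) r] at this
    rw [eq_sum_of_isLinearMap hA] at this
    simp only [Matrix.mul_apply, M, C, Matrix.of_apply]
    rw [← this]
    simp [jac, mul_comm]
  have e1 : ∑ d, ∑ r, Pi (y s) d r * A (stdVec d) r = (Pi (y s) * M).trace := by
    simp only [Matrix.trace, Matrix.diag_apply, Matrix.mul_apply, M, Matrix.of_apply]
  have e2 : LinearMap.trace ℝ _ B = C.trace := by
    rw [trace_eq_sum]; rfl
  rw [e1, e2, l.proj_eq h hs, Matrix.mul_assoc, Matrix.trace_mul_comm, Matrix.mul_assoc, hMC,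
    ← Matrix.mul_assoc, ← hQdef, hQ, Matrix.one_mul]

/-- The one-form `W` vanishes on the leaves, since `M` vanishes on three tangent vectors. -/
theorem tensorW_tangent {s : EuclideanSpace ℝ (Fin n)} (hs : s ∈ U)
    (u : EuclideanSpace ℝ (Fin n)) : ∑ a, tensorW G P Pi (y s) a * fderiv ℝ y s u a = 0 := by
  have e : ∑ a, tensorW G P Pi (y s) a * fderiv ℝ y s u a = -∑ c, ∑ b,
      mForm G P (y s) (fderiv ℝ y s u) (stdVec c) (stdVec b) * raise G Pi (y s) c b := by
    have : ∀ c b, mForm G P (y s) (fderiv ℝ y s u) (stdVec c) (stdVec b)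
        = ∑ a, fderiv ℝ y s u a * tensorM G P (y s) a c b := fun c b => by
      rw [eq_sum_of_isLinearMap (isLinearMap_mForm₁ _ _ _)]
      exact Finset.sum_congr rfl fun a _ => by rw [h.tensorM_eq (l.mapsTo s hs), smul_eq_mul]
    simp only [this, tensorW, neg_mul, Finset.sum_neg_distrib, Finset.sum_mul]
    rw [Finset.sum_comm]
    refine congrArg _ (Finset.sum_congr rfl fun c _ => ?_)
    rw [Finset.sum_comm]
    exact Finset.sum_congr rfl fun b _ => Finset.sum_congr rfl fun a _ => by ring
  rw [e, l.sum_mul_raise h hs]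
  simp only [bilCLM_of (t := mForm G P (y s) (fderiv ℝ y s u))
    (fun v => isLinearMap_mForm₂ _ _ _) (fun v => isLinearMap_mForm₃ _ _ _),
    l.mForm_tangent_tangent h hs]
  simp

/-- On tangent vectors of a leaf, the difference tensor of the bi-conformal connection is minus the
normal part of the second derivative. -/
theorem tensorL_tangent {s : EuclideanSpace ℝ (Fin n)} (hs : s ∈ U)
    (u v : EuclideanSpace ℝ (Fin n)) :
    connCLM (tensorL G P Pi (y s)) (fderiv ℝ y s u) (fderiv ℝ y s v)
      = -endCLM (P (y s)) (secondDeriv G y s u v) := by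
  have hys := l.mapsTo s hs
  set a := fderiv ℝ y s u with ha
  set b := fderiv ℝ y s v with hb
  set k := secondDeriv G y s u v
  have hPa : ∀ i, ∑ j, P (y s) i j * a j = 0 := fun i => by
    rw [← endCLM_apply, ha, l.normal h hs]; rfl
  have hPb : ∀ i, ∑ j, P (y s) i j * b j = 0 := fun i => by
    rw [← endCLM_apply, hb, l.normal h hs]; rfl
  have hWa : ∑ j, tensorW G P Pi (y s) j * a j = 0 := l.tensorW_tangent h hs u
  have hWb : ∑ j, tensorW G P Pi (y s) j * b j = 0 := l.tensorW_tangent h hs v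
  have prod : ∀ f g : Fin N → ℝ, ∑ i, ∑ j, f i * g j * (a i * b j)
      = (∑ i, f i * a i) * ∑ j, g j * b j := fun f g => by
    rw [Finset.sum_mul_sum]
    exact Finset.sum_congr rfl fun _ _ => Finset.sum_congr rfl fun _ _ => by ring
  have prod' : ∀ f g : Fin N → ℝ, ∑ i, ∑ j, f j * g i * (a i * b j)
      = (∑ i, g i * a i) * ∑ j, f j * b j := fun f g => by
    rw [Finset.sum_mul_sum]
    exact Finset.sum_congr rfl fun _ _ => Finset.sum_congr rfl fun _ _ => by ring
  have hM : ∀ e, ∑ i, ∑ j, tensorM G P (y s) e i j * (a i * b j)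
      = -2 * bilCLM (G (y s) * P (y s)) k (stdVec e) := fun e => by
    simp only [h.tensorM_eq hys]
    rw [bilCLM_of (t := mForm G P (y s) (stdVec e))
      (fun v => isLinearMap_mForm₂ _ _ _) (fun v => isLinearMap_mForm₃ _ _ _),
      l.mForm_tangent h hs]
  have hGM : ∀ d, ∑ e, (G (y s))⁻¹ d e * ∑ i, ∑ j, tensorM G P (y s) e i j * (a i * b j)
      = -2 * endCLM (P (y s)) k d := fun d => by
    have : ∀ e, bilCLM (G (y s) * P (y s)) k (stdVec e) = endCLM (G (y s) * P (y s)) k e :=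
      fun e => by
        rw [bilCLM_stdVec_right, endCLM_apply]
        refine Finset.sum_congr rfl fun i _ => ?_
        rw [← Matrix.transpose_apply (G (y s) * P (y s)), h.symm_compl hys]
    simp only [hM, this]
    have e2 : ∑ e, (G (y s))⁻¹ d e * (-2 * endCLM (G (y s) * P (y s)) k e)
        = -2 * endCLM (G (y s))⁻¹ (endCLM (G (y s) * P (y s)) k) d := by
      rw [endCLM_apply _ (endCLM _ _), Finset.mul_sum]
      exact Finset.sum_congr rfl fun _ _ => by ring
    rw [e2, ← endCLM_mul, ← Matrix.mul_assoc, h.metric.inv_mul hys, Matrix.one_mul]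
  ext i
  rw [connCLM_apply]
  have split : ∑ x, ∑ z, tensorL G P Pi (y s) i x z * (a x * b z) =
      1 / (2 * (P (y s)).trace) * ((∑ x, ∑ z, tensorE G P (y s) x * P (y s) i z * (a x * b z))
        + ∑ x, ∑ z, tensorE G P (y s) z * P (y s) i x * (a x * b z))
      + 1 / (2 * ((N : ℝ) - (P (y s)).trace)) *
        ((∑ x, ∑ z, tensorW G P Pi (y s) x * Pi (y s) i z * (a x * b z))
        + ∑ x, ∑ z, tensorW G P Pi (y s) z * Pi (y s) i x * (a x * b z))
      + (1 / 2) * ∑ d, (P (y s) i d - Pi (y s) i d) *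
        ∑ e, (G (y s))⁻¹ d e * ∑ x, ∑ z, tensorM G P (y s) e x z * (a x * b z) := by
    have e3 : ∀ x z, ∑ d, (P (y s) i d - Pi (y s) i d) * ∑ e, (G (y s))⁻¹ d e *
        (tensorM G P (y s) e x z * (a x * b z))
        = (∑ d, (P (y s) i d - Pi (y s) i d) * ∑ e, (G (y s))⁻¹ d e *
        tensorM G P (y s) e x z) * (a x * b z) := fun x z => by
      simp only [Finset.sum_mul, Finset.mul_sum]
      exact Finset.sum_congr rfl fun _ _ => Finset.sum_congr rfl fun _ _ => by ring
    have e4 : ∑ d, (P (y s) i d - Pi (y s) i d) *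
        ∑ e, (G (y s))⁻¹ d e * ∑ x, ∑ z, tensorM G P (y s) e x z * (a x * b z)
        = ∑ x, ∑ z, ∑ d, (P (y s) i d - Pi (y s) i d) * ∑ e, (G (y s))⁻¹ d e *
        (tensorM G P (y s) e x z * (a x * b z)) := by
      simp only [Finset.mul_sum]
      have c1 : ∀ f : Fin N → Fin N → Fin N → Fin N → ℝ,
          ∑ d, ∑ e, ∑ x, ∑ z, f d e x z = ∑ x, ∑ z, ∑ d, ∑ e, f d e x z := fun f => by
        calc _ = ∑ d, ∑ x, ∑ e, ∑ z, f d e x z :=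
              Finset.sum_congr rfl fun _ _ => Finset.sum_comm
          _ = ∑ x, ∑ d, ∑ z, ∑ e, f d e x z := by
              rw [Finset.sum_comm]
              exact Finset.sum_congr rfl fun _ _ => Finset.sum_congr rfl fun _ _ =>
                Finset.sum_comm
          _ = _ := Finset.sum_congr rfl fun _ _ => Finset.sum_comm
      exact c1 _
    obtain ⟨D, hD⟩ : ∃ D : Fin N → Fin N → ℝ, ∀ x z, ∑ d, (P (y s) i d - Pi (y s) i d) *
        ∑ e, (G (y s))⁻¹ d e * tensorM G P (y s) e x z = D x z := ⟨_, fun _ _ => rfl⟩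
    rw [e4]
    simp only [e3, tensorL, hD]
    simp only [Finset.mul_sum, ← Finset.sum_add_distrib]
    exact Finset.sum_congr rfl fun x _ => Finset.sum_congr rfl fun z _ => by ring
  rw [split, prod, prod, prod', prod', hPa, hPb, hWa, hWb]
  simp only [hGM]
  have fin : ∑ d, (P (y s) i d - Pi (y s) i d) * (-2 * endCLM (P (y s)) k d)
      = -2 * (endCLM (P (y s)) (endCLM (P (y s)) k) i
        - endCLM (Pi (y s)) (endCLM (P (y s)) k) i) := by
    rw [endCLM_apply _ (endCLM _ _), endCLM_apply (Pi (y s)) (endCLM _ _),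
      ← Finset.sum_sub_distrib, Finset.mul_sum]
    exact Finset.sum_congr rfl fun _ _ => by ring
  have hPiP : Pi (y s) * P (y s) = 0 := by
    rw [h.eq_one_sub hys, Matrix.mul_sub, h.idem _ hys, Matrix.mul_one, sub_self]
  rw [fin, ← endCLM_mul, ← endCLM_mul, h.mul_self hys, hPiP, PiLp.neg_apply,
    endCLM_apply (0 : Matrix _ _ ℝ)]
  simp

/-- The bi-conformal connection restricts to the leaves, where it is the Levi-Civita connection of
the induced metric. -/
theorem biconfConnection_tangent {s : EuclideanSpace ℝ (Fin n)} (hs : s ∈ U)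
    (u v : EuclideanSpace ℝ (Fin n)) : fderiv ℝ (fderiv ℝ y) s u v
      + connCLM (biconfConnection G P Pi (y s)) (fderiv ℝ y s u) (fderiv ℝ y s v)
      = fderiv ℝ y s (connCLM (christoffel H s) u v) := by
  have e : connCLM (biconfConnection G P Pi (y s)) (fderiv ℝ y s u) (fderiv ℝ y s v)
      = connCLM (christoffel G (y s)) (fderiv ℝ y s u) (fderiv ℝ y s v)
        + connCLM (tensorL G P Pi (y s)) (fderiv ℝ y s u) (fderiv ℝ y s v) := by
    ext c
    simp only [connCLM_apply, PiLp.add_apply, biconfConnection, add_mul, Finset.sum_add_distrib]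
  have := endCLM_add (P (y s)) (Pi (y s)) (secondDeriv G y s u v)
  rw [h.add_eq_one _ (l.mapsTo s hs), endCLM_one, l.proj_secondDeriv h hs] at this
  rw [e, l.tensorL_tangent h hs, ← add_assoc, ← sub_eq_add_neg, sub_eq_iff_eq_add', ← this]
  rfl

end IsLeafParam
end LeafTraces

/-! ### Restriction of the bi-conformal curvature and its contractions -/

section LeafCurvature

variable {N n : ℕ} {G P Pi : EuclideanSpace ℝ (Fin N) → Matrix (Fin N) (Fin N) ℝ}
  {O : Set (EuclideanSpace ℝ (Fin N))} {H : EuclideanSpace ℝ (Fin n) → Matrix (Fin n) (Fin n) ℝ}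
  {U : Set (EuclideanSpace ℝ (Fin n))} {y : EuclideanSpace ℝ (Fin n) → EuclideanSpace ℝ (Fin N)}

theorem trilinear_sum {m : ℕ}
    {f : EuclideanSpace ℝ (Fin m) → EuclideanSpace ℝ (Fin m) → EuclideanSpace ℝ (Fin m) → ℝ}
    (h1 : ∀ v w, IsLinearMap ℝ fun u => f u v w) (h2 : ∀ u w, IsLinearMap ℝ fun v => f u v w)
    (h3 : ∀ u v, IsLinearMap ℝ fun w => f u v w) (u v w : EuclideanSpace ℝ (Fin m)) :
    f u v w = ∑ a, ∑ b, ∑ c, u a * v b * w c * f (stdVec a) (stdVec b) (stdVec c) := by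
  rw [eq_sum_of_isLinearMap (h1 v w) u]
  refine Finset.sum_congr rfl fun a _ => ?_
  rw [eq_sum_of_isLinearMap (h2 (stdVec a) w) v, Finset.smul_sum]
  refine Finset.sum_congr rfl fun b _ => ?_
  rw [eq_sum_of_isLinearMap (h3 (stdVec a) (stdVec b)) w, Finset.smul_sum, Finset.smul_sum]
  exact Finset.sum_congr rfl fun c _ => by simp only [smul_eq_mul]; ring

theorem isLinearMap_contract {k : ℕ} {E : Type*} [AddCommGroup E] [Module ℝ E]
    (A : Matrix (Fin k) (Fin k) ℝ) {f : E → Fin k → EuclideanSpace ℝ (Fin k)}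
    (hf : ∀ d, IsLinearMap ℝ fun u => f u d) :
    IsLinearMap ℝ fun u => ∑ d, ∑ r, A d r * f u d r :=
  ⟨fun u v => by
    simp only [(hf _).map_add, PiLp.add_apply, mul_add, Finset.sum_add_distrib],
   fun c u => by
    simp only [(hf _).map_smul, PiLp.smul_apply, smul_eq_mul, Finset.mul_sum]
    exact Finset.sum_congr rfl fun _ _ => Finset.sum_congr rfl fun _ _ => by ring⟩

/-- The curvature of a Levi-Civita connection, as an endomorphism in the last slot, is
trace-free. -/
theorem IsLeviCivita.trace_curv₃ {E : Type*} [NormedAddCommGroup E] [NormedSpace ℝ E]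
    [FiniteDimensional ℝ E] {h : E → E →L[ℝ] E →L[ℝ] ℝ} {Γ : E → E →L[ℝ] E →L[ℝ] E} {U : Set E}
    (L : IsLeviCivita h Γ U) {x : E} (hx : x ∈ U) (u v : E) :
    LinearMap.trace ℝ E ((isLinearMap_curv₃ Γ x u v).mk' _) = 0 := by
  have e : (isLinearMap_curv₃ Γ x u v).mk' _ = curvEnd Γ x u v - curvEnd Γ x v u := by
    ext w
    have := L.curv_first_bianchi hx u v w
    rw [curv_antisymm Γ x w u v] at this
    simp only [IsLinearMap.mk'_apply, LinearMap.sub_apply]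
    change curv Γ x u v w = curv Γ x u w v - curv Γ x v w u
    linear_combination (norm := module) this
  rw [e, map_sub, L.ricci_symm hx, sub_self]

/-- The Christoffel form of the bi-conformal connection. -/
abbrev biconfForm (G P Pi : EuclideanSpace ℝ (Fin N) → Matrix (Fin N) (Fin N) ℝ)
    (x : EuclideanSpace ℝ (Fin N)) : EuclideanSpace ℝ (Fin N) →L[ℝ]
      EuclideanSpace ℝ (Fin N) →L[ℝ] EuclideanSpace ℝ (Fin N) :=
  connCLM (biconfConnection G P Pi x)

/-- The contraction `Π^d_r R̄(u, ∂_d) v^r`. -/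
def ricciForm (G P Pi : EuclideanSpace ℝ (Fin N) → Matrix (Fin N) (Fin N) ℝ)
    (x u v : EuclideanSpace ℝ (Fin N)) : ℝ :=
  ∑ d, ∑ r, Pi x d r * curv (biconfForm G P Pi) x u (stdVec d) v r

/-- The contraction `Π^r_q R̄(u, v) ∂_r^q`. -/
def traceForm (G P Pi : EuclideanSpace ℝ (Fin N) → Matrix (Fin N) (Fin N) ℝ)
    (x u v : EuclideanSpace ℝ (Fin N)) : ℝ :=
  ∑ r, ∑ q, Pi x r q * curv (biconfForm G P Pi) x u v (stdVec r) q

theorem isLinearMap_ricciForm₁ (x v : EuclideanSpace ℝ (Fin N)) :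
    IsLinearMap ℝ fun u => ricciForm G P Pi x u v :=
  isLinearMap_contract _ fun _ => isLinearMap_curv₁ _ _ _ _

theorem isLinearMap_ricciForm₂ (x u : EuclideanSpace ℝ (Fin N)) :
    IsLinearMap ℝ fun v => ricciForm G P Pi x u v :=
  isLinearMap_contract _ fun _ => isLinearMap_curv₃ _ _ _ _

theorem isLinearMap_traceForm₁ (x v : EuclideanSpace ℝ (Fin N)) :
    IsLinearMap ℝ fun u => traceForm G P Pi x u v :=
  isLinearMap_contract _ fun _ => isLinearMap_curv₁ _ _ _ _

theorem isLinearMap_traceForm₂ (x u : EuclideanSpace ℝ (Fin N)) :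
    IsLinearMap ℝ fun v => traceForm G P Pi x u v :=
  isLinearMap_contract _ fun _ => isLinearMap_curv₂ _ _ _ _

/-- The tensor `L^Π` as a bilinear function. -/
def lpiForm (G P Pi : EuclideanSpace ℝ (Fin N) → Matrix (Fin N) (Fin N) ℝ) (p : ℕ)
    (x u v : EuclideanSpace ℝ (Fin N)) : ℝ :=
  2 * (ricciForm G P Pi x u v - 1 / ((N : ℝ) - p) *
      (traceForm G P Pi x u (endCLM (Pi x) v) + traceForm G P Pi x v (endCLM (Pi x) u)
        - traceForm G P Pi x v u))
    + scalarPi G P Pi x / (1 - (N : ℝ) + p) * bilCLM (G x) u (endCLM (Pi x) v)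

theorem isLinearMap_lpiForm₁ (p : ℕ) (x v : EuclideanSpace ℝ (Fin N)) :
    IsLinearMap ℝ fun u => lpiForm G P Pi p x u v :=
  ⟨fun a b => by
    simp only [lpiForm, (isLinearMap_ricciForm₁ x _).map_add, (isLinearMap_traceForm₁ x _).map_add,
      (isLinearMap_traceForm₂ x _).map_add, map_add, add_apply]
    ring,
   fun c a => by
    simp only [lpiForm, (isLinearMap_ricciForm₁ x _).map_smul,
      (isLinearMap_traceForm₁ x _).map_smul, (isLinearMap_traceForm₂ x _).map_smul, map_smul,
      smul_apply, smul_eq_mul]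
    ring⟩

theorem isLinearMap_lpiForm₂ (p : ℕ) (x u : EuclideanSpace ℝ (Fin N)) :
    IsLinearMap ℝ fun v => lpiForm G P Pi p x u v :=
  ⟨fun a b => by
    simp only [lpiForm, (isLinearMap_ricciForm₂ x _).map_add, (isLinearMap_traceForm₁ x _).map_add,
      (isLinearMap_traceForm₂ x _).map_add, map_add]
    ring,
   fun c a => by
    simp only [lpiForm, (isLinearMap_ricciForm₂ x _).map_smul,
      (isLinearMap_traceForm₁ x _).map_smul, (isLinearMap_traceForm₂ x _).map_smul, map_smul,
      smul_eq_mul]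
    ring⟩

theorem IsProjectorPairOn.biconfCurvature_eq (h : IsProjectorPairOn n G P Pi O)
    {x : EuclideanSpace ℝ (Fin N)} (hx : x ∈ O) (a b c d : Fin N) :
    biconfCurvature G P Pi x a b c d
      = curv (biconfForm G P Pi) x (stdVec a) (stdVec b) (stdVec c) d :=
  curvature_eq_curv h.metric.isOpen h.contDiffOn_biconfConnection hx a b c d

theorem IsProjectorPairOn.tensorLPi_eq (h : IsProjectorPairOn n G P Pi O) (p : ℕ)
    {x : EuclideanSpace ℝ (Fin N)} (hx : x ∈ O) (b c : Fin N) :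
    tensorLPi G P Pi p x b c = lpiForm G P Pi p x (stdVec b) (stdVec c) := by
  have e : ∀ u c, ∑ d, ∑ r, ∑ q, Pi x d c * Pi x r q * curv (biconfForm G P Pi) x u (stdVec d)
      (stdVec r) q = traceForm G P Pi x u (endCLM (Pi x) (stdVec c)) := fun u c => by
    rw [eq_sum_of_isLinearMap (isLinearMap_traceForm₂ x u)]
    refine Finset.sum_congr rfl fun d _ => ?_
    rw [endCLM_stdVec, traceForm, smul_eq_mul, Finset.mul_sum]
    refine Finset.sum_congr rfl fun r _ => ?_
    rw [Finset.mul_sum]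
    exact Finset.sum_congr rfl fun q _ => by ring
  have e2 : lower G Pi x b c = bilCLM (G x) (stdVec b) (endCLM (Pi x) (stdVec c)) := by
    rw [← bilCLM_mul, bilCLM_stdVec, ← of_lower, Matrix.of_apply]
  simp only [tensorLPi, lpiForm, h.biconfCurvature_eq hx, e, e2]
  rfl

namespace IsLeafParam

variable (h : IsProjectorPairOn n G P Pi O) (l : IsLeafParam G Pi O H U y)
include h l

theorem differentiableAt_biconfForm {s : EuclideanSpace ℝ (Fin n)} (hs : s ∈ U) :
    DifferentiableAt ℝ (biconfForm G P Pi) (y s) :=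
  ((contDiffOn_connCLM h.contDiffOn_biconfConnection).contDiffAt
    (h.metric.isOpen.mem_nhds (l.mapsTo s hs))).differentiableAt (by simp)

/-- The bi-conformal curvature restricts to the curvature of the leaves. -/
theorem curv_tangent {s : EuclideanSpace ℝ (Fin n)} (hs : s ∈ U)
    (u v w : EuclideanSpace ℝ (Fin n)) :
    curv (biconfForm G P Pi) (y s) (fderiv ℝ y s u) (fderiv ℝ y s v) (fderiv ℝ y s w)
      = fderiv ℝ y s (curv (fun s => connCLM (christoffel H s)) s u v w) :=
  curv_related (l.contDiffAt hs)
    ((l.metric.isLeviCivita.contDiffAt_conn hs).differentiableAt (by simp))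
    (l.differentiableAt_biconfForm h hs)
    (Filter.eventually_of_mem (l.metric.isOpen.mem_nhds hs) fun _ hz =>
      l.biconfConnection_tangent h hz) u v w

theorem traceForm_tangent {s : EuclideanSpace ℝ (Fin n)} (hs : s ∈ U)
    (u v : EuclideanSpace ℝ (Fin n)) :
    traceForm G P Pi (y s) (fderiv ℝ y s u) (fderiv ℝ y s v) = 0 := by
  rw [traceForm, l.sum_proj_mul h hs (isLinearMap_curv₃ _ _ _ _)
    (B := (isLinearMap_curv₃ (fun s => connCLM (christoffel H s)) s u v).mk' _)
    (fun w => l.curv_tangent h hs u v w), l.metric.isLeviCivita.trace_curv₃ hs]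

theorem ricciForm_tangent {s : EuclideanSpace ℝ (Fin n)} (hs : s ∈ U)
    (u v : EuclideanSpace ℝ (Fin n)) :
    ricciForm G P Pi (y s) (fderiv ℝ y s u) (fderiv ℝ y s v)
      = LinearMap.trace ℝ _ (curvEnd (fun s => connCLM (christoffel H s)) s u v) := by
  rw [ricciForm, l.sum_proj_mul h hs (isLinearMap_curv₂ _ _ _ _)
    (B := curvEnd (fun s => connCLM (christoffel H s)) s u v)
    (fun w => l.curv_tangent h hs u w v)]

theorem scalarPi_eq {s : EuclideanSpace ℝ (Fin n)} (hs : s ∈ U) :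
    scalarPi G P Pi (y s) = scalComp H s := by
  have e : scalarPi G P Pi (y s) = ∑ c, ∑ b, ricciForm G P Pi (y s) (stdVec b) (stdVec c)
      * raise G Pi (y s) c b := by
    rw [scalarPi, Finset.sum_comm]
    simp only [h.biconfCurvature_eq (l.mapsTo s hs), ricciForm, Finset.sum_mul]
  rw [e, l.sum_mul_raise h hs]
  simp only [bilCLM_of (t := fun u v => ricciForm G P Pi (y s) v u)
    (fun v => isLinearMap_ricciForm₂ _ _) (fun v => isLinearMap_ricciForm₁ _ _),
    l.ricciForm_tangent h hs, ← l.metric.ricciComp_eq_trace hs]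
  rw [scalComp, Finset.sum_comm]
  exact Finset.sum_congr rfl fun _ _ => Finset.sum_congr rfl fun _ _ => mul_comm _ _

/-- On the leaves, the tensor `L^Π` is `2 (n - 2)` times the Schouten tensor of the induced
metric. -/
theorem lpiForm_tangent {p : ℕ} (hn : 3 ≤ n) (hp : (N : ℝ) - p = n)
    {s : EuclideanSpace ℝ (Fin n)} (hs : s ∈ U) (u v : EuclideanSpace ℝ (Fin n)) :
    lpiForm G P Pi p (y s) (fderiv ℝ y s u) (fderiv ℝ y s v)
      = 2 * ((n : ℝ) - 2) * bilCLM (schoutenComp H s) u v := by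
  have h3 : (3 : ℝ) ≤ n := by exact_mod_cast hn
  have h2 : (n : ℝ) - 1 ≠ 0 := by linarith
  have e1 : 1 - (N : ℝ) + p = -((n : ℝ) - 1) := by linarith
  rw [lpiForm, l.tangent s hs, l.tangent s hs, l.traceForm_tangent h hs, l.traceForm_tangent h hs,
    l.ricciForm_tangent h hs, l.induced s hs, l.scalarPi_eq h hs, e1,
    (l.metric.isSchouten hn).ricci s hs, finrank_euclideanSpace_fin]
  have e2 : LinearMap.trace ℝ _ (endCLM (schoutenEnd H s)).toLinearMap
      = scalComp H s / (2 * ((n : ℝ) - 1)) := by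
    rw [← l.metric.trace_schoutenEnd hn hs, trace_eq_sum]
    simp [Matrix.trace]
  rw [e2]
  field_simp
  ring

end IsLeafParam
end LeafCurvature

/-! ### Restriction of the tensors `T^∥(Π)` and `B^∥(Π)` -/

section LeafTensors

variable {N n : ℕ} {G P Pi : EuclideanSpace ℝ (Fin N) → Matrix (Fin N) (Fin N) ℝ}
  {O : Set (EuclideanSpace ℝ (Fin N))} {H : EuclideanSpace ℝ (Fin n) → Matrix (Fin n) (Fin n) ℝ}
  {U : Set (EuclideanSpace ℝ (Fin n))} {y : EuclideanSpace ℝ (Fin n) → EuclideanSpace ℝ (Fin N)}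

/-- The tensor `L^Π` as a field of bilinear forms. -/
abbrev lpiCLM (G P Pi : EuclideanSpace ℝ (Fin N) → Matrix (Fin N) (Fin N) ℝ) (p : ℕ)
    (x : EuclideanSpace ℝ (Fin N)) : EuclideanSpace ℝ (Fin N) →L[ℝ]
      EuclideanSpace ℝ (Fin N) →L[ℝ] ℝ :=
  bilCLM (Matrix.of (tensorLPi G P Pi p x))

/-- The endomorphism `L^Π_{bq} Π^{qd}`. -/
def lpiEnd (G P Pi : EuclideanSpace ℝ (Fin N) → Matrix (Fin N) (Fin N) ℝ) (p : ℕ)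
    (x : EuclideanSpace ℝ (Fin N)) : Matrix (Fin N) (Fin N) ℝ :=
  (Matrix.of (tensorLPi G P Pi p x) * Matrix.of (raise G Pi x)).transpose

/-- The tensor `T` as a vector-valued trilinear function. -/
def tForm (G P Pi : EuclideanSpace ℝ (Fin N) → Matrix (Fin N) (Fin N) ℝ) (p : ℕ)
    (x u v w : EuclideanSpace ℝ (Fin N)) : EuclideanSpace ℝ (Fin N) :=
  (2 : ℝ) • curv (biconfForm G P Pi) x u v w - (2 / (2 - (N : ℝ) + p)) •
    (((1 / 2 : ℝ) * (lpiCLM G P Pi p x v u - lpiCLM G P Pi p x u v)) • endCLM (Pi x) w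
      + (1 / 2 : ℝ) • (lpiCLM G P Pi p x v w • endCLM (Pi x) u
        - lpiCLM G P Pi p x u w • endCLM (Pi x) v)
      + (1 / 2 : ℝ) • (bilCLM (G x * Pi x) w v • endCLM (lpiEnd G P Pi p x) u
        - bilCLM (G x * Pi x) w u • endCLM (lpiEnd G P Pi p x) v))

theorem isLinearMap_tForm₁ (p : ℕ) (x v w : EuclideanSpace ℝ (Fin N)) :
    IsLinearMap ℝ fun u => tForm G P Pi p x u v w :=
  ⟨fun a b => by
    simp only [tForm, (isLinearMap_curv₁ _ x _ _).map_add, map_add, add_apply]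
    module,
   fun c a => by
    simp only [tForm, (isLinearMap_curv₁ _ x _ _).map_smul, map_smul, smul_apply, smul_eq_mul]
    module⟩

theorem isLinearMap_tForm₂ (p : ℕ) (x u w : EuclideanSpace ℝ (Fin N)) :
    IsLinearMap ℝ fun v => tForm G P Pi p x u v w :=
  ⟨fun a b => by
    simp only [tForm, (isLinearMap_curv₂ _ x _ _).map_add, map_add, add_apply]
    module,
   fun c a => by
    simp only [tForm, (isLinearMap_curv₂ _ x _ _).map_smul, map_smul, smul_apply, smul_eq_mul]
    module⟩

theorem isLinearMap_tForm₃ (p : ℕ) (x u v : EuclideanSpace ℝ (Fin N)) :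
    IsLinearMap ℝ fun w => tForm G P Pi p x u v w :=
  ⟨fun a b => by
    simp only [tForm, (isLinearMap_curv₃ _ x _ _).map_add, map_add, add_apply]
    module,
   fun c a => by
    simp only [tForm, (isLinearMap_curv₃ _ x _ _).map_smul, map_smul, smul_apply, smul_eq_mul]
    module⟩

theorem IsProjectorPairOn.tensorT_eq (h : IsProjectorPairOn n G P Pi O) (p : ℕ)
    {x : EuclideanSpace ℝ (Fin N)} (hx : x ∈ O) (b a c d : Fin N) :
    tensorT G P Pi p x b a c d = tForm G P Pi p x (stdVec b) (stdVec a) (stdVec c) d := by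
  have e : ∑ q, (1 / 2) * (lower G Pi x c a * tensorLPi G P Pi p x b q
      - lower G Pi x c b * tensorLPi G P Pi p x a q) * raise G Pi x q d
      = (1 / 2) * (lower G Pi x c a * lpiEnd G P Pi p x d b
        - lower G Pi x c b * lpiEnd G P Pi p x d a) := by
    simp only [lpiEnd, Matrix.transpose_apply, Matrix.mul_apply, Matrix.of_apply, Finset.mul_sum,
      ← Finset.sum_sub_distrib]
    exact Finset.sum_congr rfl fun _ _ => by ring
  rw [tensorT, e, tForm, h.biconfCurvature_eq hx, ← of_lower]
  simp only [PiLp.sub_apply, PiLp.add_apply, PiLp.smul_apply, bilCLM_stdVec, endCLM_stdVec,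
    Matrix.of_apply, smul_eq_mul]
  ring

theorem sum_endCLM_trilinear {m : ℕ} (A : Matrix (Fin m) (Fin m) ℝ)
    {f : EuclideanSpace ℝ (Fin m) → EuclideanSpace ℝ (Fin m) → EuclideanSpace ℝ (Fin m) → ℝ}
    (h1 : ∀ v w, IsLinearMap ℝ fun u => f u v w) (h2 : ∀ u w, IsLinearMap ℝ fun v => f u v w)
    (h3 : ∀ u v, IsLinearMap ℝ fun w => f u v w) (a b c : Fin m) :
    ∑ s, ∑ t, ∑ q, A s a * A t b * A q c * f (stdVec s) (stdVec t) (stdVec q)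
      = f (endCLM A (stdVec a)) (endCLM A (stdVec b)) (endCLM A (stdVec c)) := by
  rw [trilinear_sum h1 h2 h3]
  simp only [endCLM_stdVec]

theorem isLinearMap_coord {E : Type*} [AddCommGroup E] [Module ℝ E] {m : ℕ}
    {f : E → EuclideanSpace ℝ (Fin m)} (hf : IsLinearMap ℝ f) (r : Fin m) :
    IsLinearMap ℝ fun u => f u r :=
  ⟨fun u v => by rw [hf.map_add]; rfl, fun c u => by rw [hf.map_smul]; rfl⟩

theorem IsProjectorPairOn.tensorTPar_eq (h : IsProjectorPairOn n G P Pi O) (p : ℕ)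
    {x : EuclideanSpace ℝ (Fin N)} (hx : x ∈ O) (c a b d : Fin N) :
    tensorTPar G P Pi p x c a b d = endCLM (Pi x) (tForm G P Pi p x (endCLM (Pi x) (stdVec c))
      (endCLM (Pi x) (stdVec a)) (endCLM (Pi x) (stdVec b))) d := by
  rw [endCLM_apply, tensorTPar]
  refine Finset.sum_congr rfl fun r _ => ?_
  rw [← sum_endCLM_trilinear (Pi x) (f := fun u v w => tForm G P Pi p x u v w r)
    (fun v w => isLinearMap_coord (isLinearMap_tForm₁ p x v w) r)
    (fun v w => isLinearMap_coord (isLinearMap_tForm₂ p x v w) r)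
    (fun v w => isLinearMap_coord (isLinearMap_tForm₃ p x v w) r)]
  simp only [Finset.mul_sum, h.tensorT_eq p hx]
  exact Finset.sum_congr rfl fun _ _ => Finset.sum_congr rfl fun _ _ =>
    Finset.sum_congr rfl fun _ _ => by ring

theorem IsProjectorPairOn.tensorBPar_eq (h : IsProjectorPairOn n G P Pi O) (p : ℕ)
    {x : EuclideanSpace ℝ (Fin N)} (hx : x ∈ O) (a b c : Fin N) :
    tensorBPar G P Pi p x a b c = (1 / 2) *
      (covD (biconfForm G P Pi) (lpiCLM G P Pi p) x (endCLM (Pi x) (stdVec a))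
        (endCLM (Pi x) (stdVec b)) (endCLM (Pi x) (stdVec c))
      - covD (biconfForm G P Pi) (lpiCLM G P Pi p) x (endCLM (Pi x) (stdVec b))
        (endCLM (Pi x) (stdVec a)) (endCLM (Pi x) (stdVec c))) := by
  have e := fun r s q => covDeriv_eq_covD (Γ := biconfConnection G P Pi) h.metric.isOpen
    (h.contDiffOn_tensorLPi p) hx r s q
  rw [← sum_endCLM_trilinear (Pi x) (isLinearMap_covD₁ _ _ _) (isLinearMap_covD₂ _ _ _)
    (isLinearMap_covD₃ _ _ _),
    ← sum_endCLM_trilinear (Pi x) (f := fun u v w => covD (biconfForm G P Pi) (lpiCLM G P Pi p)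
      x v u w) (fun _ _ => isLinearMap_covD₂ _ _ _ _ _) (fun _ _ => isLinearMap_covD₁ _ _ _ _ _)
      (fun _ _ => isLinearMap_covD₃ _ _ _ _ _)]
  rw [tensorBPar]
  simp only [e, ← Finset.sum_sub_distrib, Finset.mul_sum]
  exact Finset.sum_congr rfl fun _ _ => Finset.sum_congr rfl fun _ _ =>
    Finset.sum_congr rfl fun _ _ => by ring

theorem covD_const_smul {E : Type*} [NormedAddCommGroup E] [NormedSpace ℝ E]
    {Γ : E → E →L[ℝ] E →L[ℝ] E} {S : E → E →L[ℝ] E →L[ℝ] ℝ} {x : E} (hS : DifferentiableAt ℝ S x)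
    (c : ℝ) (u v w : E) : covD Γ (fun x => c • S x) x u v w = c * covD Γ S x u v w := by
  have d : HasFDerivAt (fun x => c • S x) (c • fderiv ℝ S x) x := hS.hasFDerivAt.const_smul c
  rw [covD, covD, d.fderiv]
  simp only [smul_apply, smul_eq_mul]
  ring

namespace IsLeafParam

variable (h : IsProjectorPairOn n G P Pi O) (l : IsLeafParam G Pi O H U y)
include l

theorem injective {s : EuclideanSpace ℝ (Fin n)} (hs : s ∈ U) {v : EuclideanSpace ℝ (Fin n)}
    (hv : fderiv ℝ y s v = 0) : v = 0 :=
  l.metric.isLeviCivita.nondeg s hs v fun w => by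
    rw [← l.induced s hs, hv, map_zero, zero_apply]

include h

theorem lpiCLM_tangent {p : ℕ} (hn : 3 ≤ n) (hp : (N : ℝ) - p = n)
    {s : EuclideanSpace ℝ (Fin n)} (hs : s ∈ U) (u v : EuclideanSpace ℝ (Fin n)) :
    lpiCLM G P Pi p (y s) (fderiv ℝ y s u) (fderiv ℝ y s v)
      = 2 * ((n : ℝ) - 2) * bilCLM (schoutenComp H s) u v := by
  rw [← l.lpiForm_tangent h hn hp hs, lpiCLM, bilCLM_apply]
  simp only [Matrix.of_apply, h.tensorLPi_eq p (l.mapsTo s hs)]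
  exact bilCLM_of (fun _ => isLinearMap_lpiForm₁ p _ _) (fun _ => isLinearMap_lpiForm₂ p _ _) _ _

theorem lpiEnd_tangent {p : ℕ} (hn : 3 ≤ n) (hp : (N : ℝ) - p = n)
    {s : EuclideanSpace ℝ (Fin n)} (hs : s ∈ U) (u : EuclideanSpace ℝ (Fin n)) :
    endCLM (lpiEnd G P Pi p (y s)) (fderiv ℝ y s u)
      = (2 * ((n : ℝ) - 2)) • fderiv ℝ y s (endCLM (schoutenEnd H s) u) := by
  set B := Matrix.of (tensorLPi G P Pi p (y s)) with hB
  have e1 : (jac y s).transpose * (B * jac y s) = (2 * ((n : ℝ) - 2)) • schoutenComp H s := by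
    ext α β
    have := l.lpiCLM_tangent h hn hp hs (stdVec α) (stdVec β)
    rw [bilCLM_stdVec] at this
    rw [Matrix.smul_apply, smul_eq_mul, ← this, bilCLM_apply]
    simp only [Matrix.mul_apply, Matrix.transpose_apply, jac, Matrix.of_apply, Finset.mul_sum]
    exact Finset.sum_congr rfl fun _ _ => Finset.sum_congr rfl fun _ _ => by rw [hB]; simp; ring
  have hHt : ((H s)⁻¹).transpose = (H s)⁻¹ := by
    rw [Matrix.transpose_nonsing_inv, l.metric.transpose_eq hs]
  have hSt : (schoutenComp H s).transpose = schoutenComp H s := by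
    ext a b; exact l.metric.schoutenComp_symm hs b a
  have e2 : lpiEnd G P Pi p (y s) * jac y s
      = (2 * ((n : ℝ) - 2)) • (jac y s * schoutenEnd H s) := by
    have e3 : (jac y s).transpose * (B.transpose * jac y s)
        = (2 * ((n : ℝ) - 2)) • schoutenComp H s := by
      have := congrArg Matrix.transpose e1
      rwa [Matrix.transpose_mul, Matrix.transpose_mul, Matrix.transpose_transpose,
        Matrix.transpose_smul, hSt, Matrix.mul_assoc] at this
    rw [lpiEnd, l.raise_proj h hs, Matrix.transpose_mul, Matrix.transpose_mul,
      Matrix.transpose_mul, Matrix.transpose_transpose, hHt, Matrix.mul_assoc, Matrix.mul_assoc,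
      Matrix.mul_assoc, e3, Matrix.mul_smul, Matrix.mul_smul, schoutenEnd]
  have e4 : ∀ α, endCLM (lpiEnd G P Pi p (y s)) (fderiv ℝ y s (stdVec α))
      = (2 * ((n : ℝ) - 2)) • fderiv ℝ y s (endCLM (schoutenEnd H s) (stdVec α)) := by
    intro α
    ext a
    have := congrFun (congrFun e2 a) α
    rw [PiLp.smul_apply, fderiv_apply_eq_sum_jac s (endCLM _ _) a, endCLM_apply]
    simp only [endCLM_stdVec]
    simpa [Matrix.mul_apply, jac] using this
  have : (endCLM (lpiEnd G P Pi p (y s))).comp (fderiv ℝ y s)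
      = (2 * ((n : ℝ) - 2)) • (fderiv ℝ y s).comp (endCLM (schoutenEnd H s)) := clm_ext e4
  exact congrArg (fun T => T u) this

/-- On the leaves, the tensor `T` is twice the Weyl tensor of the induced metric. -/
theorem tForm_tangent {p : ℕ} (hn : 3 ≤ n) (hp : (N : ℝ) - p = n)
    {s : EuclideanSpace ℝ (Fin n)} (hs : s ∈ U) (u v z : EuclideanSpace ℝ (Fin n)) :
    tForm G P Pi p (y s) (fderiv ℝ y s u) (fderiv ℝ y s v) (fderiv ℝ y s z)
      = fderiv ℝ y s ((2 : ℝ) • (curv (fun s => connCLM (christoffel H s)) s u v z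
        - (bilCLM (schoutenComp H s) u z • v - bilCLM (schoutenComp H s) v z • u
          + bilCLM (H s) u z • endCLM (schoutenEnd H s) v
          - bilCLM (H s) v z • endCLM (schoutenEnd H s) u))) := by
  have h3 : (3 : ℝ) ≤ n := by exact_mod_cast hn
  have h2 : (n : ℝ) - 2 ≠ 0 := by linarith
  have e1 : 2 - (N : ℝ) + p = -((n : ℝ) - 2) := by linarith
  have hS : bilCLM (schoutenComp H s) v u = bilCLM (schoutenComp H s) u v :=
    (l.metric.isSchouten hn).symm s hs v u
  have hH := l.metric.isLeviCivita.symm s hs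
  rw [tForm, l.curv_tangent h hs, l.lpiCLM_tangent h hn hp hs, l.lpiCLM_tangent h hn hp hs,
    l.lpiCLM_tangent h hn hp hs, l.lpiCLM_tangent h hn hp hs, l.lpiEnd_tangent h hn hp hs,
    l.lpiEnd_tangent h hn hp hs, bilCLM_mul, bilCLM_mul, l.tangent s hs, l.tangent s hs,
    l.tangent s hs, l.induced s hs, l.induced s hs, hS, sub_self, hH z v, hH z u, e1]
  simp only [map_smul, map_sub, map_add]
  match_scalars <;> field_simp
  simp

/-- At the points of a leaf, `T^∥(Π)` vanishes iff the Weyl tensor of the leaf does. -/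
theorem tensorTPar_eq_zero_iff {p : ℕ} (hn : 3 ≤ n) (hp : (N : ℝ) - p = n)
    {s : EuclideanSpace ℝ (Fin n)} (hs : s ∈ U) :
    (∀ c a b d, tensorTPar G P Pi p (y s) c a b d = 0) ↔ WeylFreeComp H s := by
  have hys := l.mapsTo s hs
  simp only [h.tensorTPar_eq p hys]
  constructor
  · intro h0 u v z
    have h1 : ∀ u v w, endCLM (Pi (y s)) (tForm G P Pi p (y s) (endCLM (Pi (y s)) u)
        (endCLM (Pi (y s)) v) (endCLM (Pi (y s)) w)) = 0 := by
      intro u v w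
      ext d
      refine trilinear_eq_zero (stdBasis N) (f := fun u v w => endCLM (Pi (y s)) (tForm G P Pi p
        (y s) (endCLM (Pi (y s)) u) (endCLM (Pi (y s)) v) (endCLM (Pi (y s)) w)) d) ?_ ?_ ?_
        (fun a b c => by simpa using h0 a b c d) u v w
      · exact fun v w => ⟨fun a b => by
          rw [map_add, (isLinearMap_tForm₁ p _ _ _).map_add, map_add]; rfl, fun c a => by
          rw [map_smul, (isLinearMap_tForm₁ p _ _ _).map_smul, map_smul]; rfl⟩
      · exact fun v w => ⟨fun a b => by
          rw [map_add, (isLinearMap_tForm₂ p _ _ _).map_add, map_add]; rfl, fun c a => by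
          rw [map_smul, (isLinearMap_tForm₂ p _ _ _).map_smul, map_smul]; rfl⟩
      · exact fun v w => ⟨fun a b => by
          rw [map_add, (isLinearMap_tForm₃ p _ _ _).map_add, map_add]; rfl, fun c a => by
          rw [map_smul, (isLinearMap_tForm₃ p _ _ _).map_smul, map_smul]; rfl⟩
    have h2 := h1 (fderiv ℝ y s u) (fderiv ℝ y s v) (fderiv ℝ y s z)
    rw [l.tangent s hs, l.tangent s hs, l.tangent s hs, l.tForm_tangent h hn hp hs,
      l.tangent s hs] at h2
    have h3 := l.injective hs h2
    exact sub_eq_zero.1 ((smul_eq_zero.1 h3).resolve_left two_ne_zero)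
  · intro hW c a b d
    obtain ⟨u, hu⟩ := l.surj s hs (stdVec c)
    obtain ⟨v, hv⟩ := l.surj s hs (stdVec a)
    obtain ⟨w, hw⟩ := l.surj s hs (stdVec b)
    rw [hu, hv, hw, l.tForm_tangent h hn hp hs, hW u v w, sub_self, smul_zero, map_zero, map_zero]
    rfl

/-- At the points of a leaf, `B^∥(Π)` vanishes iff the Cotton tensor of the leaf does. -/
theorem tensorBPar_eq_zero_iff {p : ℕ} (hn : 3 ≤ n) (hp : (N : ℝ) - p = n)
    {s : EuclideanSpace ℝ (Fin n)} (hs : s ∈ U) :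
    (∀ a b c, tensorBPar G P Pi p (y s) a b c = 0) ↔ CottonFreeComp H s := by
  have hys := l.mapsTo s hs
  have h3 : (3 : ℝ) ≤ n := by exact_mod_cast hn
  have h2 : 2 * ((n : ℝ) - 2) ≠ 0 := by linarith
  have dS : DifferentiableAt ℝ (fun s => bilCLM (schoutenComp H s)) s :=
    (((l.metric.isSchouten hn).smooth_form).contDiffAt (l.metric.isOpen.mem_nhds hs)
      ).differentiableAt (by simp)
  have dL : DifferentiableAt ℝ (lpiCLM G P Pi p) (y s) :=
    ((contDiffOn_bilCLM (B := fun x => Matrix.of (tensorLPi G P Pi p x))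
      (h.contDiffOn_tensorLPi p)).contDiffAt (h.metric.isOpen.mem_nhds hys)).differentiableAt
      (by simp)
  have e : ∀ u v w, covD (biconfForm G P Pi) (lpiCLM G P Pi p) (y s) (fderiv ℝ y s u)
      (fderiv ℝ y s v) (fderiv ℝ y s w) = 2 * ((n : ℝ) - 2) *
        covD (fun s => connCLM (christoffel H s)) (fun s => bilCLM (schoutenComp H s)) s u v w := by
    intro u v w
    have dcS : DifferentiableAt ℝ (fun s => (2 * ((n : ℝ) - 2)) • bilCLM (schoutenComp H s)) s :=
      dS.fun_const_smul _
    rw [← covD_const_smul dS]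
    exact covD_related (Γ := fun s => connCLM (christoffel H s)) (Γ' := biconfForm G P Pi)
      (S := fun s => (2 * ((n : ℝ) - 2)) • bilCLM (schoutenComp H s)) (S' := lpiCLM G P Pi p)
      (l.contDiffAt hs) dcS dL (l.biconfConnection_tangent h hs)
      (Filter.eventually_of_mem (l.metric.isOpen.mem_nhds hs) fun _ hz u v =>
        l.lpiCLM_tangent h hn hp hz u v) u v w
  simp only [h.tensorBPar_eq p hys]
  constructor
  · intro h0 u v z
    have h1 : ∀ u v w, covD (biconfForm G P Pi) (lpiCLM G P Pi p) (y s) (endCLM (Pi (y s)) u)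
        (endCLM (Pi (y s)) v) (endCLM (Pi (y s)) w)
        - covD (biconfForm G P Pi) (lpiCLM G P Pi p) (y s) (endCLM (Pi (y s)) v)
        (endCLM (Pi (y s)) u) (endCLM (Pi (y s)) w) = 0 := by
      refine trilinear_eq_zero (stdBasis N) ?_ ?_ ?_ (fun a b c => by
        simpa [sub_eq_zero] using h0 a b c)
      · exact fun v w => ⟨fun a b => by
          rw [map_add, (isLinearMap_covD₁ _ _ _ _ _).map_add,
            (isLinearMap_covD₂ _ _ _ _ _).map_add]; ring, fun c a => by
          rw [map_smul, (isLinearMap_covD₁ _ _ _ _ _).map_smul,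
            (isLinearMap_covD₂ _ _ _ _ _).map_smul, smul_sub]⟩
      · exact fun v w => ⟨fun a b => by
          rw [map_add, (isLinearMap_covD₁ _ _ _ _ _).map_add,
            (isLinearMap_covD₂ _ _ _ _ _).map_add]; ring, fun c a => by
          rw [map_smul, (isLinearMap_covD₁ _ _ _ _ _).map_smul,
            (isLinearMap_covD₂ _ _ _ _ _).map_smul, smul_sub]⟩
      · exact fun v w => ⟨fun a b => by
          rw [map_add, (isLinearMap_covD₃ _ _ _ _ _).map_add,
            (isLinearMap_covD₃ _ _ _ _ _).map_add]; ring, fun c a => by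
          rw [map_smul, (isLinearMap_covD₃ _ _ _ _ _).map_smul,
            (isLinearMap_covD₃ _ _ _ _ _).map_smul, smul_sub]⟩
    have h4 := h1 (fderiv ℝ y s u) (fderiv ℝ y s v) (fderiv ℝ y s z)
    rw [l.tangent s hs, l.tangent s hs, l.tangent s hs, e, e, ← mul_sub] at h4
    exact sub_eq_zero.1 ((mul_eq_zero.1 h4).resolve_left h2)
  · intro hC a b c
    obtain ⟨u, hu⟩ := l.surj s hs (stdVec a)
    obtain ⟨v, hv⟩ := l.surj s hs (stdVec b)
    obtain ⟨w, hw⟩ := l.surj s hs (stdVec c)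
    rw [hu, hv, hw, e, e, hC u v w, sub_self, mul_zero]

end IsLeafParam
end LeafTensors

/-! ### Tensor components in the charts of a manifold -/

section ChartLayer

variable {m : ℕ} {M : Type*} [TopologicalSpace M] [ChartedSpace (EuclideanSpace ℝ (Fin m)) M]
  {φ : OpenPartialHomeomorph M (EuclideanSpace ℝ (Fin m))}

theorem mdifferentiable_of_mem_maximalAtlas (hφ : φ ∈ IsManifold.maximalAtlas (𝓡 m) ∞ M) :
    φ.MDifferentiable (𝓡 m) (𝓡 m) :=
  ⟨(contMDiffOn_of_mem_maximalAtlas hφ).mdifferentiableOn (by simp),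
    (contMDiffOn_symm_of_mem_maximalAtlas hφ).mdifferentiableOn (by simp)⟩

/-- The differential of the chart `φ` at the point `x`. -/
def chartDiff (φ : OpenPartialHomeomorph M (EuclideanSpace ℝ (Fin m))) (x : M) :
    TangentSpace (𝓡 m) x →L[ℝ] EuclideanSpace ℝ (Fin m) :=
  mfderiv (𝓡 m) (𝓡 m) φ x

/-- The differential of the inverse of the chart `φ` at the point with coordinates `y`. -/
def chartSymmDiff (φ : OpenPartialHomeomorph M (EuclideanSpace ℝ (Fin m)))
    (y : EuclideanSpace ℝ (Fin m)) : EuclideanSpace ℝ (Fin m) →L[ℝ] TangentSpace (𝓡 m) (φ.symm y) :=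
  mfderiv (𝓡 m) (𝓡 m) φ.symm y

theorem chartSymmDiff_chartDiff (hφ : φ ∈ IsManifold.maximalAtlas (𝓡 m) ∞ M)
    {y : EuclideanSpace ℝ (Fin m)} (hy : y ∈ φ.target) (u : TangentSpace (𝓡 m) (φ.symm y)) :
    chartSymmDiff φ y (chartDiff φ (φ.symm y) u) = u := by
  have := (mdifferentiable_of_mem_maximalAtlas hφ).symm_comp_deriv (φ.map_target hy)
  rw [φ.right_inv hy] at this
  exact congrArg (fun T => T u) this

theorem chartDiff_chartSymmDiff (hφ : φ ∈ IsManifold.maximalAtlas (𝓡 m) ∞ M)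
    {y : EuclideanSpace ℝ (Fin m)} (hy : y ∈ φ.target) (u : EuclideanSpace ℝ (Fin m)) :
    chartDiff φ (φ.symm y) (chartSymmDiff φ y u) = u :=
  congrArg (fun T => T u) ((mdifferentiable_of_mem_maximalAtlas hφ).comp_symm_deriv hy)

omit [ChartedSpace (EuclideanSpace ℝ (Fin m)) M] in
theorem exists_target_eq {x : M} (hx : x ∈ φ.source) : ∃ y ∈ φ.target, φ.symm y = x :=
  ⟨φ x, φ.map_source hx, φ.left_inv hx⟩

theorem chartDiff_surjective (hφ : φ ∈ IsManifold.maximalAtlas (𝓡 m) ∞ M) {x : M}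
    (hx : x ∈ φ.source) (w : EuclideanSpace ℝ (Fin m)) : ∃ u, chartDiff φ x u = w := by
  obtain ⟨y, hy, rfl⟩ := exists_target_eq hx
  exact ⟨_, chartDiff_chartSymmDiff hφ hy w⟩

theorem chartSymmDiff_surjective (hφ : φ ∈ IsManifold.maximalAtlas (𝓡 m) ∞ M)
    {y : EuclideanSpace ℝ (Fin m)} (hy : y ∈ φ.target) (w : TangentSpace (𝓡 m) (φ.symm y)) :
    ∃ u, chartSymmDiff φ y u = w :=
  ⟨_, chartSymmDiff_chartDiff hφ hy w⟩

theorem bilCLM_formComp_of_isLinearMap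
    {h : ∀ x : M, TangentSpace (𝓡 m) x → TangentSpace (𝓡 m) x → ℝ}
    (h1 : ∀ x v, IsLinearMap ℝ fun u => h x u v) (h2 : ∀ x u, IsLinearMap ℝ fun v => h x u v)
    (y u v : EuclideanSpace ℝ (Fin m)) : bilCLM (formComp φ h y) u v
      = h (φ.symm y) (chartSymmDiff φ y u) (chartSymmDiff φ y v) := by
  rw [bilCLM_apply]
  refine bilCLM_of (t := fun u v => h (φ.symm y) (chartSymmDiff φ y u) (chartSymmDiff φ y v))
    (fun v => ⟨fun a b => ?_, fun c a => ?_⟩) (fun u => ⟨fun a b => ?_, fun c a => ?_⟩) u v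
  · rw [map_add, (h1 _ _).map_add]
  · rw [map_smul, (h1 _ _).map_smul]
  · rw [map_add, (h2 _ _).map_add]
  · rw [map_smul, (h2 _ _).map_smul]

theorem bilCLM_formComp (h : ∀ x : M, TangentSpace (𝓡 m) x →L[ℝ] TangentSpace (𝓡 m) x →L[ℝ] ℝ)
    (y u v : EuclideanSpace ℝ (Fin m)) : bilCLM (formComp φ (fun x u v => h x u v) y) u v
      = h (φ.symm y) (chartSymmDiff φ y u) (chartSymmDiff φ y v) :=
  bilCLM_formComp_of_isLinearMap
    (fun x v => ⟨fun a b => by rw [map_add, add_apply], fun c a => by rw [map_smul, smul_apply]⟩)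
    (fun x u => ⟨fun a b => by rw [map_add], fun c a => by rw [map_smul]⟩) y u v

theorem bilCLM_formComp_chartDiff (hφ : φ ∈ IsManifold.maximalAtlas (𝓡 m) ∞ M)
    (h : ∀ x : M, TangentSpace (𝓡 m) x →L[ℝ] TangentSpace (𝓡 m) x →L[ℝ] ℝ)
    {x : M} (hx : x ∈ φ.source) (u v : TangentSpace (𝓡 m) x) :
    bilCLM (formComp φ (fun x u v => h x u v) (φ x)) (chartDiff φ x u) (chartDiff φ x v)
      = h x u v := by
  obtain ⟨y, hy, rfl⟩ := exists_target_eq hx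
  rw [φ.right_inv hy, bilCLM_formComp, chartSymmDiff_chartDiff hφ hy,
    chartSymmDiff_chartDiff hφ hy]

theorem endCLM_endComp (A : ∀ x : M, TangentSpace (𝓡 m) x →ₗ[ℝ] TangentSpace (𝓡 m) x)
    (y u : EuclideanSpace ℝ (Fin m)) :
    endCLM (endComp φ A y) u = chartDiff φ (φ.symm y) (A (φ.symm y) (chartSymmDiff φ y u)) := by
  have hlin : IsLinearMap ℝ fun u =>
      chartDiff φ (φ.symm y) (A (φ.symm y) (chartSymmDiff φ y u)) :=
    ⟨fun a b => by rw [map_add, map_add, map_add], fun c a => by rw [map_smul, map_smul, map_smul]⟩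
  rw [eq_sum_of_isLinearMap hlin]
  ext c
  rw [endCLM_apply]
  simp only [WithLp.ofLp_sum, Finset.sum_apply, PiLp.smul_apply, smul_eq_mul]
  exact Finset.sum_congr rfl fun a _ => mul_comm _ _

theorem endCLM_endComp_chartDiff (hφ : φ ∈ IsManifold.maximalAtlas (𝓡 m) ∞ M)
    (A : ∀ x : M, TangentSpace (𝓡 m) x →ₗ[ℝ] TangentSpace (𝓡 m) x)
    {x : M} (hx : x ∈ φ.source) (u : TangentSpace (𝓡 m) x) :
    endCLM (endComp φ A (φ x)) (chartDiff φ x u) = chartDiff φ x (A x u) := by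
  obtain ⟨y, hy, rfl⟩ := exists_target_eq hx
  rw [φ.right_inv hy, endCLM_endComp, chartSymmDiff_chartDiff hφ hy]

theorem matrix_eq_of_endCLM_eq {A B : Matrix (Fin m) (Fin m) ℝ}
    (h : ∀ u, endCLM A u = endCLM B u) : A = B := by
  ext c a
  rw [← endCLM_stdVec A, h, endCLM_stdVec]

theorem endComp_mul (hφ : φ ∈ IsManifold.maximalAtlas (𝓡 m) ∞ M)
    (A B : ∀ x : M, TangentSpace (𝓡 m) x →ₗ[ℝ] TangentSpace (𝓡 m) x)
    {y : EuclideanSpace ℝ (Fin m)} (hy : y ∈ φ.target) :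
    endComp φ A y * endComp φ B y = endComp φ (fun x => A x ∘ₗ B x) y := by
  refine matrix_eq_of_endCLM_eq fun u => ?_
  rw [endCLM_mul, endCLM_endComp, endCLM_endComp, endCLM_endComp, chartSymmDiff_chartDiff hφ hy]
  rfl

theorem det_ne_zero_of_nondegenerate {B : Matrix (Fin m) (Fin m) ℝ}
    (h : ∀ u, (∀ v, bilCLM B u v = 0) → u = 0) : B.det ≠ 0 := by
  intro h0
  obtain ⟨u, hu, hu0⟩ := Matrix.exists_vecMul_eq_zero_iff.2 h0
  refine hu ?_
  have := h (WithLp.toLp 2 u) fun v => by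
    rw [bilCLM_apply, Finset.sum_comm]
    refine Finset.sum_eq_zero fun b _ => ?_
    have := congrFun hu0 b
    simp only [Matrix.vecMul, dotProduct, Pi.zero_apply] at this
    calc ∑ a, B a b * (u a * v b) = (∑ a, u a * B a b) * v b := by
          rw [Finset.sum_mul]; exact Finset.sum_congr rfl fun _ _ => by ring
      _ = 0 := by rw [this, zero_mul]
  funext a
  exact congrArg (fun z : EuclideanSpace ℝ (Fin m) => z a) this

variable [IsManifold (𝓡 m) ∞ M]

theorem contMDiffOn_coordVec (hφ : φ ∈ IsManifold.maximalAtlas (𝓡 m) ∞ M) (a : Fin m) :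
    ContMDiffOn (𝓡 m) (𝓡 m).tangent ∞
      (fun y => (⟨φ.symm y, coordVec φ y a⟩ : TangentBundle (𝓡 m) M)) φ.target := by
  have h1 := (contMDiffOn_symm_of_mem_maximalAtlas hφ).contMDiffOn_tangentMapWithin
    (m := ∞) (by simp) φ.open_target.uniqueMDiffOn
  have h2 : ContMDiffOn (𝓡 m) (𝓡 m).tangent ∞ (fun y : EuclideanSpace ℝ (Fin m) =>
      (⟨y, stdVec a⟩ : TangentBundle (𝓡 m) (EuclideanSpace ℝ (Fin m)))) φ.target :=
    contMDiffOn_vectorSpace_iff_contDiffOn.2 contDiffOn_const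
  refine (h1.comp h2 fun y hy => hy).congr fun y hy => ?_
  simp only [Function.comp_apply, tangentMapWithin]
  rw [mfderivWithin_of_isOpen φ.open_target hy]
  rfl

/-- The components in a chart of a smooth vector field are smooth. -/
theorem contDiffOn_chartDiff (hφ : φ ∈ IsManifold.maximalAtlas (𝓡 m) ∞ M) {W : Set M}
    {X : ∀ x : M, TangentSpace (𝓡 m) x}
    (hX : ContMDiffOn (𝓡 m) (𝓡 m).tangent ∞ (fun x => (⟨x, X x⟩ : TangentBundle (𝓡 m) M)) W) :
    ContDiffOn ℝ ∞ (fun y => chartDiff φ (φ.symm y) (X (φ.symm y)))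
      (φ.target ∩ φ.symm ⁻¹' W) := by
  have h1 := (contMDiffOn_of_mem_maximalAtlas hφ).contMDiffOn_tangentMapWithin
    (m := ∞) (by simp) φ.open_source.uniqueMDiffOn
  have h2 : ContMDiffOn (𝓡 m) (𝓡 m).tangent ∞
      (fun y => (⟨φ.symm y, X (φ.symm y)⟩ : TangentBundle (𝓡 m) M)) (φ.target ∩ φ.symm ⁻¹' W) :=
    hX.comp ((contMDiffOn_symm_of_mem_maximalAtlas hφ).mono Set.inter_subset_left)
      fun y hy => hy.2
  refine contMDiffOn_vectorSpace_iff_contDiffOn.1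
    ((h1.comp h2 fun y hy => φ.map_target hy.1).congr fun y hy => ?_)
  simp only [Function.comp_apply, tangentMapWithin]
  rw [mfderivWithin_of_isOpen φ.open_source (φ.map_target hy.1)]
  rw [φ.right_inv hy.1]
  rfl

end ChartLayer

/-! ### Metrics and foliations in charts -/

section FoliationLayer

variable {N p : ℕ} {V : Type*} [TopologicalSpace V]
  [ChartedSpace (EuclideanSpace ℝ (Fin N)) V] [IsManifold (𝓡 N) ∞ V]
  {g : PseudoRiemannianMetric N V} {F : Foliation N p V}
  {P Pi : ∀ x : V, TangentSpace (𝓡 N) x →ₗ[ℝ] TangentSpace (𝓡 N) x}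
  {φ : OpenPartialHomeomorph V (EuclideanSpace ℝ (Fin N))}

theorem PseudoRiemannianMetric.isMetricOn (g : PseudoRiemannianMetric N V)
    (hφ : φ ∈ IsManifold.maximalAtlas (𝓡 N) ∞ V) :
    IsMetricOn (formComp φ (fun x u v => g.form x u v)) φ.target where
  isOpen := φ.open_target
  smooth a b := by
    intro y hy
    have h1 : ContMDiffWithinAt (𝓡 N) ((𝓡 N).prod 𝓘(ℝ)) ∞
        (fun y => TotalSpace.mk' ℝ (E := Bundle.Trivial V ℝ) (φ.symm y)
          (g.form (φ.symm y) (coordVec φ y a) (coordVec φ y b))) φ.target y := by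
      apply ContMDiffWithinAt.clm_bundle_apply₂ (F₁ := EuclideanSpace ℝ (Fin N))
        (F₂ := EuclideanSpace ℝ (Fin N))
      · exact g.contMDiff.contMDiffAt.comp_contMDiffWithinAt y
          (contMDiffOn_symm_of_mem_maximalAtlas hφ y hy)
      · exact contMDiffOn_coordVec hφ a y hy
      · exact contMDiffOn_coordVec hφ b y hy
    simp only [contMDiffWithinAt_totalSpace] at h1
    exact h1.2.contDiffWithinAt
  det_ne_zero y hy := by
    refine det_ne_zero_of_nondegenerate fun u hu => ?_
    have h0 : chartSymmDiff φ y u = 0 := g.nondegenerate _ _ fun w => by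
      obtain ⟨v, rfl⟩ := chartSymmDiff_surjective hφ hy w
      rw [← bilCLM_formComp]
      exact hu v
    rw [← chartDiff_chartSymmDiff hφ hy u, h0, map_zero]
  symm y _ a b := g.symm _ _ _

namespace Foliation

/-- The differential of the inclusion of a leaf. -/
def leafDiff (F : Foliation N p V) (i : F.ι) (z : F.Leaf i) :
    TangentSpace (𝓡 (N - p)) z →L[ℝ] TangentSpace (𝓡 N) (F.incl i z) :=
  mfderiv (𝓡 (N - p)) (𝓡 N) (F.incl i) z

theorem exists_incl_eq (F : Foliation N p V) (x : V) : ∃ i, ∃ z : F.Leaf i, F.incl i z = x := by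
  have : x ∈ ⋃ i, Set.range (F.incl i) := by rw [F.cover]; trivial
  simpa using this

theorem leafDiff_mem_dist (F : Foliation N p V) (i : F.ι) (z : F.Leaf i)
    (u : TangentSpace (𝓡 (N - p)) z) : F.leafDiff i z u ∈ F.dist (F.incl i z) := by
  rw [F.dist_incl]
  exact ⟨u, rfl⟩

theorem exists_leafDiff_eq {i : F.ι} {z : F.Leaf i} {w : TangentSpace (𝓡 N) (F.incl i z)}
    (hw : w ∈ F.dist (F.incl i z)) : ∃ u, F.leafDiff i z u = w := by
  rw [F.dist_incl] at hw
  exact hw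

theorem IsNondegenerate.leafDiff_injective (hF : F.IsNondegenerate g) (i : F.ι) (z : F.Leaf i) :
    Function.Injective (F.leafDiff i z) :=
  (injective_iff_map_eq_zero _).2 fun u hu => hF i z u fun w => by
    change g.form _ (F.leafDiff i z u) _ = 0
    rw [hu, map_zero, zero_apply]

theorem IsNondegenerate.finrank_dist (hF : F.IsNondegenerate g) (x : V) :
    finrank ℝ (F.dist x) = N - p := by
  obtain ⟨i, z, rfl⟩ := F.exists_incl_eq x
  rw [F.dist_incl]
  have := LinearMap.finrank_range_of_inj (f := (F.leafDiff i z).toLinearMap)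
    (hF.leafDiff_injective i z)
  exact this.trans finrank_euclideanSpace_fin

theorem IsNondegenerate.eq_zero_of_mem_dist (hF : F.IsNondegenerate g) {x : V}
    {w : TangentSpace (𝓡 N) x} (hw : w ∈ F.dist x) (h : ∀ w' ∈ F.dist x, g.form x w w' = 0) :
    w = 0 := by
  obtain ⟨i, z, rfl⟩ := F.exists_incl_eq x
  obtain ⟨u, rfl⟩ := exists_leafDiff_eq hw
  have : u = 0 := hF i z u fun v => h _ (F.leafDiff_mem_dist i z v)
  rw [this, map_zero]

theorem IsProjectorPair.proj_of_mem (h : F.IsProjectorPair g P Pi) {x : V}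
    {w : TangentSpace (𝓡 N) x} (hw : w ∈ F.dist x) : Pi x w = w := by
  rw [← h.range_Pi x] at hw
  obtain ⟨u, rfl⟩ := hw
  exact congrArg (fun T => T u) (h.Pi_idem x)

theorem IsProjectorPair.proj_mem (h : F.IsProjectorPair g P Pi) (x : V)
    (w : TangentSpace (𝓡 N) x) : Pi x w ∈ F.dist x := by
  rw [← h.range_Pi x]
  exact ⟨w, rfl⟩

theorem IsProjectorPair.form_proj (h : F.IsProjectorPair g P Pi) (x : V)
    (u v : TangentSpace (𝓡 N) x) : g.form x u (Pi x v) = g.form x (Pi x u) (Pi x v) := by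
  have h1 : P x u + Pi x u = u := congrArg (fun T => T u) (h.add_eq_id x)
  have h2 : g.form x (P x u) (Pi x v) = 0 :=
    (h.mem_range_P x (P x u)).1 ⟨u, rfl⟩ _ (h.proj_mem x v)
  conv_lhs => rw [← h1, map_add, add_apply, h2, zero_add]

end Foliation
end FoliationLayer

/-! ### Smoothness of the projectors of a foliation -/

section FoliationProjectors

variable {N p : ℕ} {V : Type*} [TopologicalSpace V]
  [ChartedSpace (EuclideanSpace ℝ (Fin N)) V] [IsManifold (𝓡 N) ∞ V]
  {g : PseudoRiemannianMetric N V} {F : Foliation N p V}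
  {P Pi : ∀ x : V, TangentSpace (𝓡 N) x →ₗ[ℝ] TangentSpace (𝓡 N) x}
  {φ : OpenPartialHomeomorph V (EuclideanSpace ℝ (Fin N))}

namespace Foliation

/-- In a chart, the distribution of a foliation has a smooth local frame, given here by the columns
of a matrix-valued function. -/
theorem IsProjectorPair.exists_frame (hF : F.IsNondegenerate g) (h : F.IsProjectorPair g P Pi)
    (hφ : φ ∈ IsManifold.maximalAtlas (𝓡 N) ∞ V) {y₀ : EuclideanSpace ℝ (Fin N)}
    (hy₀ : y₀ ∈ φ.target) : ∃ W, IsOpen W ∧ y₀ ∈ W ∧ W ⊆ φ.target ∧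
      ∃ J : EuclideanSpace ℝ (Fin N) → Matrix (Fin N) (Fin (N - p)) ℝ,
        (∀ a k, ContDiffOn ℝ ∞ (fun y => J y a k) W) ∧ ∀ y ∈ W,
          endComp φ Pi y * J y = J y ∧ (∃ B : Matrix (Fin (N - p)) (Fin N) ℝ,
            endComp φ Pi y = J y * B) ∧
          ((J y).transpose * (formComp φ (fun x u v => g.form x u v) y * J y)).det ≠ 0 := by
  obtain ⟨U, hU, hyU, X, hX, hspan⟩ := F.smooth_dist (φ.symm y₀)
  let Jc : Fin (N - p) → EuclideanSpace ℝ (Fin N) → EuclideanSpace ℝ (Fin N) := fun k y =>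
    chartDiff φ (φ.symm y) (X k (φ.symm y))
  refine ⟨φ.target ∩ φ.symm ⁻¹' U, φ.isOpen_inter_preimage_symm hU, ⟨hy₀, hyU⟩,
    Set.inter_subset_left, fun y => Matrix.of fun a k => Jc k y a, fun a k => ?_,
    fun y hy => ?_⟩
  · exact (EuclideanSpace.proj (𝕜 := ℝ) a :
      EuclideanSpace ℝ (Fin N) →L[ℝ] ℝ).contDiff.comp_contDiffOn (contDiffOn_chartDiff hφ (hX k))
  have hXmem : ∀ k, X k (φ.symm y) ∈ F.dist (φ.symm y) := fun k => by
    rw [← hspan _ hy.2]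
    exact Submodule.subset_span ⟨k, rfl⟩
  have hsum : ∀ c : Fin (N - p) → ℝ, ∑ k, c k • Jc k y
      = chartDiff φ (φ.symm y) (∑ k, c k • X k (φ.symm y)) := fun c => by
    rw [map_sum]
    exact Finset.sum_congr rfl fun k _ => by rw [map_smul]
  refine ⟨?_, ?_, ?_⟩
  · ext a k
    have : endCLM (endComp φ Pi y) (Jc k y) = Jc k y := by
      rw [endCLM_endComp, chartSymmDiff_chartDiff hφ hy.1, h.proj_of_mem (hXmem k)]
    have := congrArg (fun z : EuclideanSpace ℝ (Fin N) => z a) this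
    simp only [endCLM_apply] at this
    exact this
  · have hmem : ∀ b, ∃ c : Fin (N - p) → ℝ, ∑ k, c k • X k (φ.symm y)
        = Pi (φ.symm y) (chartSymmDiff φ y (stdVec b)) := fun b =>
      (Submodule.mem_span_range_iff_exists_fun ℝ).1 (by
        rw [hspan _ hy.2]; exact h.proj_mem _ _)
    choose c hc using hmem
    refine ⟨Matrix.of fun k b => c b k, ?_⟩
    ext a b
    rw [← endCLM_stdVec (endComp φ Pi y) b a, endCLM_endComp, ← hc b, ← hsum, Matrix.mul_apply]
    simp [mul_comm]
  · intro hdet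
    obtain ⟨c, hc, hc0⟩ := Matrix.exists_mulVec_eq_zero_iff.2 hdet
    have hK : ∀ j k, ((Matrix.of fun a k => Jc k y a).transpose *
        (formComp φ (fun x u v => g.form x u v) y * Matrix.of fun a k => Jc k y a)) j k
        = g.form (φ.symm y) (X j (φ.symm y)) (X k (φ.symm y)) := by
      intro j k
      rw [← chartSymmDiff_chartDiff hφ hy.1 (X j (φ.symm y)),
        ← chartSymmDiff_chartDiff hφ hy.1 (X k (φ.symm y)), ← bilCLM_formComp, bilCLM_apply]
      simp only [Matrix.mul_apply, Matrix.transpose_apply, Matrix.of_apply, Finset.mul_sum]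
      exact Finset.sum_congr rfl fun _ _ => Finset.sum_congr rfl fun _ _ => by
        simp only [Jc]; ring
    have hw : ∑ k, c k • X k (φ.symm y) = 0 := by
      refine hF.eq_zero_of_mem_dist (Submodule.sum_mem _ fun k _ =>
        Submodule.smul_mem _ _ (hXmem k)) fun w' hw' => ?_
      rw [← hspan _ hy.2] at hw'
      obtain ⟨d, rfl⟩ := (Submodule.mem_span_range_iff_exists_fun ℝ).1 hw'
      rw [map_sum]
      refine Finset.sum_eq_zero fun j _ => ?_
      have := congrFun hc0 j
      simp only [Matrix.mulVec, dotProduct, hK] at this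
      rw [map_smul, g.symm, map_sum]
      have e : ∑ k, g.form (φ.symm y) (X j (φ.symm y)) (c k • X k (φ.symm y)) = 0 := by
        refine Eq.trans ?_ this
        exact Finset.sum_congr rfl fun k _ => by rw [map_smul, smul_eq_mul, mul_comm]
      rw [e, smul_zero]
    have hli : LinearIndependent ℝ fun k => X k (φ.symm y) := by
      rw [linearIndependent_iff_card_eq_finrank_span, Set.finrank, hspan _ hy.2,
        hF.finrank_dist, Fintype.card_fin]
    exact hc (funext fun k => Fintype.linearIndependent_iff.1 hli c hw k)

/-- The components of the projectors of a foliation in a chart. They are smooth, since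
`Π = J (Jᵀ G J)⁻¹ Jᵀ G` for a smooth local frame `J`. -/
theorem IsProjectorPair.isProjectorPairOn (hF : F.IsNondegenerate g)
    (h : F.IsProjectorPair g P Pi) (hφ : φ ∈ IsManifold.maximalAtlas (𝓡 N) ∞ V) :
    IsProjectorPairOn (N - p) (formComp φ (fun x u v => g.form x u v)) (endComp φ P)
      (endComp φ Pi) φ.target := by
  have hG := g.isMetricOn hφ
  have hsymm : ∀ y ∈ φ.target, (formComp φ (fun x u v => g.form x u v) y
      * endComp φ Pi y).transpose = formComp φ (fun x u v => g.form x u v) y * endComp φ Pi y := by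
    intro y hy
    have e : ∀ a b, (formComp φ (fun x u v => g.form x u v) y * endComp φ Pi y) a b
        = g.form (φ.symm y) (Pi (φ.symm y) (chartSymmDiff φ y (stdVec a)))
          (Pi (φ.symm y) (chartSymmDiff φ y (stdVec b))) := fun a b => by
      rw [← bilCLM_stdVec (_ * _) a b, bilCLM_mul, bilCLM_formComp, endCLM_endComp,
        chartSymmDiff_chartDiff hφ hy, h.form_proj]
    ext a b
    rw [Matrix.transpose_apply, e, e, g.symm]
  have key : ∀ y₀ ∈ φ.target, ∃ W, IsOpen W ∧ y₀ ∈ W ∧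
      (∀ a b, ContDiffOn ℝ ∞ (fun y => endComp φ Pi y a b) W) ∧
      (endComp φ Pi y₀).trace = (N - p : ℕ) := by
    intro y₀ hy₀
    obtain ⟨W, hW, hyW, hWt, J, hJ, hJ'⟩ := h.exists_frame hF hφ hy₀
    let K : EuclideanSpace ℝ (Fin N) → Matrix (Fin (N - p)) (Fin (N - p)) ℝ := fun y =>
      (J y).transpose * (formComp φ (fun x u v => g.form x u v) y * J y)
    have hJt : ∀ k a, ContDiffOn ℝ ∞ (fun y => (J y).transpose k a) W := fun k a => hJ a k
    have hGW := fun a b => (hG.smooth a b).mono hWt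
    have hK := contDiffOn_matrix_inv (A := K)
      (contDiffOn_matrix_mul hJt (contDiffOn_matrix_mul hGW hJ)) fun y hy => (hJ' y hy).2.2
    have hKinv : ∀ y ∈ W, (K y)⁻¹ * K y = 1 := fun y hy =>
      Matrix.nonsing_inv_mul _ (isUnit_iff_ne_zero.2 (hJ' y hy).2.2)
    have hPi : ∀ y ∈ W, endComp φ Pi y = J y * ((K y)⁻¹ * ((J y).transpose *
        formComp φ (fun x u v => g.form x u v) y)) := fun y hy =>
      matrix_proj_eq (hG.transpose_eq (hWt hy)) (hsymm y (hWt hy)) (hJ' y hy).1 (hJ' y hy).2.1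
        (hKinv y hy)
    refine ⟨W, hW, hyW, fun a b => (contDiffOn_matrix_mul hJ (contDiffOn_matrix_mul hK
      (contDiffOn_matrix_mul hJt hGW)) a b).congr fun y hy => by rw [hPi y hy], ?_⟩
    rw [hPi y₀ hyW, Matrix.trace_mul_comm, Matrix.mul_assoc, Matrix.mul_assoc, hKinv y₀ hyW,
      Matrix.trace_one, Fintype.card_fin]
  exact
  { metric := hG
    smooth := fun a b y hy => by
      obtain ⟨W, hW, hyW, hs, -⟩ := key y hy
      exact ((hs a b).contDiffAt (hW.mem_nhds hyW)).contDiffWithinAt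
    add_eq_one := fun y hy => by
      refine matrix_eq_of_endCLM_eq fun u => ?_
      rw [endCLM_add, endCLM_endComp, endCLM_endComp, endCLM_one, ← map_add]
      have := congrArg (fun T => T (chartSymmDiff φ y u)) (h.add_eq_id (φ.symm y))
      simp only [LinearMap.add_apply, LinearMap.id_apply] at this
      rw [this, chartDiff_chartSymmDiff hφ hy]
    idem := fun y hy => by
      rw [endComp_mul hφ Pi Pi hy]
      congr 1
      funext x
      exact h.Pi_idem x
    symm := hsymm
    trace := fun y hy => (key y hy).choose_spec.2.2.2 }

end Foliation
end FoliationProjectors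

/-! ### Leaves in charts -/

section Leaves

variable {N p : ℕ} {V : Type*} [TopologicalSpace V]
  [ChartedSpace (EuclideanSpace ℝ (Fin N)) V] [IsManifold (𝓡 N) ∞ V]
  {g : PseudoRiemannianMetric N V} {F : Foliation N p V}
  {P Pi : ∀ x : V, TangentSpace (𝓡 N) x →ₗ[ℝ] TangentSpace (𝓡 N) x}
  {φ : OpenPartialHomeomorph V (EuclideanSpace ℝ (Fin N))}

namespace Foliation

variable {i : F.ι} {ψ : OpenPartialHomeomorph (F.Leaf i) (EuclideanSpace ℝ (Fin (N - p)))}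

/-- The parametrization of a leaf in the charts `ψ` of the leaf and `φ` of the manifold. -/
def leafMap (F : Foliation N p V) (i : F.ι)
    (ψ : OpenPartialHomeomorph (F.Leaf i) (EuclideanSpace ℝ (Fin (N - p))))
    (φ : OpenPartialHomeomorph V (EuclideanSpace ℝ (Fin N))) (s : EuclideanSpace ℝ (Fin (N - p))) :
    EuclideanSpace ℝ (Fin N) :=
  φ (F.incl i (ψ.symm s))

/-- The set on which `leafMap` is defined. -/
def leafDomain (F : Foliation N p V) (i : F.ι)
    (ψ : OpenPartialHomeomorph (F.Leaf i) (EuclideanSpace ℝ (Fin (N - p))))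
    (φ : OpenPartialHomeomorph V (EuclideanSpace ℝ (Fin N))) :
    Set (EuclideanSpace ℝ (Fin (N - p))) :=
  ψ.target ∩ ψ.symm ⁻¹' (F.incl i ⁻¹' φ.source)

theorem isOpen_leafDomain (i : F.ι)
    (ψ : OpenPartialHomeomorph (F.Leaf i) (EuclideanSpace ℝ (Fin (N - p))))
    (φ : OpenPartialHomeomorph V (EuclideanSpace ℝ (Fin N))) : IsOpen (F.leafDomain i ψ φ) :=
  ψ.isOpen_inter_preimage_symm
    (φ.open_source.preimage (F.isImmersion i).contMDiff.continuous)

theorem fderiv_leafMap (hψ : ψ ∈ IsManifold.maximalAtlas (𝓡 (N - p)) ∞ (F.Leaf i))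
    (hφ : φ ∈ IsManifold.maximalAtlas (𝓡 N) ∞ V) {s : EuclideanSpace ℝ (Fin (N - p))}
    (hs : s ∈ F.leafDomain i ψ φ) (v : EuclideanSpace ℝ (Fin (N - p))) :
    fderiv ℝ (F.leafMap i ψ φ) s v = chartDiff φ (F.incl i (ψ.symm s))
      (F.leafDiff i (ψ.symm s) (chartSymmDiff ψ s v)) := by
  have h1 := ((mdifferentiable_of_mem_maximalAtlas hψ).mdifferentiableAt_symm hs.1).hasMFDerivAt
  have h2 := ((F.isImmersion i).contMDiff.mdifferentiable (by simp) (ψ.symm s)).hasMFDerivAt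
  have h3 := ((mdifferentiable_of_mem_maximalAtlas hφ).mdifferentiableAt hs.2).hasMFDerivAt
  have h4 := (HasMFDerivAt.comp s h3 (HasMFDerivAt.comp s h2 h1)).mfderiv
  rw [← mfderiv_eq_fderiv]
  exact congrArg (fun T => T v) h4

theorem contDiffOn_leafMap (hψ : ψ ∈ IsManifold.maximalAtlas (𝓡 (N - p)) ∞ (F.Leaf i))
    (hφ : φ ∈ IsManifold.maximalAtlas (𝓡 N) ∞ V) :
    ContDiffOn ℝ ∞ (F.leafMap i ψ φ) (F.leafDomain i ψ φ) := by
  have h1 : ContMDiff (𝓡 (N - p)) (𝓡 N) ∞ (F.incl i) := (F.isImmersion i).contMDiff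
  have h2 : ContMDiffOn (𝓡 (N - p)) (𝓡 (N - p)) ∞ ψ.symm (F.leafDomain i ψ φ) :=
    (contMDiffOn_symm_of_mem_maximalAtlas hψ).mono Set.inter_subset_left
  have h3 : ContMDiffOn (𝓡 (N - p)) (𝓡 N) ∞ (F.leafMap i ψ φ) (F.leafDomain i ψ φ) :=
    (contMDiffOn_of_mem_maximalAtlas hφ).comp (h1.comp_contMDiffOn h2) fun s hs => hs.2
  exact h3.contDiffOn

theorem bilCLM_formComp_inducedMetric (g : PseudoRiemannianMetric N V)
    (s u v : EuclideanSpace ℝ (Fin (N - p))) :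
    bilCLM (formComp ψ (F.inducedMetric g i) s) u v = g.form (F.incl i (ψ.symm s))
      (F.leafDiff i (ψ.symm s) (chartSymmDiff ψ s u))
      (F.leafDiff i (ψ.symm s) (chartSymmDiff ψ s v)) :=
  bilCLM_formComp_of_isLinearMap (h := fun z u v => g.form (F.incl i z) (F.leafDiff i z u)
    (F.leafDiff i z v))
    (fun x v => ⟨fun a b => by rw [map_add, map_add, add_apply],
      fun c a => by rw [map_smul, map_smul, smul_apply]⟩)
    (fun x u => ⟨fun a b => by rw [map_add, map_add], fun c a => by rw [map_smul, map_smul]⟩)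
    s u v

theorem induced_leafMap (hψ : ψ ∈ IsManifold.maximalAtlas (𝓡 (N - p)) ∞ (F.Leaf i))
    (hφ : φ ∈ IsManifold.maximalAtlas (𝓡 N) ∞ V) {s : EuclideanSpace ℝ (Fin (N - p))}
    (hs : s ∈ F.leafDomain i ψ φ) (u v : EuclideanSpace ℝ (Fin (N - p))) :
    bilCLM (formComp φ (fun x u v => g.form x u v) (F.leafMap i ψ φ s))
      (fderiv ℝ (F.leafMap i ψ φ) s u) (fderiv ℝ (F.leafMap i ψ φ) s v)
      = bilCLM (formComp ψ (F.inducedMetric g i) s) u v := by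
  rw [fderiv_leafMap hψ hφ hs, fderiv_leafMap hψ hφ hs, leafMap,
    bilCLM_formComp_chartDiff hφ g.form hs.2, bilCLM_formComp_inducedMetric]

theorem isMetricOn_inducedMetric (hF : F.IsNondegenerate g)
    (hψ : ψ ∈ IsManifold.maximalAtlas (𝓡 (N - p)) ∞ (F.Leaf i))
    (hφ : φ ∈ IsManifold.maximalAtlas (𝓡 N) ∞ V) :
    IsMetricOn (formComp ψ (F.inducedMetric g i)) (F.leafDomain i ψ φ) where
  isOpen := isOpen_leafDomain i ψ φ
  smooth a b := by
    have hy := contDiffOn_leafMap hψ hφ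
    have hJ : ContDiffOn ℝ ∞ (fderiv ℝ (F.leafMap i ψ φ)) (F.leafDomain i ψ φ) :=
      hy.fderiv_of_isOpen (isOpen_leafDomain i ψ φ) (by simp)
    have hG := (contDiffOn_bilCLM (g.isMetricOn hφ).smooth).comp hy
      fun s hs => φ.map_source hs.2
    refine ((hG.clm_apply (hJ.clm_apply (contDiffOn_const (c := stdVec a)))).clm_apply
      (hJ.clm_apply (contDiffOn_const (c := stdVec b)))).congr fun s hs => ?_
    rw [← bilCLM_stdVec (formComp ψ (F.inducedMetric g i) s) a b, ← induced_leafMap hψ hφ hs]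
    rfl
  det_ne_zero s hs := by
    refine det_ne_zero_of_nondegenerate fun u hu => ?_
    have h0 : chartSymmDiff ψ s u = 0 := hF i _ _ fun w => by
      obtain ⟨v, rfl⟩ := chartSymmDiff_surjective hψ hs.1 w
      exact (bilCLM_formComp_inducedMetric g s u v).symm.trans (hu v)
    rw [← chartDiff_chartSymmDiff hψ hs.1 u, h0, map_zero]
  symm s _ a b := g.symm _ _ _

/-- The leaves are integral manifolds of the range of the projectors `Π`. -/
theorem IsProjectorPair.isLeafParam (hF : F.IsNondegenerate g) (h : F.IsProjectorPair g P Pi)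
    (hψ : ψ ∈ IsManifold.maximalAtlas (𝓡 (N - p)) ∞ (F.Leaf i))
    (hφ : φ ∈ IsManifold.maximalAtlas (𝓡 N) ∞ V) :
    IsLeafParam (formComp φ (fun x u v => g.form x u v)) (endComp φ Pi) φ.target
      (formComp ψ (F.inducedMetric g i)) (F.leafDomain i ψ φ) (F.leafMap i ψ φ) where
  metric := isMetricOn_inducedMetric hF hψ hφ
  smooth := contDiffOn_leafMap hψ hφ
  mapsTo s hs := φ.map_source hs.2
  induced s hs u v := induced_leafMap hψ hφ hs u v
  tangent s hs v := by
    rw [fderiv_leafMap hψ hφ hs, leafMap, endCLM_endComp_chartDiff hφ Pi hs.2,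
      h.proj_of_mem (F.leafDiff_mem_dist _ _ _)]
  surj s hs w := by
    obtain ⟨u, rfl⟩ := chartDiff_surjective hφ hs.2 w
    obtain ⟨u', hu'⟩ := exists_leafDiff_eq (h.proj_mem _ u)
    obtain ⟨v, hv⟩ := chartSymmDiff_surjective hψ hs.1 u'
    exact ⟨v, by rw [fderiv_leafMap hψ hφ hs, leafMap, endCLM_endComp_chartDiff hφ Pi hs.2, hv,
      hu']⟩

/-- Conformal flatness of the leaves, in terms of a pointwise condition that is necessary for local
conformal flatness of a metric in coordinates and, when it holds on an open set, sufficient. -/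
theorem leavesConformallyFlat_iff (hF : F.IsNondegenerate g)
    {T : OpenPartialHomeomorph V (EuclideanSpace ℝ (Fin N)) → EuclideanSpace ℝ (Fin N) → Prop}
    {C : (EuclideanSpace ℝ (Fin (N - p)) → Matrix (Fin (N - p)) (Fin (N - p)) ℝ) →
      EuclideanSpace ℝ (Fin (N - p)) → Prop}
    (hTC : ∀ φ ∈ IsManifold.maximalAtlas (𝓡 N) ∞ V, ∀ i,
      ∀ ψ ∈ IsManifold.maximalAtlas (𝓡 (N - p)) ∞ (F.Leaf i), ∀ s ∈ F.leafDomain i ψ φ,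
      (T φ (F.leafMap i ψ φ s) ↔ C (formComp ψ (F.inducedMetric g i)) s))
    (hflat : ∀ H U, IsMetricOn H U → ∀ f : EuclideanSpace ℝ (Fin (N - p)) → ℝ,
      ContDiffOn ℝ ∞ f U → (∀ x ∈ U, ∀ a b c d,
        curvature (christoffel (fun z => Real.exp (2 * f z) • H z)) x a b c d = 0) →
      ∀ x ∈ U, C H x)
    (hex : ∀ H U, IsMetricOn H U → (∀ x ∈ U, C H x) → ∀ x₀ ∈ U, ∃ r > 0, Metric.ball x₀ r ⊆ U ∧
      ∃ f : EuclideanSpace ℝ (Fin (N - p)) → ℝ, ContDiffOn ℝ ∞ f (Metric.ball x₀ r) ∧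
        ∀ x ∈ Metric.ball x₀ r, ∀ a b c d,
          curvature (christoffel (fun z => Real.exp (2 * f z) • H z)) x a b c d = 0) :
    F.LeavesConformallyFlat g ↔
      ∀ φ ∈ IsManifold.maximalAtlas (𝓡 N) ∞ V, ∀ y ∈ φ.target, T φ y := by
  constructor
  · intro hL φ hφ y hy
    obtain ⟨i, z, hz⟩ := F.exists_incl_eq (φ.symm y)
    obtain ⟨ψ, hψ, hzψ, f, hf, hflatf⟩ := hL i z
    have hs : ψ z ∈ F.leafDomain i ψ φ := by
      refine ⟨ψ.map_source hzψ, ?_⟩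
      rw [Set.mem_preimage, ψ.left_inv hzψ, Set.mem_preimage, hz]
      exact φ.map_target hy
    have hy' : F.leafMap i ψ φ (ψ z) = y := by
      rw [leafMap, ψ.left_inv hzψ, hz, φ.right_inv hy]
    rw [← hy', hTC φ hφ i ψ hψ _ hs]
    exact hflat _ _ (isMetricOn_inducedMetric hF hψ hφ) f (hf.mono Set.inter_subset_left)
      (fun x hx => hflatf x hx.1) _ hs
  · intro hT i z
    let ψ := chartAt (EuclideanSpace ℝ (Fin (N - p))) z
    let φ := chartAt (EuclideanSpace ℝ (Fin N)) (F.incl i z)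
    have hψ : ψ ∈ IsManifold.maximalAtlas (𝓡 (N - p)) ∞ (F.Leaf i) :=
      IsManifold.chart_mem_maximalAtlas z
    have hφ : φ ∈ IsManifold.maximalAtlas (𝓡 N) ∞ V := IsManifold.chart_mem_maximalAtlas _
    have hzψ : z ∈ ψ.source := mem_chart_source _ z
    have hs : ψ z ∈ F.leafDomain i ψ φ := by
      refine ⟨ψ.map_source hzψ, ?_⟩
      rw [Set.mem_preimage, ψ.left_inv hzψ, Set.mem_preimage]
      exact mem_chart_source _ _
    obtain ⟨r, hr, hrU, f, hf, hflatf⟩ := hex _ _ (isMetricOn_inducedMetric hF hψ hφ)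
      (fun s hs => (hTC φ hφ i ψ hψ s hs).1 (hT φ hφ _ (φ.map_source hs.2))) _ hs
    have hopen : IsOpen (ψ.source ∩ ψ ⁻¹' Metric.ball (ψ z) r) :=
      ψ.isOpen_inter_preimage Metric.isOpen_ball
    have htarget : (ψ.restr (ψ.source ∩ ψ ⁻¹' Metric.ball (ψ z) r)).target
        ⊆ Metric.ball (ψ z) r := by
      intro s hs
      rw [ψ.restr_target, hopen.interior_eq] at hs
      have := hs.2.2
      rwa [Set.mem_preimage, ψ.right_inv hs.1] at this
    refine ⟨ψ.restr (ψ.source ∩ ψ ⁻¹' Metric.ball (ψ z) r),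
      restr_mem_maximalAtlas _ hψ hopen, ?_, f, hf.mono htarget,
      fun s hs => hflatf s (htarget hs)⟩
    rw [ψ.restr_source, hopen.interior_eq]
    exact ⟨hzψ, hzψ, Metric.mem_ball_self hr⟩

end Foliation
end Leaves

end BiConformal

end

theorem theorem1 {N p : ℕ} (hp : 0 < p) {V : Type*} [TopologicalSpace V]
    [ChartedSpace (EuclideanSpace ℝ (Fin N)) V] [IsManifold (𝓡 N) ∞ V]
    (g : BiConformal.PseudoRiemannianMetric N V) (F : BiConformal.Foliation N p V)
    (hF : F.IsNondegenerate g)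
    (P Pi : ∀ x : V, TangentSpace (𝓡 N) x →ₗ[ℝ] TangentSpace (𝓡 N) x)
    (hPPi : F.IsProjectorPair g P Pi) :
    (3 < N - p → (F.LeavesConformallyFlat g ↔ BiConformal.TParVanishes p g P Pi)) ∧
    (N - p = 3 → (F.LeavesConformallyFlat g ↔ BiConformal.BParVanishes p g P Pi)) := by
  have hcast : 3 ≤ N - p → (N : ℝ) - p = (N - p : ℕ) := fun hn => by
    rw [Nat.cast_sub (by omega)]
  constructor
  · intro hn
    exact BiConformal.Foliation.leavesConformallyFlat_iff
      (C := fun H x => BiConformal.WeylFreeComp H x) hF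
      (fun φ hφ i ψ hψ s hs => (hPPi.isLeafParam hF hψ hφ).tensorTPar_eq_zero_iff
        (hPPi.isProjectorPairOn hF hφ) hn.le (hcast hn.le) hs)
      (fun H U hH f hf h x hx => (hH.weylFree_cottonFree_of_flat hn.le hf h hx).1)
      (fun H U hH hW x hx => hH.exists_flat_of_weylFree hn hW hx)
  · intro hn
    exact BiConformal.Foliation.leavesConformallyFlat_iff
      (C := fun H x => BiConformal.CottonFreeComp H x) hF
      (fun φ hφ i ψ hψ s hs => (hPPi.isLeafParam hF hψ hφ).tensorBPar_eq_zero_iff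
        (hPPi.isProjectorPairOn hF hφ) hn.ge (hcast hn.ge) hs)
      (fun H U hH f hf h x hx => (hH.weylFree_cottonFree_of_flat hn.ge hf h hx).2)
      (fun H U hH hC x hx => hH.exists_flat_of_cottonFree hn hC hx)
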